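/- Let $C$ and $V\neq 0$ be finite-dimensional real Euclidean spaces, let $\mathbf 1\in C$ be a unit vector, and let $C\times V\to V$, $(\zeta,v)\mapsto \zeta v$, be a bilinear map with $\mathbf 1v=v$, $|\zeta v|=|\zeta||v|$ and $C(Cv)=Cv$ for all $\zeta\in C$, $v\in V$, where $Cv=\{\zeta v:\zeta\in C\}$. For $\zeta=a\mathbf 1+z$ with $a\in\mathbb R$, $z\perp\mathbf 1$, put $\bar\zeta=a\mathbf 1-z$, and $\zeta^{-1}=|\zeta|^{-2}\bar\zeta$ if $\zeta\ne0$. Let $W=C\oplus V$ (orthogonal direct sum). On $W\setminus\{0\}$ let $\sim$ be the equivalence relation for which $(0,u)\sim(0,v)$ if $u\in Cv$, and, for $\zeta\neq0$, $(\eta,u)\sim(\zeta,v)$ if $\eta\ne0$ and $\eta^{-1}u=\zeta^{-1}v$. For $w\ne0$ let $Cw\subset W$ be the class of $w$ together with $0$ (a linear subspace); put $C0=\{0\}$. The affine $C$-lines are the sets $w_0+Cw$ with $w\neq 0$. Let $\pi: W\setminus\{0\}\to W_\infty=(W\setminus\{0\})/\!\sim$, $\pi(w)=[w]$, be the quotient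 map, give $W_\infty$ the quotient topology, and let $CPW=W\sqcup W_\infty$, with the topology in which points of $W$ have their Euclidean neighbourhoods, and $p\in W_\infty$ has the neighbourhood basis $A\cup\{w\in\pi^{-1}(A):|w|>R\}$, where $R>0$ and $A$ is a neighbourhood of $p$ in $W_\infty$. The differentiable structure of $CPW$ is given by the parametrizations $W\to CPW$ (inverses of charts) consisting of the inclusion; of $\varphi_0$, where $\varphi_0(\zeta,v)=(\zeta^{-1},\zeta^{-1}v)$ for $\zeta\neq0$ and $\varphi_0(0,v)=[\mathbf 1,v]$; and, for every unit vector $v\in V$, of $\varphi_v$, where for $v'\perp Cv$ $$\varphi_v(\zeta,\eta v+v')=(\xi,\ \eta^{-1}v+\eta^{-1}v')\ \text{ with } \xi v=\eta^{-1}(\zeta v),\ \text{ if }\eta\neq0,\qquad \varphi_v(\zeta,v')=[\zeta,v+v'].$$ The Riemannian metric of $CPW$ is the one for which all these parametrizations are isometric, where $W$ carries the metric that at $w$ equals $\langle X,Y\rangle/(1+|w|^2)^2$ on $Cw$ and $\langle X,Y\rangle/(1+|w|^2)$ on $(Cw)^\perp$, with $Cw$ and $(Cw)^\perp$ orthogonal.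 The projective $C$-lines are the closures in $CPW$ of the affine $C$-lines of $W$ and the images of these closures under isometries of $CPW$. A collineation is a homeomorphism of $CPW$ onto itself that maps projective $C$-lines onto projective $C$-lines. **Theorem.** The action of every collineation $g$ on projective $C$-lines is conformal: for every projective $C$-line $L$, the restriction $g|_L:L\to g(L)$ is a smooth map between submanifolds of $CPW$, and for the induced Riemannian metrics its differential at every point $p\in L$ is a positive scalar multiple of a linear isometry of $T_pL$ onto $T_{g(p)}g(L)$. -/

import Mathlib

open scoped ContDiff Topology

noncomputable section

/-- A `C`-module structure on `V` satisfying the `J²`-condition: `C`, `V` are Euclidean spaces,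
`one` is a unit vector of `C`, and `J : C × V → V` is bilinear with `J(1,v) = v`,
`|J(ζ,v)| = |ζ||v|` and `C(Cv) = Cv`, where `Cv = {J(ζ,v) : ζ ∈ C}`. -/
structure J2CModule (C V : Type*) [NormedAddCommGroup C] [InnerProductSpace ℝ C]
    [NormedAddCommGroup V] [InnerProductSpace ℝ V] where
  one : C
  norm_one : ‖one‖ = 1
  J : C →ₗ[ℝ] V →ₗ[ℝ] V
  J_one : ∀ v, J one v = v
  norm_J : ∀ ζ v, ‖J ζ v‖ = ‖ζ‖ * ‖v‖
  J_sq : ∀ v, {x : V | ∃ ζ : C, ∃ u ∈ Set.range (fun η => J η v), x = J ζ u}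
    = Set.range (fun η => J η v)

/-- The Euclidean direct sum `W = C ⊕ V`. -/
abbrev WSpace (C V : Type*) : Type _ := WithLp 2 (C × V)

namespace J2CModule

variable {C V : Type*} [NormedAddCommGroup C] [InnerProductSpace ℝ C]
  [NormedAddCommGroup V] [InnerProductSpace ℝ V] (M : J2CModule C V)

/-- The conjugate `a 1 - z` of `a 1 + z`, for `a ∈ ℝ` and `z ⊥ 1`. -/
def conj (ζ : C) : C := (2 * inner ℝ M.one ζ) • M.one - ζ

/-- `ζ⁻¹ = |ζ|⁻² ζ̄` (used only for `ζ ≠ 0`). -/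
def inv (ζ : C) : C := (‖ζ‖ ^ 2)⁻¹ • M.conj ζ

lemma inner_J_same (ζ : C) (u v : V) :
    inner ℝ (M.J ζ u) (M.J ζ v) = ‖ζ‖ ^ 2 * inner ℝ u v := by
  have h := M.norm_J ζ (u + v)
  have h2 : ‖M.J ζ (u + v)‖ ^ 2 = (‖ζ‖ * ‖u + v‖) ^ 2 := by rw [h]
  rw [map_add, mul_pow, norm_add_sq_real, norm_add_sq_real, M.norm_J, M.norm_J] at h2
  linarith

lemma inner_J_polar (ζ η : C) (u v : V) :
    inner ℝ (M.J ζ u) (M.J η v) + inner ℝ (M.J η u) (M.J ζ v)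
      = 2 * inner ℝ ζ η * inner ℝ u v := by
  have h := M.inner_J_same (ζ + η) u v
  have h1 := M.inner_J_same ζ u v
  have h2 := M.inner_J_same η u v
  rw [norm_add_sq_real, map_add, LinearMap.add_apply, LinearMap.add_apply, inner_add_left,
    inner_add_right, inner_add_right] at h
  linarith

lemma J_conj_J (ζ : C) (v : V) : M.J (M.conj ζ) (M.J ζ v) = (‖ζ‖ ^ 2) • v := by
  refine ext_inner_right ℝ fun u => ?_
  have h := M.inner_J_polar M.one ζ (M.J ζ v) u
  rw [M.J_one, M.J_one, M.inner_J_same] at h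
  rw [conj, map_sub, map_smul, LinearMap.sub_apply, LinearMap.smul_apply, M.J_one,
    inner_sub_left, inner_smul_left, inner_smul_left]
  simp only [conj_trivial]
  linarith

lemma norm_conj (ζ : C) : ‖M.conj ζ‖ = ‖ζ‖ := by
  have h : ‖M.conj ζ‖ ^ 2 = ‖ζ‖ ^ 2 := by
    rw [conj, norm_sub_sq_real, norm_smul, inner_smul_left, M.norm_one]
    simp only [conj_trivial, Real.norm_eq_abs, mul_one, sq_abs]
    ring
  exact (sq_eq_sq₀ (norm_nonneg _) (norm_nonneg _)).1 h

lemma conj_conj (ζ : C) : M.conj (M.conj ζ) = ζ := by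
  have h : inner ℝ M.one M.one = (1 : ℝ) := by
    rw [real_inner_self_eq_norm_sq, M.norm_one]; norm_num
  simp only [conj, inner_sub_right, inner_smul_right, h]
  module

lemma J_inv_J {ζ : C} (hζ : ζ ≠ 0) (v : V) : M.J (M.inv ζ) (M.J ζ v) = v := by
  have h : ‖ζ‖ ^ 2 ≠ 0 := pow_ne_zero _ (norm_ne_zero_iff.2 hζ)
  rw [inv, map_smul, LinearMap.smul_apply, M.J_conj_J, inv_smul_smul₀ h]

lemma J_J_inv {ζ : C} (hζ : ζ ≠ 0) (v : V) : M.J ζ (M.J (M.inv ζ) v) = v := by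
  have h : ‖ζ‖ ^ 2 ≠ 0 := pow_ne_zero _ (norm_ne_zero_iff.2 hζ)
  have h1 := M.J_conj_J (M.conj ζ) v
  rw [M.conj_conj, M.norm_conj] at h1
  rw [inv, map_smul, LinearMap.smul_apply, map_smul, h1, inv_smul_smul₀ h]

lemma exists_J_J (ζ η : C) (v : V) : ∃ ξ, M.J ζ (M.J η v) = M.J ξ v := by
  have h : M.J ζ (M.J η v) ∈ Set.range (fun η => M.J η v) := by
    rw [← M.J_sq v]; exact ⟨ζ, _, ⟨η, rfl⟩, rfl⟩
  obtain ⟨ξ, h⟩ := h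
  exact ⟨ξ, h.symm⟩

/-- The relation `∼` on `W`: `(0,u) ∼ (0,v)` if `u ∈ Cv`, and for `ζ ≠ 0`,
`(η,u) ∼ (ζ,v)` if `η ≠ 0` and `η⁻¹u = ζ⁻¹v`. -/
def Rel (w w' : WSpace C V) : Prop :=
  (w.fst = 0 ∧ w'.fst = 0 ∧ ∃ ξ, w.snd = M.J ξ w'.snd) ∨
    (w'.fst ≠ 0 ∧ w.fst ≠ 0 ∧ M.J (M.inv w.fst) w.snd = M.J (M.inv w'.fst) w'.snd)

/-- The equivalence relation `∼` on `W ∖ {0}`. -/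
def setoid : Setoid {w : WSpace C V // w ≠ 0} where
  r w w' := M.Rel w w'
  iseqv :=
    { refl := fun w => by
        by_cases h : w.1.fst = 0
        · exact Or.inl ⟨h, h, M.one, (M.J_one _).symm⟩
        · exact Or.inr ⟨h, h, rfl⟩
      symm := by
        rintro ⟨w, hw⟩ ⟨w', hw'⟩ (⟨h, h', ξ, hξ⟩ | ⟨h, h', e⟩)
        · refine Or.inl ⟨h', h, M.inv ξ, ?_⟩
          have hξ0 : ξ ≠ 0 := by
            rintro rfl
            apply hw
            have h2 : w.snd = 0 := by simpa using hξ
            apply (WithLp.ofLp_injective 2)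
            exact Prod.ext h h2
          change w'.snd = M.J (M.inv ξ) w.snd
          rw [show w.snd = M.J ξ w'.snd from hξ, M.J_inv_J hξ0]
        · exact Or.inr ⟨h', h, e.symm⟩
      trans := by
        rintro ⟨a, ha⟩ ⟨b, hb⟩ ⟨c, hc⟩ (⟨h, h', ξ, hξ⟩ | ⟨h, h', e⟩)
          (⟨k, k', ξ', hξ'⟩ | ⟨k, k', e'⟩)
        · obtain ⟨θ, hθ⟩ := M.exists_J_J ξ ξ' c.snd
          refine Or.inl ⟨h, k', θ, ?_⟩
          rw [← hθ, ← hξ']; exact hξ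
        · exact absurd h' k'
        · exact absurd k h
        · exact Or.inr ⟨k, h', e.trans e'⟩ }

/-- `W_∞ = (W ∖ {0}) / ∼`, with the quotient topology. -/
def WInf : Type _ := Quotient M.setoid

instance : TopologicalSpace M.WInf := inferInstanceAs (TopologicalSpace (Quotient M.setoid))

/-- The quotient map `π : W ∖ {0} → W_∞`. -/
def proj (w : WSpace C V) (hw : w ≠ 0) : M.WInf := Quotient.mk M.setoid ⟨w, hw⟩

/-- `CPW = W ∪ W_∞` (disjoint union of sets; the topology is given below). -/
inductive CPW : Type _
  | fin (w : WSpace C V) : CPW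
  | inf (p : M.WInf) : CPW

/-- The topology of `CPW`. Neighbourhoods of `w ∈ W` are its Euclidean neighbourhoods; basic
neighbourhoods of `p ∈ W_∞` are `U ∪ {w ∈ π⁻¹(U) : |w| > R}`, with `R > 0` and `U` an open
neighbourhood of `p` in `W_∞`. -/
instance : TopologicalSpace M.CPW where
  IsOpen S := (∀ w, CPW.fin w ∈ S → ∀ᶠ w' in 𝓝 w, CPW.fin w' ∈ S) ∧
    ∀ p, CPW.inf p ∈ S → ∃ U : Set M.WInf, IsOpen U ∧ p ∈ U ∧ ∃ R : ℝ, 0 < R ∧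
      (∀ q ∈ U, CPW.inf q ∈ S) ∧
      ∀ (w : WSpace C V) (hw : w ≠ 0), M.proj w hw ∈ U → R < ‖w‖ → CPW.fin w ∈ S
  isOpen_univ := ⟨fun _ _ => Filter.Eventually.of_forall fun _ => trivial,
    fun _ _ => ⟨Set.univ, isOpen_univ, trivial, 1, one_pos, fun _ _ => trivial,
      fun _ _ _ _ => trivial⟩⟩
  isOpen_inter := by
    rintro S T ⟨hS, hS'⟩ ⟨hT, hT'⟩
    refine ⟨fun w hw => (hS w hw.1).and (hT w hw.2), fun p hp => ?_⟩
    obtain ⟨U, hU, hpU, R, hR, h1, h2⟩ := hS' p hp.1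
    obtain ⟨U', hU', hpU', R', hR', h1', h2'⟩ := hT' p hp.2
    exact ⟨U ∩ U', hU.inter hU', ⟨hpU, hpU'⟩, max R R', lt_max_of_lt_left hR,
      fun q hq => ⟨h1 q hq.1, h1' q hq.2⟩,
      fun w hw hwU hwR => ⟨h2 w hw hwU.1 ((le_max_left _ _).trans_lt hwR),
        h2' w hw hwU.2 ((le_max_right _ _).trans_lt hwR)⟩⟩
  isOpen_sUnion := by
    intro 𝒮 h𝒮
    refine ⟨fun w ⟨S, hS, h⟩ => ((h𝒮 S hS).1 w h).mono fun _ h' => ⟨S, hS, h'⟩,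
      fun p ⟨S, hS, hp⟩ => ?_⟩
    obtain ⟨U, hU, hpU, R, hR, h1, h2⟩ := (h𝒮 S hS).2 p hp
    exact ⟨U, hU, hpU, R, hR, fun q hq => ⟨S, hS, h1 q hq⟩,
      fun w h0 hwU hwR => ⟨S, hS, h2 w h0 hwU hwR⟩⟩

open Classical in
/-- A linear parametrization of the `C`-line `Cw` through `w = (ζ,v)`:
`λ ↦ (0, λv)` if `ζ = 0` and `λ ↦ (λ, λ(ζ⁻¹v))` if `ζ ≠ 0`. -/
def lineMap (w : WSpace C V) : C →ₗ[ℝ] WSpace C V :=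
  (WithLp.linearEquiv 2 ℝ (C × V)).symm.toLinearMap ∘ₗ
    (if w.fst = 0 then LinearMap.prod 0 (M.J.flip w.snd)
      else LinearMap.prod LinearMap.id (M.J.flip (M.J (M.inv w.fst) w.snd)))

/-- The `C`-line `Cw` through the origin and `w`, as a real linear subspace of `W`; by
`mem_line_iff` it is the equivalence class of `w` together with `0`.  (For `w = 0` it is `{0}`.) -/
def line (w : WSpace C V) : Submodule ℝ (WSpace C V) := LinearMap.range (M.lineMap w)

lemma mem_line_iff {w : WSpace C V} (hw : w ≠ 0) (x : WSpace C V) :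
    x ∈ M.line w ↔ x = 0 ∨ x ≠ 0 ∧ M.Rel x w := by
  have hext : ∀ a b : WSpace C V, a = b ↔ a.fst = b.fst ∧ a.snd = b.snd := fun a b =>
    ⟨fun h => h ▸ ⟨rfl, rfl⟩, fun h => WithLp.ofLp_injective 2 (Prod.ext h.1 h.2)⟩
  by_cases h : w.fst = 0
  · have hm : ∀ ξ, M.lineMap w ξ = WithLp.toLp 2 (0, M.J ξ w.snd) := by
      intro ξ; simp [lineMap, h]
    constructor
    · rintro ⟨ξ, rfl⟩
      by_cases h0 : M.lineMap w ξ = 0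
      · exact Or.inl h0
      · refine Or.inr ⟨h0, Or.inl ⟨?_, h, ξ, ?_⟩⟩ <;> simp [hm]
    · rintro (rfl | ⟨_, ⟨h1, _, ξ, h2⟩ | ⟨h1, _⟩⟩)
      · exact Submodule.zero_mem _
      · exact ⟨ξ, by rw [hm, hext]; exact ⟨h1.symm, h2.symm⟩⟩
      · exact absurd h h1
  · have hm : ∀ ξ, M.lineMap w ξ = WithLp.toLp 2 (ξ, M.J ξ (M.J (M.inv w.fst) w.snd)) := by
      intro ξ; simp [lineMap, h]
    constructor
    · rintro ⟨ξ, rfl⟩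
      by_cases h0 : M.lineMap w ξ = 0
      · exact Or.inl h0
      · have hξ : ξ ≠ 0 := by
          rintro rfl; exact h0 (map_zero _)
        refine Or.inr ⟨h0, Or.inr ⟨h, ?_, ?_⟩⟩
        · simpa [hm] using hξ
        · simp [hm, M.J_inv_J hξ]
    · rintro (rfl | ⟨_, ⟨_, h1, _⟩ | ⟨_, h1, h2⟩⟩)
      · exact Submodule.zero_mem _
      · exact absurd h1 h
      · refine ⟨x.fst, ?_⟩
        rw [hm, hext]
        refine ⟨rfl, ?_⟩
        change M.J x.fst (M.J (M.inv w.fst) w.snd) = x.snd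
        rw [← h2, M.J_J_inv h1]

/-- The affine `C`-line `w₀ + Cw`. -/
def affineLine (w₀ w : WSpace C V) : Set (WSpace C V) := {x | ∃ y ∈ M.line w, x = w₀ + y}

lemma chartZero_aux (v : V) : (WithLp.toLp 2 (M.one, v) : WSpace C V) ≠ 0 := by
  intro h0
  have h1 : M.one = 0 := congrArg WithLp.fst h0
  have h2 := M.norm_one
  rw [h1, norm_zero] at h2
  exact zero_ne_one h2

variable [FiniteDimensional ℝ C] [FiniteDimensional ℝ V]

/-- The Riemannian metric of `W` at `w`: on `Cw` it is `⟨X,Y⟩ / (1+|w|²)²`, on `(Cw)^⊥` it is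
`⟨X,Y⟩ / (1+|w|²)`, and these two subspaces are orthogonal.  At `w = 0` it is `⟨X,Y⟩`. -/
def metric (w X Y : WSpace C V) : ℝ :=
  inner ℝ ((M.line w).starProjection X) ((M.line w).starProjection Y) / (1 + ‖w‖ ^ 2) ^ 2
    + inner ℝ (X - (M.line w).starProjection X) (Y - (M.line w).starProjection Y) / (1 + ‖w‖ ^ 2)

/-- For a unit vector `v`, `coord v x` is the element `η` in the decomposition
`x = ηv + v'`, `v' ⊥ Cv`: the map `coord v` is the adjoint of the isometry `ζ ↦ ζv`. -/
def coord (v : V) : V →ₗ[ℝ] C := LinearMap.adjoint (M.J.flip v)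

lemma coord_add {v : V} (hv : ‖v‖ = 1) (η : C) {v' : V} (hv' : ∀ ζ, inner ℝ (M.J ζ v) v' = 0) :
    M.coord v (M.J η v + v') = η := by
  refine ext_inner_left ℝ fun ζ => ?_
  rw [coord, LinearMap.adjoint_inner_right, LinearMap.flip_apply, inner_add_right, hv', add_zero]
  have h : ∀ ξ, ‖M.J ξ v‖ = ‖ξ‖ := fun ξ => by rw [M.norm_J, hv, mul_one]
  have h1 := h (ζ + η)
  have h2 : ‖M.J (ζ + η) v‖ ^ 2 = ‖ζ + η‖ ^ 2 := by rw [h1]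
  rw [map_add, LinearMap.add_apply, norm_add_sq_real, norm_add_sq_real, h, h] at h2
  linarith

lemma chartVec_aux {v : V} (hv : ‖v‖ = 1) {w : WSpace C V} (h : M.coord v w.snd = 0) :
    (WithLp.toLp 2 (w.fst, v + w.snd) : WSpace C V) ≠ 0 := by
  intro h0
  have h1 : v + w.snd = 0 := congrArg WithLp.snd h0
  have h2 : inner ℝ v w.snd = 0 := by
    have h3 : inner ℝ M.one (M.coord v w.snd) = 0 := by rw [h, inner_zero_right]
    rwa [coord, LinearMap.adjoint_inner_right, LinearMap.flip_apply, M.J_one] at h3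
  have h4 : inner ℝ v (v + w.snd) = 0 := by rw [h1, inner_zero_right]
  rw [inner_add_right, h2, real_inner_self_eq_norm_sq, hv] at h4
  norm_num at h4

open Classical in
/-- The parametrization `φ₀ : W → CPW`, with `φ₀(ζ,v) = (ζ⁻¹, ζ⁻¹v)` if `ζ ≠ 0` and
`φ₀(0,v) = [1,v]`. -/
def chartZero (w : WSpace C V) : M.CPW :=
  if w.fst = 0 then .inf (M.proj (WithLp.toLp 2 (M.one, w.snd)) (M.chartZero_aux w.snd))
  else .fin (WithLp.toLp 2 (M.inv w.fst, M.J (M.inv w.fst) w.snd))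

open Classical in
/-- The parametrization `φ_v : W → CPW` attached to a unit vector `v` of `V`.  For `v' ⊥ Cv`,
`φ_v(ζ, ηv + v') = (η⁻¹ ·_v ζ, η⁻¹v + η⁻¹v')` if `η ≠ 0`, and `φ_v(ζ, v') = [ζ, v + v']`
(which is `[1, ζ⁻¹(v + v')]` if `ζ ≠ 0`).
Here `η⁻¹ ·_v ζ` is the element of `C` with `(η⁻¹ ·_v ζ)v = η⁻¹(ζv)`. -/
def chartVec (v : V) (hv : ‖v‖ = 1) (w : WSpace C V) : M.CPW :=
  if h : M.coord v w.snd = 0 then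
    .inf (M.proj (WithLp.toLp 2 (w.fst, v + w.snd)) (M.chartVec_aux hv h))
  else
    let η := M.coord v w.snd
    .fin (WithLp.toLp 2 (M.coord v (M.J (M.inv η) (M.J w.fst v)),
      M.J (M.inv η) v + M.J (M.inv η) (w.snd - M.J η v)))

/-- The atlas of `CPW`, given by the inverse charts `W → CPW`: the inclusion of `W`, `φ₀`, and the
`φ_v` for all unit vectors `v` of `V`.  The members of an orthonormal `C`-basis of `V` would
suffice as vectors `v`, and all choices give the same differentiable structure. -/
def atlas : Set (WSpace C V → M.CPW) :=
  {CPW.fin, M.chartZero} ∪ {φ | ∃ (v : V) (hv : ‖v‖ = 1), φ = M.chartVec v hv}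

lemma exists_atlas (p : M.CPW) : ∃ φ ∈ M.atlas, ∃ x, φ x = p := by
  rcases p with w | q
  · exact ⟨CPW.fin, Or.inl (Or.inl rfl), w, rfl⟩
  · induction q using Quotient.inductionOn with
    | h w =>
      obtain ⟨w, hw⟩ := w
      by_cases h : w.fst = 0
      · have h2 : w.snd ≠ 0 := fun h2 => hw (WithLp.ofLp_injective 2 (Prod.ext h h2))
        have h3 : ‖w.snd‖ ≠ 0 := norm_ne_zero_iff.2 h2
        have hv : ‖‖w.snd‖⁻¹ • w.snd‖ = 1 := by
          rw [norm_smul, norm_inv, norm_norm, inv_mul_cancel₀ h3]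
        refine ⟨M.chartVec _ hv, Or.inr ⟨_, hv, rfl⟩, 0, ?_⟩
        have h4 : M.coord (‖w.snd‖⁻¹ • w.snd) (0 : WSpace C V).snd = 0 := map_zero _
        rw [chartVec, dif_pos h4, proj]
        refine congrArg CPW.inf (Quotient.sound (Or.inl ⟨rfl, h, ‖w.snd‖⁻¹ • M.one, ?_⟩))
        simp [M.J_one]
      · refine ⟨M.chartZero, Or.inl (Or.inr rfl), WithLp.toLp 2 (0, M.J (M.inv w.fst) w.snd), ?_⟩
        refine (if_pos rfl).trans ?_
        have h1 : M.one ≠ 0 := fun h => by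
          have := M.norm_one
          rw [h, norm_zero] at this
          exact zero_ne_one this
        refine congrArg CPW.inf (Quotient.sound (Or.inr ⟨h, h1, ?_⟩))
        have h5 := M.J_inv_J h1 (M.J (M.inv w.fst) w.snd)
        rw [M.J_one] at h5
        exact h5

/-- `u` is an isometry of the Riemannian manifold `CPW`, whose metric is given by `metric` in each
chart of the atlas: `u` is a homeomorphism which, read in any charts `φ` of the source and `ψ` of
the target, is a smooth map `F` whose differential preserves the metric.  (Such a map is a
diffeomorphism, by the inverse function theorem.) -/
def IsIsom (u : M.CPW ≃ₜ M.CPW) : Prop :=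
  ∀ φ ∈ M.atlas, ∀ ψ ∈ M.atlas, ∀ x y : WSpace C V, u (φ x) = ψ y →
    ∃ F : WSpace C V → WSpace C V, F x = y ∧ ContDiffAt ℝ ∞ F x ∧
      (∀ᶠ x' in 𝓝 x, u (φ x') = ψ (F x')) ∧
      ∀ X Y, M.metric y (fderiv ℝ F x X) (fderiv ℝ F x Y) = M.metric x X Y

/-- Projective `C`-lines: the closures in `CPW` of the affine `C`-lines of `W`, and the images of
these under isometries of `CPW`. -/
def IsProjLine (L : Set M.CPW) : Prop :=
  ∃ u : M.CPW ≃ₜ M.CPW, M.IsIsom u ∧ ∃ w₀ w : WSpace C V, w ≠ 0 ∧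
    L = u '' closure (CPW.fin '' M.affineLine w₀ w)

/-- Collineations: homeomorphisms of `CPW` that map projective `C`-lines onto projective
`C`-lines. -/
def IsCollineation (g : M.CPW ≃ₜ M.CPW) : Prop :=
  ∀ L, M.IsProjLine L → M.IsProjLine (g '' L)

/-- The tangent space, read in the chart `φ`, of a submanifold `L` of `CPW` at the point `φ x` of
`L`: the set of velocities at `x` of smooth curves in `φ⁻¹(L)`. -/
def tangent (φ : WSpace C V → M.CPW) (L : Set M.CPW) (x : WSpace C V) : Set (WSpace C V) :=
  {X | ∃ γ : ℝ → WSpace C V, γ 0 = x ∧ ContDiffAt ℝ ∞ γ 0 ∧ deriv γ 0 = X ∧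
    ∀ᶠ t in 𝓝 (0 : ℝ), φ (γ t) ∈ L}

/-- The restriction of `g` to the submanifold `L`, as a map from `L` to the submanifold `g(L)`, is
conformal for the Riemannian metrics induced from `CPW`.  In any charts `φ`, `ψ` of `CPW` at a
point of `L` and at its image, the restriction of `g` to `L` is smooth, i.e. it is locally the
restriction to `L` of a smooth map `F`, and its differential is a positive multiple of a linear
isometry of the tangent space of `L` onto the tangent space of `g(L)`. -/
def IsConformalOn (g : M.CPW → M.CPW) (L : Set M.CPW) : Prop :=
  ∀ φ ∈ M.atlas, ∀ ψ ∈ M.atlas, ∀ x y : WSpace C V, φ x ∈ L → g (φ x) = ψ y →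
    ∃ F : WSpace C V → WSpace C V, F x = y ∧ ContDiffAt ℝ ∞ F x ∧
      (∀ᶠ x' in 𝓝[φ ⁻¹' L] x, g (φ x') = ψ (F x')) ∧
      fderiv ℝ F x '' M.tangent φ L x = M.tangent ψ (g '' L) y ∧
      ∃ c : ℝ, 0 < c ∧ ∀ X ∈ M.tangent φ L x, ∀ Y ∈ M.tangent φ L x,
        M.metric y (fderiv ℝ F x X) (fderiv ℝ F x Y) = c ^ 2 * M.metric x X Y

end J2CModule

end

open scoped ContDiff Topology

noncomputable section

set_option linter.unusedSectionVars false

namespace J2CModule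

variable {C V : Type*} [NormedAddCommGroup C] [InnerProductSpace ℝ C]
  [NormedAddCommGroup V] [InnerProductSpace ℝ V]

/-! The claim is local at a point p of L; near p the collineation is reduced to a real linear map of
a plane. The linear isometries of W that permute the lines Cw extend to isometries of `CPW`
(`isIsom_ext`), and so does the inversion (ζ,v) ↦ (ζ⁻¹,ζ⁻¹v) (`isIsom_inversion`). The group they
generate is transitive on incident pairs of points and lines (`exists_gen_axis`). An isometry fixing
the origin is linear (`IsIsom.eq_ext`), so there are no other isometries (`IsIsom.gen`), and the
projective lines are exactly the affine lines completed by their point at infinity and the lines at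
infinity (`isProjLine_iff`). Composing with isometries on both sides turns g into a homeomorphism G
that fixes the origin and maps the axis C ⊕ 0, with its point at infinity, onto itself.

Let v ≠ 0 in V. The image N under G of the line at infinity of the plane C ⊕ Cv misses the origin. A
line-preserving bijection K, in general not an isometry, moves N to infinity, fixes the origin and
has an orthogonal differential there (`IsStd.exists_move`); it comes from a translation conjugated
by the inversion. Now K∘G maps parallel affine lines of the plane to parallel affine lines. The
parallelogram construction makes it additive, and continuity makes it real linear
(`exists_linear_of_isStd`).

After a rotation this linear map f sends (ζ,0) to (Aζ,0). Let Bξ be the V-component of f(0,ξv).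
Since f respects lines, ζ(ξv) = θv implies Bθ = A(ζ)(A(1)⁻¹Bξ). The cases ζ(1v) = ζv and ζ̄(ζv) =
|ζ|²v give |Aζ||Aζ̄| = |ζ|²|A1|², which forces A to be a similarity (`norm_eq_of_norm_conj`,
`similarity_of_linear`). On the axis G is therefore K⁻¹ after a linear similarity, hence smooth near
the origin and conformal there (`exists_conformal`).

The analysis rests on Q(w,X) = |w|²|P X|², with P the projection to Cw. It is polynomial, and the
metric is expressed by norms and Q. The functions 1/(1+|w|²), ⟨w,X⟩/(1+|w|²), Q(w,X)/(1+|w|²) extend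
to `CPW`, embed it, and are transformed linearly by the generating isometries; this gives continuity
at infinity. -/

/-- The vector `(ζ, v)` of `W = C ⊕ V`. -/
abbrev pr (ζ : C) (v : V) : WSpace C V := WithLp.toLp 2 (ζ, v)

lemma wext {w w' : WSpace C V} (h : w.fst = w'.fst) (h' : w.snd = w'.snd) : w = w' :=
  WithLp.ofLp_injective 2 (Prod.ext h h')

lemma pr_eta (w : WSpace C V) : pr w.fst w.snd = w := rfl

lemma pr_inj {ζ ζ' : C} {v v' : V} : pr ζ v = pr ζ' v' ↔ ζ = ζ' ∧ v = v' :=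
  ⟨fun h => ⟨congrArg WithLp.fst h, congrArg WithLp.snd h⟩, fun h => by rw [h.1, h.2]⟩

lemma pr_eq_zero {ζ : C} {v : V} : pr ζ v = 0 ↔ ζ = 0 ∧ v = 0 := pr_inj (ζ' := 0) (v' := 0)

lemma pr_add (ζ ζ' : C) (v v' : V) : pr ζ v + pr ζ' v' = pr (ζ + ζ') (v + v') := rfl

lemma smul_pr (r : ℝ) (ζ : C) (v : V) : r • pr ζ v = pr (r • ζ) (r • v) := rfl

lemma norm_pr_sq (ζ : C) (v : V) : ‖pr ζ v‖ ^ 2 = ‖ζ‖ ^ 2 + ‖v‖ ^ 2 :=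
  WithLp.prod_norm_sq_eq_of_L2 _

lemma wnorm_sq (w : WSpace C V) : ‖w‖ ^ 2 = ‖w.fst‖ ^ 2 + ‖w.snd‖ ^ 2 :=
  WithLp.prod_norm_sq_eq_of_L2 _

lemma inner_pr (ζ ζ' : C) (v v' : V) :
    inner ℝ (pr ζ v) (pr ζ' v') = inner ℝ ζ ζ' + inner ℝ v v' := WithLp.prod_inner_apply _ _

variable (M : J2CModule C V)

/-! ### Conjugation, inverses and adjoints of the action -/

lemma one_ne_zero : M.one ≠ 0 := fun h => by
  have := M.norm_one
  rw [h, norm_zero] at this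
  exact zero_ne_one this

lemma inner_one_one : inner ℝ M.one M.one = (1 : ℝ) := by
  rw [real_inner_self_eq_norm_sq, M.norm_one]; norm_num

lemma conj_one : M.conj M.one = M.one := by
  simp only [conj, inner_one_one]; module

lemma conj_add (a b : C) : M.conj (a + b) = M.conj a + M.conj b := by
  simp only [conj, inner_add_right]; module

lemma conj_smul (r : ℝ) (a : C) : M.conj (r • a) = r • M.conj a := by
  simp only [conj, inner_smul_right]; module

lemma conj_zero : M.conj 0 = 0 := by simp [conj]

/-- Conjugation as a linear map. -/
def conjL : C →ₗ[ℝ] C where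
  toFun := M.conj
  map_add' := M.conj_add
  map_smul' := M.conj_smul

lemma inv_one : M.inv M.one = M.one := by simp [inv, M.norm_one, conj_one]

lemma norm_inv (ζ : C) : ‖M.inv ζ‖ = ‖ζ‖⁻¹ := by
  rw [inv, norm_smul, M.norm_conj, Real.norm_eq_abs, abs_of_nonneg (by positivity)]
  by_cases h : ‖ζ‖ = 0
  · simp [h]
  · field_simp

lemma inv_ne_zero {ζ : C} (h : ζ ≠ 0) : M.inv ζ ≠ 0 := by
  rw [← norm_ne_zero_iff, M.norm_inv]
  exact _root_.inv_ne_zero (norm_ne_zero_iff.2 h)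

lemma inv_inv {ζ : C} (h : ζ ≠ 0) : M.inv (M.inv ζ) = ζ := by
  have h' := norm_ne_zero_iff.2 h
  rw [inv, M.norm_inv, inv, M.conj_smul, M.conj_conj, smul_smul]
  rw [show ((‖ζ‖⁻¹ ^ 2)⁻¹ * (‖ζ‖ ^ 2)⁻¹) = 1 by field_simp, one_smul]

lemma conj_eq_smul_inv {ζ : C} (h : ζ ≠ 0) : M.conj ζ = ‖ζ‖ ^ 2 • M.inv ζ := by
  rw [inv, smul_smul, mul_inv_cancel₀ (pow_ne_zero _ (norm_ne_zero_iff.2 h)), one_smul]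

lemma J_J_conj (ζ : C) (v : V) : M.J ζ (M.J (M.conj ζ) v) = (‖ζ‖ ^ 2) • v := by
  simpa [M.conj_conj, M.norm_conj] using M.J_conj_J (M.conj ζ) v

lemma inner_J_left (ζ : C) (u v : V) : inner ℝ (M.J ζ u) v = inner ℝ u (M.J (M.conj ζ) v) := by
  have h := M.inner_J_polar M.one ζ u v
  rw [M.J_one, M.J_one] at h
  rw [conj, map_sub, map_smul, LinearMap.sub_apply, LinearMap.smul_apply, M.J_one,
    inner_sub_right, inner_smul_right]
  linarith

lemma inner_J_right (ζ : C) (u v : V) : inner ℝ u (M.J ζ v) = inner ℝ (M.J (M.conj ζ) u) v := by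
  rw [M.inner_J_left, M.conj_conj]

lemma inner_J_J (ζ η : C) (v : V) : inner ℝ (M.J ζ v) (M.J η v) = inner ℝ ζ η * ‖v‖ ^ 2 := by
  have h := M.inner_J_polar ζ η v v
  rw [real_inner_comm (M.J ζ v), real_inner_self_eq_norm_sq] at h
  linarith [real_inner_comm (M.J ζ v) (M.J η v)]

lemma J_inj {ζ η : C} {v : V} (hv : v ≠ 0) (h : M.J ζ v = M.J η v) : ζ = η := by
  have h2 : ‖M.J (ζ - η) v‖ = 0 := by simp [h]
  rw [M.norm_J, mul_eq_zero, norm_eq_zero, norm_eq_zero, sub_eq_zero] at h2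
  exact h2.resolve_right hv

lemma J_eq_zero {ζ : C} {v : V} : M.J ζ v = 0 ↔ ζ = 0 ∨ v = 0 := by
  rw [← norm_eq_zero, M.norm_J, mul_eq_zero, norm_eq_zero, norm_eq_zero]

/-- The adjoint of the action of a is the action of its conjugate, and this preserves Cv by the
J²-condition; hence (Cv)^⊥ is also invariant. -/
lemma orth_J {v v' : V} (h : ∀ ζ, inner ℝ (M.J ζ v) v' = 0) (a : C) :
    ∀ ζ, inner ℝ (M.J ζ v) (M.J a v') = 0 := by
  intro ζ
  obtain ⟨ξ, hξ⟩ := M.exists_J_J (M.conj a) ζ v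
  rw [M.inner_J_right, hξ, h]

variable [FiniteDimensional ℝ C] [FiniteDimensional ℝ V]

lemma inner_coord (v x : V) (ζ : C) : inner ℝ ζ (M.coord v x) = inner ℝ (M.J ζ v) x := by
  rw [coord, LinearMap.adjoint_inner_right, LinearMap.flip_apply]

lemma coord_J (v : V) (ζ : C) : M.coord v (M.J ζ v) = ‖v‖ ^ 2 • ζ := by
  refine ext_inner_left ℝ fun ξ => ?_
  rw [M.inner_coord, M.inner_J_J, inner_smul_right, mul_comm]

lemma norm_sub_coord {v : V} (hv : ‖v‖ = 1) (x : V) (ζ : C) :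
    inner ℝ (M.J ζ v) (x - M.J (M.coord v x) v) = 0 := by
  rw [inner_sub_right, M.inner_J_J, hv, ← M.inner_coord]; ring

/-! ### The norm-multiplicative product of C read from its action on Cv -/

/-- The product of `C` for which `(ab)v = a(bv)`. -/
def mul (v : V) (a b : C) : C := M.coord v (M.J a (M.J b v))

section

variable {v : V} (hv : ‖v‖ = 1)
include hv

lemma coord_J' (ζ : C) : M.coord v (M.J ζ v) = ζ := by
  rw [M.coord_J, hv]; simp

lemma J_mul (a b : C) : M.J (M.mul v a b) v = M.J a (M.J b v) := by
  obtain ⟨ξ, h⟩ := M.exists_J_J a b v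
  rw [mul, h, M.coord_J' hv]

lemma J_coord_of_mem {x : V} (h : ∃ ξ, x = M.J ξ v) : M.J (M.coord v x) v = x := by
  obtain ⟨ξ, rfl⟩ := h
  rw [M.coord_J' hv]

lemma coord_orth_zero {x : V} (h : ∀ ζ, inner ℝ (M.J ζ v) x = 0) (h' : ∃ ξ, x = M.J ξ v) :
    x = 0 := by
  obtain ⟨ξ, rfl⟩ := h'
  exact inner_self_eq_zero.1 (h ξ)

/-- The `J²`-condition forces `C` to act associatively on the complement of `Cv`. -/
lemma mul_J {v' : V} (h : ∀ ζ, inner ℝ (M.J ζ v) v' = 0) (a b : C) :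
    M.J (M.mul v a b) v' = M.J a (M.J b v') := by
  -- One θ serves for a(b(v + v')). The components in Cv and in its invariant complement can be
  -- compared separately, so θ is the product ab and also governs v'.
  obtain ⟨θ, hθ⟩ := M.exists_J_J a b (v + v')
  simp only [map_add] at hθ
  have key : M.J a (M.J b v) - M.J θ v = M.J θ v' - M.J a (M.J b v') := by
    rw [sub_eq_sub_iff_add_eq_add, hθ, add_comm]
  have h1 : M.J a (M.J b v) - M.J θ v = 0 := by
    apply M.coord_orth_zero hv
    · intro ζ
      rw [key, inner_sub_right, M.orth_J h, M.orth_J (M.orth_J h b), sub_zero]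
    · exact ⟨M.mul v a b - θ, by simp [M.J_mul hv]⟩
  have h2 : M.mul v a b = θ := by
    apply M.J_inj (v := v) (by rintro rfl; simp at hv)
    rw [M.J_mul hv, sub_eq_zero.1 h1]
  rw [h2]
  exact sub_eq_zero.1 (key.symm.trans h1)

lemma norm_mul (a b : C) : ‖M.mul v a b‖ = ‖a‖ * ‖b‖ := by
  have : ‖M.J (M.mul v a b) v‖ = ‖a‖ * ‖b‖ := by rw [M.J_mul hv, M.norm_J, M.norm_J, hv, mul_one]
  rwa [M.norm_J, hv, mul_one] at this

lemma inner_mul_left (a b c : C) : inner ℝ (M.mul v a b) c = inner ℝ b (M.mul v (M.conj a) c) := by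
  have h : ∀ x y : C, inner ℝ x y = inner ℝ (M.J x v) (M.J y v) := fun x y => by
    rw [M.inner_J_J, hv]; ring
  rw [h, h, M.J_mul hv, M.J_mul hv, M.inner_J_left]

lemma mul_one (a : C) : M.mul v a M.one = a := by rw [mul, M.J_one, M.coord_J' hv]

lemma one_mul (a : C) : M.mul v M.one a = a := by rw [mul, M.J_one, M.coord_J' hv]

lemma inner_mul_polar (a b c d : C) :
    inner ℝ (M.mul v a b) (M.mul v c d) + inner ℝ (M.mul v c b) (M.mul v a d)
      = 2 * inner ℝ a c * inner ℝ b d := by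
  have h : ∀ x y : C, inner ℝ x y = inner ℝ (M.J x v) (M.J y v) := fun x y => by
    rw [M.inner_J_J, hv]; ring
  rw [h (M.mul v a b), h (M.mul v c b), h b d]
  simp only [M.J_mul hv]
  exact M.inner_J_polar a c _ _

lemma inner_mul_right (a b c : C) :
    inner ℝ (M.mul v a b) c = inner ℝ a (M.mul v c (M.conj b)) := by
  have h := M.inner_mul_polar hv a b c M.one
  rw [M.mul_one hv, M.mul_one hv] at h
  have h1 : M.mul v c (M.conj b) = (2 * inner ℝ M.one b) • c - M.mul v c b := by
    rw [mul, conj]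
    simp only [map_sub, map_smul, LinearMap.sub_apply, LinearMap.smul_apply, M.J_one,
      M.coord_J' hv, mul]
  rw [h1, inner_sub_right, inner_smul_right, real_inner_comm (M.mul v c b)]
  rw [real_inner_comm M.one b] at *
  linarith

/-- The product need not be associative, but pairing with μ gives ⟨μb, ab⟩ = ⟨μ, a⟩|b|², the
polarized multiplicativity of the norm. This is all the associativity that is needed on Cv itself.
-/
lemma mul_mul_conj (a b : C) : M.mul v (M.mul v a b) (M.conj b) = ‖b‖ ^ 2 • a := by
  refine ext_inner_left ℝ fun μ => ?_
  have h := M.inner_mul_polar hv μ b a b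
  rw [real_inner_self_eq_norm_sq, real_inner_comm (M.mul v μ b) (M.mul v a b)] at h
  rw [← M.inner_mul_right hv, inner_smul_right]
  linarith [real_inner_comm (M.mul v a b) (M.mul v μ b)]

lemma conj_mul (a b : C) : M.conj (M.mul v a b) = M.mul v (M.conj b) (M.conj a) := by
  have hc : ∀ x y : C, inner ℝ (M.conj x) y = inner ℝ x (M.conj y) := fun x y => by
    simp only [conj, inner_sub_left, inner_sub_right, inner_smul_left, inner_smul_right,
      conj_trivial, real_inner_comm x M.one]
    ring
  refine ext_inner_right ℝ fun c => ?_
  have h := M.inner_mul_right hv (M.conj a) (M.conj c) b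
  rw [M.conj_conj] at h
  rw [hc, M.inner_mul_left hv, M.inner_mul_left hv, M.conj_conj, real_inner_comm, h]

end

/-! ### Complex lines -/

lemma lineMap_one (u : V) (ξ : C) : M.lineMap (pr M.one u) ξ = pr ξ (M.J ξ u) := by
  simp [lineMap, M.one_ne_zero, M.inv_one, M.J_one]

lemma lineMap_of_ne {ζ : C} (h : ζ ≠ 0) (u : V) (ξ : C) :
    M.lineMap (pr ζ u) ξ = pr ξ (M.J ξ (M.J (M.inv ζ) u)) := by
  simp [lineMap, h]

lemma lineMap_zero (u : V) (ξ : C) : M.lineMap (pr 0 u) ξ = pr 0 (M.J ξ u) := by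
  simp [lineMap]

lemma mem_line_one {u : V} {x : WSpace C V} :
    x ∈ M.line (pr M.one u) ↔ x.snd = M.J x.fst u := by
  constructor
  · rintro ⟨ξ, rfl⟩; rw [M.lineMap_one]; rfl
  · intro h; exact ⟨x.fst, by rw [M.lineMap_one, ← h]; rfl⟩

lemma mem_line_zero {u : V} {x : WSpace C V} :
    x ∈ M.line (pr 0 u) ↔ x.fst = 0 ∧ ∃ ξ, x.snd = M.J ξ u := by
  constructor
  · rintro ⟨ξ, rfl⟩; rw [M.lineMap_zero]; exact ⟨rfl, ξ, rfl⟩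
  · rintro ⟨h, ξ, h'⟩; exact ⟨ξ, by rw [M.lineMap_zero, ← h', ← h]; rfl⟩

lemma line_of_ne {ζ : C} (h : ζ ≠ 0) (u : V) :
    M.line (pr ζ u) = M.line (pr M.one (M.J (M.inv ζ) u)) := by
  ext x
  rw [mem_line_one]
  constructor
  · rintro ⟨ξ, rfl⟩; rw [M.lineMap_of_ne h]; rfl
  · intro h'; exact ⟨x.fst, by rw [M.lineMap_of_ne h, ← h']; rfl⟩

lemma self_mem_line (w : WSpace C V) : w ∈ M.line w := by
  by_cases h : w.fst = 0
  · rw [← pr_eta w, h, mem_line_zero]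
    exact ⟨rfl, M.one, (M.J_one _).symm⟩
  · rw [← pr_eta w, M.line_of_ne h, mem_line_one]
    exact (M.J_J_inv h _).symm

lemma rel_of_mem {x w : WSpace C V} (hx : x ≠ 0) (h : x ∈ M.line w) : M.Rel x w := by
  have hw : w ≠ 0 := by
    rintro rfl
    obtain ⟨ξ, rfl⟩ := h
    exact hx (by rw [show (0 : WSpace C V) = pr 0 0 from rfl, M.lineMap_zero, map_zero])
  exact ((M.mem_line_iff hw x).1 h |>.resolve_left hx).2

/-- Distinct lines meet only in 0, because they come from the classes of an equivalence relation. -/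
lemma line_eq_of_mem {x w : WSpace C V} (hx : x ≠ 0) (h : x ∈ M.line w) :
    M.line x = M.line w := by
  have hr := M.rel_of_mem hx h
  have hw : w ≠ 0 := by
    rintro rfl
    obtain ⟨ξ, rfl⟩ := h
    exact hx (by rw [show (0 : WSpace C V) = pr 0 0 from rfl, M.lineMap_zero, map_zero])
  ext y
  rw [M.mem_line_iff hx, M.mem_line_iff hw]
  refine or_congr_right (and_congr_right fun hy => ?_)
  exact ⟨fun h' => M.setoid.trans (a := ⟨y, hy⟩) (b := ⟨x, hx⟩) (c := ⟨w, hw⟩) h' hr,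
    fun h' => M.setoid.trans (a := ⟨y, hy⟩) (b := ⟨w, hw⟩) (c := ⟨x, hx⟩) h'
      (M.setoid.symm (a := ⟨x, hx⟩) (b := ⟨w, hw⟩) hr)⟩

lemma line_zero : M.line (0 : WSpace C V) = ⊥ := by
  rw [eq_bot_iff]
  rintro x ⟨ξ, rfl⟩
  rw [show (0 : WSpace C V) = pr 0 0 from rfl, M.lineMap_zero, map_zero]; rfl

/-- Every nonzero line is `C(1,u)` or `C(0,u)`. -/
lemma line_cases {w : WSpace C V} (hw : w ≠ 0) :
    (∃ u, M.line w = M.line (pr M.one u)) ∨ ∃ u, u ≠ 0 ∧ w = pr 0 u := by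
  by_cases h : w.fst = 0
  · refine Or.inr ⟨w.snd, fun h' => hw (wext h h'), ?_⟩
    rw [← h]; rfl
  · exact Or.inl ⟨_, by rw [← pr_eta w, M.line_of_ne h]⟩

lemma line_eq_or_disjoint {x w : WSpace C V} {y : WSpace C V} (hy : y ≠ 0) (h : y ∈ M.line x)
    (h' : y ∈ M.line w) : M.line x = M.line w :=
  (M.line_eq_of_mem hy h).symm.trans (M.line_eq_of_mem hy h')

/-! ### The quadratic form `|w|²|P_{Cw}X|²` -/

/-- Since B*B = c, the projection onto the range is c⁻¹BB*, so its length is read off from the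
adjoint. -/
lemma norm_starProjection_range {W : Type*} [NormedAddCommGroup W] [InnerProductSpace ℝ W]
    [FiniteDimensional ℝ W] (B : C →ₗ[ℝ] W) {c : ℝ} (hc : 0 < c)
    (hB : ∀ ξ, ‖B ξ‖ ^ 2 = c * ‖ξ‖ ^ 2) (X : W) :
    c * ‖(LinearMap.range B).starProjection X‖ ^ 2 = ‖LinearMap.adjoint B X‖ ^ 2 := by
  have hB' : ∀ ξ η, inner ℝ (B ξ) (B η) = c * inner ℝ ξ η := fun ξ η => by
    have h := hB (ξ + η)
    rw [map_add, norm_add_sq_real, norm_add_sq_real, hB, hB] at h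
    linarith
  have h : (LinearMap.range B).starProjection X = c⁻¹ • B (LinearMap.adjoint B X) := by
    refine Submodule.eq_starProjection_of_mem_of_inner_eq_zero
      (Submodule.smul_mem _ _ ⟨_, rfl⟩) ?_
    rintro _ ⟨ξ, rfl⟩
    rw [inner_sub_left, inner_smul_left, hB', LinearMap.adjoint_inner_left]
    simp only [conj_trivial]
    field_simp; ring
  rw [h, norm_smul, mul_pow, hB, Real.norm_eq_abs, sq_abs]
  field_simp

/-- The quadratic form `X ↦ |w|²|P X|²`, where `P` is the projection onto `Cw`. -/
def Q (w X : WSpace C V) : ℝ :=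
  ‖w.fst‖ ^ 2 * ‖X.fst‖ ^ 2 + 2 * inner ℝ (M.J X.fst (M.J (M.conj w.fst) w.snd)) X.snd
    + ‖M.coord w.snd X.snd‖ ^ 2

/-- For nonzero ζ and v, the vectors ζv and v span the same C-line. Both sides are multiples of the
length of the projection of x to that line. -/
lemma norm_coord_J (ζ : C) (v x : V) : ‖M.coord (M.J ζ v) x‖ ^ 2 = ‖ζ‖ ^ 2 * ‖M.coord v x‖ ^ 2 := by
  by_cases hv : v = 0
  · subst hv; simp [coord]
  by_cases hζ : ζ = 0
  · subst hζ; simp [coord]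
  have hr : LinearMap.range (M.J.flip (M.J ζ v)) = LinearMap.range (M.J.flip v) := by
    ext y
    constructor
    · rintro ⟨ξ, rfl⟩
      obtain ⟨θ, h⟩ := M.exists_J_J ξ ζ v
      exact ⟨θ, h.symm⟩
    · rintro ⟨ξ, rfl⟩
      obtain ⟨θ, h⟩ := M.exists_J_J ξ (M.inv ζ) (M.J ζ v)
      rw [M.J_inv_J hζ] at h
      exact ⟨θ, h.symm⟩
  have hv' := norm_pos_iff.2 hv
  have hζ' := norm_pos_iff.2 hζ
  have h1 := norm_starProjection_range (M.J.flip v) (c := ‖v‖ ^ 2) (by positivity)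
    (fun ξ => by rw [LinearMap.flip_apply, M.norm_J]; ring) x
  have h2 := norm_starProjection_range (M.J.flip (M.J ζ v)) (c := ‖ζ‖ ^ 2 * ‖v‖ ^ 2)
    (by positivity) (fun ξ => by rw [LinearMap.flip_apply, M.norm_J, M.norm_J]; ring) x
  simp only [hr] at h2
  rw [coord, coord, ← h1, ← h2]; ring

/-- The projection onto Cw depends discontinuously on w at 0, but multiplied by |w|² its squared
length becomes polynomial. The adjoint of `lineMap` gives the formula separately for ζ = 0 and ζ ≠
0. -/
lemma Q_eq (w X : WSpace C V) : M.Q w X = ‖w‖ ^ 2 * ‖(M.line w).starProjection X‖ ^ 2 := by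
  obtain ⟨ζ, v, rfl⟩ : ∃ ζ v, w = pr ζ v := ⟨_, _, rfl⟩
  obtain ⟨ξ, u, rfl⟩ : ∃ ζ v, X = pr ζ v := ⟨_, _, rfl⟩
  by_cases hζ : ζ = 0
  · subst hζ
    by_cases hv : v = 0
    · subst hv
      have : M.J.flip (0 : V) = 0 := map_zero _
      have h0 : (pr 0 0 : WSpace C V) = 0 := rfl
      simp [Q, coord, this, h0]
    have h := norm_starProjection_range (M.lineMap (pr 0 v)) (c := ‖v‖ ^ 2) (by positivity)
      (fun ξ => by rw [M.lineMap_zero, norm_pr_sq, M.norm_J]; simp; ring) (pr ξ u)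
    have h2 : LinearMap.adjoint (M.lineMap (pr 0 v)) (pr ξ u) = M.coord v u :=
      ext_inner_left ℝ fun a => by
        rw [LinearMap.adjoint_inner_right, M.lineMap_zero, inner_pr, M.inner_coord]; simp
    rw [norm_pr_sq, norm_zero, line]
    rw [h2] at h
    simp [Q, ← h, M.conj_zero]
  · have hζ' := norm_pos_iff.2 hζ
    have h := norm_starProjection_range (M.lineMap (pr ζ v))
      (c := 1 + ‖M.J (M.inv ζ) v‖ ^ 2) (by positivity)
      (fun ξ => by rw [M.lineMap_of_ne hζ, norm_pr_sq, M.norm_J ξ]; ring) (pr ξ u)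
    have h2 : LinearMap.adjoint (M.lineMap (pr ζ v)) (pr ξ u)
        = ξ + M.coord (M.J (M.inv ζ) v) u :=
      ext_inner_left ℝ fun a => by
        rw [LinearMap.adjoint_inner_right, M.lineMap_of_ne hζ, inner_pr, inner_add_right,
          M.inner_coord]
    rw [h2, M.norm_J, M.norm_inv, norm_add_sq_real, M.inner_coord, M.norm_coord_J, M.norm_inv] at h
    rw [norm_pr_sq, line]
    have h3 : ‖ζ‖ ^ 2 + ‖v‖ ^ 2 = ‖ζ‖ ^ 2 * (1 + (‖ζ‖⁻¹ * ‖v‖) ^ 2) := by field_simp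
    rw [h3, mul_assoc, h]
    simp only [Q, WithLp.toLp_fst, WithLp.toLp_snd, M.conj_eq_smul_inv hζ, map_smul,
      LinearMap.smul_apply, inner_smul_left, conj_trivial]
    field_simp

lemma Q_le (w X : WSpace C V) : M.Q w X ≤ ‖w‖ ^ 2 * ‖X‖ ^ 2 := by
  rw [Q_eq]
  gcongr
  exact (M.line w).norm_starProjection_apply_le X

/-- Equality in Bessel's inequality: membership in a line becomes a polynomial equation. -/
lemma mem_line_iff_Q {w : WSpace C V} (hw : w ≠ 0) (X : WSpace C V) :
    X ∈ M.line w ↔ M.Q w X = ‖w‖ ^ 2 * ‖X‖ ^ 2 := by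
  have hw' := norm_pos_iff.2 hw
  rw [Q_eq, mul_right_inj' (by positivity)]
  constructor
  · intro h; rw [Submodule.starProjection_eq_self_iff.2 h]
  · intro h
    have h2 : inner ℝ (X - (M.line w).starProjection X) ((M.line w).starProjection X) = 0 :=
      (M.line w).starProjection_inner_eq_zero X _ (Submodule.starProjection_apply_mem _ _)
    have h3 : X = (X - (M.line w).starProjection X) + (M.line w).starProjection X := by abel
    have h4 : ‖X‖ ^ 2 = ‖X - (M.line w).starProjection X + (M.line w).starProjection X‖ ^ 2 :=
      congrArg (fun y => ‖y‖ ^ 2) h3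
    rw [norm_add_sq_real, h2, ← h] at h4
    have h5 : ‖X - (M.line w).starProjection X‖ = 0 := by
      have : ‖X - (M.line w).starProjection X‖ ^ 2 = 0 := by linarith
      exact pow_eq_zero_iff (two_ne_zero) |>.1 this
    rw [norm_eq_zero, sub_eq_zero] at h5
    rw [h5]; exact Submodule.starProjection_apply_mem _ _

/-- Pythagoras eliminates the two projections. Preserving the metric is then a matter of norms and
of Q alone. -/
lemma metric_self (w X : WSpace C V) :
    M.metric w X X = ((1 + ‖w‖ ^ 2) * ‖X‖ ^ 2 - M.Q w X) / (1 + ‖w‖ ^ 2) ^ 2 := by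
  have h2 : inner ℝ (X - (M.line w).starProjection X) ((M.line w).starProjection X) = 0 :=
    (M.line w).starProjection_inner_eq_zero X _ (Submodule.starProjection_apply_mem _ _)
  have h4 : ‖X‖ ^ 2 = ‖X - (M.line w).starProjection X‖ ^ 2
      + ‖(M.line w).starProjection X‖ ^ 2 := by
    conv_lhs => rw [show X = (X - (M.line w).starProjection X) + (M.line w).starProjection X by abel]
    rw [norm_add_sq_real, h2]; ring
  rw [metric, real_inner_self_eq_norm_sq, real_inner_self_eq_norm_sq, Q_eq, h4]
  have : 0 < 1 + ‖w‖ ^ 2 := by positivity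
  field_simp; ring

lemma metric_polar (w X Y : WSpace C V) :
    M.metric w (X + Y) (X + Y) = M.metric w X X + 2 * M.metric w X Y + M.metric w Y Y := by
  simp only [metric, map_add]
  rw [show X + Y - ((M.line w).starProjection X + (M.line w).starProjection Y)
    = (X - (M.line w).starProjection X) + (Y - (M.line w).starProjection Y) by abel]
  simp only [inner_add_left, inner_add_right]
  rw [real_inner_comm ((M.line w).starProjection X) ((M.line w).starProjection Y),
    real_inner_comm (X - (M.line w).starProjection X) (Y - (M.line w).starProjection Y)]
  ring

/-- A linear map preserving the quadratic form of the metric preserves the metric. -/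
lemma metric_of_self {x y : WSpace C V} {A : WSpace C V →L[ℝ] WSpace C V}
    (h : ∀ X, M.metric y (A X) (A X) = M.metric x X X) (X Y : WSpace C V) :
    M.metric y (A X) (A Y) = M.metric x X Y := by
  have h1 := M.metric_polar y (A X) (A Y)
  have h2 := M.metric_polar x X Y
  rw [← map_add, h, h, h] at h1
  linarith

lemma metric_zero (X Y : WSpace C V) : M.metric 0 X Y = inner ℝ X Y := by
  simp [metric, M.line_zero]

lemma metric_pos (w : WSpace C V) {X : WSpace C V} (hX : X ≠ 0) : 0 < M.metric w X X := by
  rw [metric_self]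
  have := M.Q_le w X
  have hX := norm_pos_iff.2 hX
  have : 0 < ‖X‖ ^ 2 := by positivity
  apply div_pos _ (by positivity)
  nlinarith

/-! ### Linear isometries permuting the lines -/

/-- A linear isometry of `W` that maps the lines `Cw` onto lines. -/
def IsSpread (T : WSpace C V ≃ₗᵢ[ℝ] WSpace C V) : Prop :=
  ∀ w x, T x ∈ M.line (T w) ↔ x ∈ M.line w

variable {M} in
lemma IsSpread.refl : M.IsSpread (LinearIsometryEquiv.refl ℝ _) := fun _ _ => Iff.rfl

variable {M} in
lemma IsSpread.symm {T : WSpace C V ≃ₗᵢ[ℝ] WSpace C V} (h : M.IsSpread T) : M.IsSpread T.symm :=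
  fun w x => by rw [← h]; simp

variable {M} in
lemma IsSpread.trans {S T : WSpace C V ≃ₗᵢ[ℝ] WSpace C V} (hS : M.IsSpread S)
    (hT : M.IsSpread T) : M.IsSpread (S.trans T) :=
  fun _ _ => (hT _ _).trans (hS _ _)

variable {M} in
-- Such an isometry conjugates the projection onto Cw into the projection onto the image line.
lemma IsSpread.Q_map {T : WSpace C V ≃ₗᵢ[ℝ] WSpace C V} (h : M.IsSpread T) (w X : WSpace C V) :
    M.Q (T w) (T X) = M.Q w X := by
  have h1 : (M.line (T w)).starProjection (T X) = T ((M.line w).starProjection X) := by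
    refine Submodule.eq_starProjection_of_mem_of_inner_eq_zero
      ((h _ _).2 (Submodule.starProjection_apply_mem _ _)) fun y hy => ?_
    obtain ⟨y, rfl⟩ := T.surjective y
    rw [← map_sub, T.inner_map_map]
    exact (M.line w).starProjection_inner_eq_zero X _ ((h _ _).1 hy)
  rw [Q_eq, Q_eq, h1, T.norm_map, T.norm_map]

lemma isSpread_of_Q {T : WSpace C V ≃ₗᵢ[ℝ] WSpace C V} (h : ∀ w X, M.Q (T w) (T X) = M.Q w X) :
    M.IsSpread T := by
  intro w x
  by_cases hw : w = 0
  · simp [hw, M.line_zero]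
  · rw [M.mem_line_iff_Q hw, M.mem_line_iff_Q (by simpa using hw), h, T.norm_map, T.norm_map]

variable {M} in
lemma IsSpread.metric {T : WSpace C V ≃ₗᵢ[ℝ] WSpace C V} (h : M.IsSpread T) (w X : WSpace C V) :
    M.metric (T w) (T X) (T X) = M.metric w X X := by
  rw [metric_self, metric_self, h.Q_map, T.norm_map, T.norm_map]

variable {M} in
lemma IsSpread.line_eq {T : WSpace C V ≃ₗᵢ[ℝ] WSpace C V} (h : M.IsSpread T) {w w' : WSpace C V}
    (e : M.line w = M.line w') : M.line (T w) = M.line (T w') := by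
  ext x
  obtain ⟨x, rfl⟩ := T.surjective x
  rw [h, h, e]

/-- For κ ≠ 0 and u = (p + qκ)v + v' one needs (λκ)(κ⁻¹u) = λu. On v' this is associativity on the
complement (`mul_J`), on v it is (λκ)κ̄ = |κ|²λ, and on κv it holds because κ⁻¹ cancels κ. -/
lemma lineAux {v : V} (hv : ‖v‖ = 1) {v' : V} (hv' : ∀ ζ, inner ℝ (M.J ζ v) v' = 0) (lam κ : C)
    (p q : ℝ) : pr (M.mul v lam κ) (M.J lam (M.J (p • M.one + q • κ) v + v')) ∈
      M.line (pr κ (M.J (p • M.one + q • κ) v + v')) := by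
  by_cases hκ : κ = 0
  · subst hκ
    rw [mem_line_zero]
    exact ⟨by simp [mul], lam, rfl⟩
  rw [M.line_of_ne hκ, mem_line_one]
  have hk : ‖κ‖ ^ 2 ≠ 0 := pow_ne_zero _ (norm_ne_zero_iff.2 hκ)
  have key : M.J (M.mul v lam κ) (M.J (M.conj κ) (M.J (p • M.one + q • κ) v + v'))
      = ‖κ‖ ^ 2 • M.J lam (M.J (p • M.one + q • κ) v + v') := by
    have h1 : M.J (M.mul v lam κ) (M.J (M.conj κ) v') = ‖κ‖ ^ 2 • M.J lam v' := by
      rw [M.mul_J hv (M.orth_J hv' _), M.J_J_conj, map_smul]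
    have h2 : M.J (M.mul v lam κ) (M.J (M.conj κ) v) = ‖κ‖ ^ 2 • M.J lam v := by
      rw [← M.J_mul hv, M.mul_mul_conj hv, map_smul, LinearMap.smul_apply]
    have h3 : M.J (M.mul v lam κ) (M.J (M.conj κ) (M.J κ v)) = ‖κ‖ ^ 2 • M.J lam (M.J κ v) := by
      rw [M.J_conj_J, map_smul, M.J_mul hv]
    simp only [map_add, map_smul, LinearMap.add_apply, LinearMap.smul_apply, M.J_one, h1, h2, h3]
    module
  change M.J lam _ = M.J (M.mul v lam κ) _
  rw [inv, map_smul, LinearMap.smul_apply, map_smul, key, inv_smul_smul₀ hk]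

/-- The linear map `(ζ, ηv + v') ↦ (cζ + sη, (sζ - cη)v + v')`. -/
def reflL (v : V) (c s : ℝ) : WSpace C V →ₗ[ℝ] WSpace C V where
  toFun w := pr (c • w.fst + s • M.coord v w.snd)
    (w.snd + M.J (s • w.fst - (c + 1) • M.coord v w.snd) v)
  map_add' x y := by
    apply wext <;> simp <;> module
  map_smul' r x := by
    apply wext <;> simp <;> module

lemma exists_decomp {v : V} (hv : ‖v‖ = 1) (x : V) :
    ∃ η v', x = M.J η v + v' ∧ ∀ ζ, inner ℝ (M.J ζ v) v' = 0 :=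
  ⟨M.coord v x, x - M.J (M.coord v x) v, by abel, M.norm_sub_coord hv x⟩

lemma reflL_apply {v : V} (hv : ‖v‖ = 1) {v' : V} (hv' : ∀ ζ, inner ℝ (M.J ζ v) v' = 0)
    (c s : ℝ) (ζ η : C) : M.reflL v c s (pr ζ (M.J η v + v'))
      = pr (c • ζ + s • η) (M.J (s • ζ - c • η) v + v') := by
  change pr _ _ = _
  rw [pr_inj]
  simp only [WithLp.toLp_snd, M.coord_add hv η hv', WithLp.toLp_fst, true_and, map_sub, map_smul,
    LinearMap.sub_apply, LinearMap.smul_apply]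
  module

lemma reflL_involutive {v : V} (hv : ‖v‖ = 1) {c s : ℝ} (h : c ^ 2 + s ^ 2 = 1) :
    Function.Involutive (M.reflL v c s) := by
  intro w
  obtain ⟨η, v', hx, hv'⟩ := M.exists_decomp hv w.snd
  rw [← pr_eta w, hx, M.reflL_apply hv hv', M.reflL_apply hv hv', pr_inj]
  have h1 : c • (c • w.fst + s • η) + s • (s • w.fst - c • η) = w.fst := by
    rw [show c • (c • w.fst + s • η) + s • (s • w.fst - c • η) = (c ^ 2 + s ^ 2) • w.fst by module,
      h, one_smul]
  have h2 : s • (c • w.fst + s • η) - c • (s • w.fst - c • η) = η := by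
    rw [show s • (c • w.fst + s • η) - c • (s • w.fst - c • η) = (c ^ 2 + s ^ 2) • η by module,
      h, one_smul]
  rw [h1, h2]
  exact ⟨rfl, rfl⟩

/-- The isometry `(ζ, ηv + v') ↦ (cζ + sη, (sζ - cη)v + v')`, for `c² + s² = 1`. -/
def refl {v : V} (hv : ‖v‖ = 1) {c s : ℝ} (h : c ^ 2 + s ^ 2 = 1) :
    WSpace C V ≃ₗᵢ[ℝ] WSpace C V where
  toLinearEquiv := LinearEquiv.ofInvolutive (M.reflL v c s) (M.reflL_involutive hv h)
  norm_map' w := by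
    change ‖M.reflL v c s w‖ = ‖w‖
    obtain ⟨η, v', hx, hv'⟩ := M.exists_decomp hv w.snd
    rw [← sq_eq_sq₀ (norm_nonneg _) (norm_nonneg _)]
    rw [← pr_eta w, hx, M.reflL_apply hv hv', norm_pr_sq, norm_pr_sq, norm_add_sq_real,
      norm_add_sq_real (M.J _ v), norm_add_sq_real (M.J η v), hv', hv', M.norm_J, M.norm_J, hv, _root_.mul_one,
      _root_.mul_one, norm_sub_sq_real]
    simp only [norm_smul, inner_smul_left, inner_smul_right, conj_trivial, mul_pow,
      Real.norm_eq_abs, sq_abs]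
    linear_combination (‖w.fst‖ ^ 2 + ‖η‖ ^ 2) * h

lemma refl_apply {v : V} (hv : ‖v‖ = 1) {c s : ℝ} (h : c ^ 2 + s ^ 2 = 1) {v' : V}
    (hv' : ∀ ζ, inner ℝ (M.J ζ v) v' = 0) (ζ η : C) : M.refl hv h (pr ζ (M.J η v + v'))
      = pr (c • ζ + s • η) (M.J (s • ζ - c • η) v + v') := M.reflL_apply hv hv' c s ζ η

lemma refl_refl {v : V} (hv : ‖v‖ = 1) {c s : ℝ} (h : c ^ 2 + s ^ 2 = 1) (w : WSpace C V) :
    M.refl hv h (M.refl hv h w) = w := M.reflL_involutive hv h w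

/-- The image of a point of a line has first component κ = c + sη (or sη), and its Cv-component is a
real combination of 1 and κ applied to v. Then `lineAux` applies; the division by s expresses η
through κ. The converse inclusion follows since the map is an involution. -/
lemma isSpread_refl {v : V} (hv : ‖v‖ = 1) {c s : ℝ} (h : c ^ 2 + s ^ 2 = 1) (hs : s ≠ 0) :
    M.IsSpread (M.refl hv h) := by
  set R := M.refl hv h with hR
  have h1 : ∀ u lam, R (pr lam (M.J lam u)) ∈ M.line (R (pr M.one u)) := by
    intro u lam
    obtain ⟨η, v', rfl, hv'⟩ := M.exists_decomp hv u
    have e1 : M.J lam (M.J η v + v') = M.J (M.mul v lam η) v + M.J lam v' := by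
      rw [map_add, M.J_mul hv]
    rw [e1, hR, M.refl_apply hv h hv', M.refl_apply hv h (M.orth_J hv' lam)]
    -- Substitute η = (κ - c)/s with κ = c + sη.
    have e2 : s • M.one - c • η = (s + c * s⁻¹ * c) • M.one + (-(c * s⁻¹)) • (c • M.one + s • η) := by
      match_scalars <;> field_simp <;> ring
    have := M.lineAux hv hv' lam (c • M.one + s • η) (s + c * s⁻¹ * c) (-(c * s⁻¹))
    rw [← e2] at this
    convert this using 1
    rw [pr_inj]
    have e3 := M.J_mul hv lam η
    simp only [mul, map_add, map_sub, map_smul, M.J_one, LinearMap.add_apply, LinearMap.sub_apply,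
      LinearMap.smul_apply, M.coord_J' hv] at e3 ⊢
    rw [e3]
    exact ⟨trivial, rfl⟩
  have h0 : ∀ u lam, R (pr 0 (M.J lam u)) ∈ M.line (R (pr 0 u)) := by
    intro u lam
    obtain ⟨η, v', rfl, hv'⟩ := M.exists_decomp hv u
    have e1 : M.J lam (M.J η v + v') = M.J (M.mul v lam η) v + M.J lam v' := by
      rw [map_add, M.J_mul hv]
    rw [e1, hR, M.refl_apply hv h hv', M.refl_apply hv h (M.orth_J hv' lam)]
    have e2 : s • (0 : C) - c • η = (0 : ℝ) • M.one + (-(c * s⁻¹)) • (c • (0 : C) + s • η) := by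
      match_scalars <;> field_simp
    have := M.lineAux hv hv' lam (c • (0 : C) + s • η) 0 (-(c * s⁻¹))
    rw [← e2] at this
    convert this using 1
    rw [pr_inj]
    have e3 := M.J_mul hv lam η
    simp only [mul, map_add, map_smul, LinearMap.smul_apply, smul_zero, zero_add, zero_sub, map_neg,
      LinearMap.neg_apply] at e3 ⊢
    rw [e3]
    exact ⟨trivial, rfl⟩
  have h2 : ∀ w x, x ∈ M.line w → R x ∈ M.line (R w) := by
    intro w x hx
    by_cases hw : w = 0
    · subst hw
      rw [M.line_zero, Submodule.mem_bot] at hx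
      simp [hx]
    · rcases M.line_cases hw with ⟨u, hu⟩ | ⟨u, hu, rfl⟩
      · have hw' : R w ∈ M.line (R (pr M.one u)) := by
          have : w ∈ M.line (pr M.one u) := hu ▸ M.self_mem_line w
          rw [mem_line_one] at this
          rw [← pr_eta w, this]
          exact h1 u _
        rw [M.line_eq_of_mem (by simpa using hw) hw']
        rw [hu, mem_line_one] at hx
        rw [← pr_eta x, hx]
        exact h1 u _
      · rw [mem_line_zero] at hx
        obtain ⟨hx1, ξ, hx2⟩ := hx
        rw [← pr_eta x, hx2, hx1]
        exact h0 u ξ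
  intro w x
  refine ⟨fun hx => ?_, h2 w x⟩
  have := h2 _ _ hx
  rwa [hR, M.refl_refl, M.refl_refl] at this

/-- The isometry `(ζ, ηv + v') ↦ (η, ζv + v')`. -/
def swap {v : V} (hv : ‖v‖ = 1) : WSpace C V ≃ₗᵢ[ℝ] WSpace C V :=
  M.refl hv (c := 0) (s := 1) (by norm_num)

lemma swap_apply {v : V} (hv : ‖v‖ = 1) {v' : V}
    (hv' : ∀ ζ, inner ℝ (M.J ζ v) v' = 0) (ζ η : C) :
    M.swap hv (pr ζ (M.J η v + v')) = pr η (M.J ζ v + v') := by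
  rw [swap, M.refl_apply hv _ hv']; simp

lemma swap_apply' {v : V} (hv : ‖v‖ = 1) (ζ η : C) :
    M.swap hv (pr ζ (M.J η v)) = pr η (M.J ζ v) := by
  simpa using M.swap_apply hv (v' := 0) (by simp) ζ η

lemma isSpread_swap {v : V} (hv : ‖v‖ = 1) : M.IsSpread (M.swap hv) :=
  M.isSpread_refl hv _ (_root_.one_ne_zero)

lemma exists_unit {u : V} (hu : u ≠ 0) : ∃ v : V, ‖v‖ = 1 ∧ u = ‖u‖ • v := by
  have := norm_ne_zero_iff.2 hu
  exact ⟨‖u‖⁻¹ • u, by rw [norm_smul, _root_.norm_inv, norm_norm, inv_mul_cancel₀ this],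
    by rw [smul_smul, mul_inv_cancel₀ this, one_smul]⟩

/-- If ζ = 0 the swap along u suffices. Otherwise u = (rζ)v for a unit vector v in the direction of
ζ⁻¹u, and the reflection whose angle has tangent r annihilates the V-component. -/
lemma exists_isSpread_fst {w : WSpace C V} (hw : w ≠ 0) :
    ∃ T, M.IsSpread T ∧ ∃ a, a ≠ 0 ∧ T w = pr a 0 := by
  suffices h : ∃ T, M.IsSpread T ∧ ∃ a, T w = pr a 0 by
    obtain ⟨T, hT, a, h⟩ := h
    refine ⟨T, hT, a, ?_, h⟩
    rintro rfl
    exact hw (T.map_eq_zero_iff.1 (h.trans rfl))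
  obtain ⟨ζ, u, rfl⟩ : ∃ ζ v, w = pr ζ v := ⟨_, _, rfl⟩
  by_cases hu : u = 0
  · exact ⟨_, IsSpread.refl, ζ, by rw [hu]; rfl⟩
  by_cases hζ : ζ = 0
  · obtain ⟨v, hv, h⟩ := exists_unit hu
    refine ⟨_, M.isSpread_swap hv, ‖u‖ • M.one, ?_⟩
    have := M.swap_apply' hv 0 (‖u‖ • M.one)
    rw [map_smul, LinearMap.smul_apply, M.J_one, ← h] at this
    rw [hζ, this]; simp
  · have hu' : M.J (M.inv ζ) u ≠ 0 := by
      rw [Ne, M.J_eq_zero]; exact not_or.2 ⟨M.inv_ne_zero hζ, hu⟩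
    obtain ⟨v, hv, h⟩ := exists_unit hu'
    set r := ‖M.J (M.inv ζ) u‖ with hr
    have hr0 : r ≠ 0 := norm_ne_zero_iff.2 hu'
    have h1 : u = M.J (r • ζ) v := by
      rw [← M.J_J_inv hζ u, h]; simp
    have hp : 0 < 1 + r ^ 2 := by positivity
    have hq := Real.sqrt_pos.2 hp
    -- These c and s are cosine and sine of the angle with tangent r, so that sζ - c(rζ) = 0.
    have hc : (1 / √(1 + r ^ 2)) ^ 2 + (r / √(1 + r ^ 2)) ^ 2 = 1 := by
      rw [div_pow, div_pow, Real.sq_sqrt hp.le]; field_simp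
    refine ⟨_, M.isSpread_refl hv hc (div_ne_zero hr0 hq.ne'),
      (1 / √(1 + r ^ 2)) • ζ + (r / √(1 + r ^ 2)) • r • ζ, ?_⟩
    have := M.refl_apply hv hc (v' := 0) (by simp) ζ (r • ζ)
    rw [add_zero, ← h1] at this
    rw [this, pr_inj]
    refine ⟨rfl, ?_⟩
    have e : (r / √(1 + r ^ 2)) • ζ - (1 / √(1 + r ^ 2)) • r • ζ = 0 := by
      match_scalars; field_simp; ring
    rw [e]; simp

lemma exists_isSpread_snd [Nontrivial V] {w : WSpace C V} (hw : w ≠ 0) :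
    ∃ T, M.IsSpread T ∧ ∃ u, u ≠ 0 ∧ T w = pr 0 u := by
  obtain ⟨T, hT, a, ha, h⟩ := M.exists_isSpread_fst hw
  obtain ⟨u, hu⟩ := exists_ne (0 : V)
  obtain ⟨v, hv, -⟩ := exists_unit hu
  have hv0 : v ≠ 0 := by rintro rfl; simp at hv
  refine ⟨_, hT.trans (M.isSpread_swap hv), M.J a v, ?_, ?_⟩
  · rw [Ne, M.J_eq_zero]; exact not_or.2 ⟨ha, hv0⟩
  · have := M.swap_apply' hv a 0
    simp only [map_zero, LinearMap.zero_apply] at this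
    rw [LinearIsometryEquiv.trans_apply, h, this]

/-! ### Points at infinity -/

open Classical in
/-- The point at infinity `[w]` of `CPW`, for `w ≠ 0`. -/
def infPt (w : WSpace C V) : M.CPW := if h : w ≠ 0 then .inf (M.proj w h) else .fin 0

variable {M} in
lemma infPt_of_ne {w : WSpace C V} (h : w ≠ 0) : M.infPt w = .inf (M.proj w h) := dif_pos h

lemma infPt_eq_iff {w w' : WSpace C V} (hw : w ≠ 0) (hw' : w' ≠ 0) :
    M.infPt w = M.infPt w' ↔ M.line w = M.line w' := by
  have h1 : M.infPt w = M.infPt w' ↔ M.Rel w w' := by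
    rw [infPt_of_ne hw, infPt_of_ne hw', CPW.inf.injEq]
    exact Quotient.eq (r := M.setoid) (x := ⟨w, hw⟩) (y := ⟨w', hw'⟩)
  rw [h1]
  constructor
  · intro h
    exact M.line_eq_of_mem hw ((M.mem_line_iff hw' w).2 (Or.inr ⟨hw, h⟩))
  · intro h
    exact M.rel_of_mem hw (h ▸ M.self_mem_line w)

lemma infPt_eq_of_mem {x w : WSpace C V} (hx : x ≠ 0) (h : x ∈ M.line w) :
    M.infPt x = M.infPt w := by
  have hw : w ≠ 0 := by
    rintro rfl
    rw [M.line_zero] at h; exact hx h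
  exact (M.infPt_eq_iff hx hw).2 (M.line_eq_of_mem hx h)

variable {M} in
lemma infPt_ne_fin {w x : WSpace C V} (hw : w ≠ 0) : M.infPt w ≠ .fin x := by
  rw [infPt_of_ne hw]; simp

lemma inf_eq_infPt (q : M.WInf) : ∃ w, w ≠ 0 ∧ CPW.inf q = M.infPt w := by
  induction q using Quotient.inductionOn with
  | h w => exact ⟨w.1, w.2, (infPt_of_ne w.2).symm⟩

lemma pr_one_ne (u : V) : pr M.one u ≠ 0 := M.chartZero_aux u

lemma pr_zero_ne {u : V} (h : u ≠ 0) : (pr 0 u : WSpace C V) ≠ 0 := fun h' => h (pr_eq_zero.1 h').2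

lemma infPt_pr {ζ : C} (h : ζ ≠ 0) (u : V) :
    M.infPt (pr ζ u) = M.infPt (pr M.one (M.J (M.inv ζ) u)) := by
  rw [M.infPt_eq_iff (fun h' => h (pr_eq_zero.1 h').1) (M.pr_one_ne _), M.line_of_ne h]

lemma cpw_cases' (p : M.CPW) : (∃ w, p = .fin w) ∨ ∃ w, w ≠ 0 ∧ p = M.infPt w := by
  rcases p with w | q
  · exact Or.inl ⟨w, rfl⟩
  · exact Or.inr (M.inf_eq_infPt q)

/-- The case split is adapted to the inversion: it preserves the first kind, exchanges (0,v) with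
[1,v], and fixes each [0,v]. -/
lemma cpw_cases (p : M.CPW) : (∃ ζ v, ζ ≠ 0 ∧ p = .fin (pr ζ v)) ∨ (∃ v, p = .fin (pr 0 v)) ∨
    (∃ v, p = M.infPt (pr M.one v)) ∨ ∃ v, v ≠ 0 ∧ p = M.infPt (pr 0 v) := by
  rcases M.cpw_cases' p with ⟨w, rfl⟩ | ⟨w, hw, rfl⟩
  · by_cases h : w.fst = 0
    · exact Or.inr (Or.inl ⟨w.snd, by rw [← h]; rfl⟩)
    · exact Or.inl ⟨w.fst, w.snd, h, rfl⟩
  · by_cases h : w.fst = 0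
    · exact Or.inr (Or.inr (Or.inr ⟨w.snd, fun h' => hw (wext h h'), by rw [← h]; rfl⟩))
    · exact Or.inr (Or.inr (Or.inl ⟨_, by rw [← pr_eta w, M.infPt_pr h]⟩))

/-! ### The topology of `CPW` -/

lemma continuous_fin : Continuous (CPW.fin : WSpace C V → M.CPW) := by
  rw [continuous_def]
  intro S hS
  rw [isOpen_iff_mem_nhds]
  exact fun w hw => hS.1 w hw

lemma isOpen_image_fin {S : Set (WSpace C V)} (hS : IsOpen S) :
    IsOpen (CPW.fin '' S : Set M.CPW) := by
  refine ⟨?_, ?_⟩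
  · rintro w ⟨x, hx, h⟩
    rw [CPW.fin.injEq] at h
    subst h
    filter_upwards [hS.mem_nhds hx] with y hy using ⟨y, hy, rfl⟩
  · rintro p ⟨x, hx, h⟩
    exact absurd h (by simp)

lemma isOpenEmbedding_fin : Topology.IsOpenEmbedding (CPW.fin : WSpace C V → M.CPW) :=
  .of_continuous_injective_isOpenMap M.continuous_fin (fun _ _ h => by simpa using h)
    fun _ hS => M.isOpen_image_fin hS

lemma tendsto_fin {α : Type*} {l : Filter α} {f : α → WSpace C V} {x : WSpace C V} :
    Filter.Tendsto (fun a => (CPW.fin (f a) : M.CPW)) l (𝓝 (.fin x)) ↔ Filter.Tendsto f l (𝓝 x) :=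
  (M.isOpenEmbedding_fin.isInducing.tendsto_nhds_iff (f := f)).symm

lemma continuous_proj : Continuous (fun w : {w : WSpace C V // w ≠ 0} => M.proj w.1 w.2) :=
  continuous_quotient_mk'

/-- A function on `CPW` is continuous if it is so on `W` and on `W_∞` and its values at `w` and
at `[w]` become close as `|w| → ∞`. -/
lemma continuous_of_close {f : M.CPW → ℝ} (h1 : Continuous fun w => f (.fin w))
    (h2 : Continuous fun w : {w : WSpace C V // w ≠ 0} => f (M.infPt w.1))
    (h3 : ∀ ε > 0, ∃ R, ∀ w : WSpace C V, R < ‖w‖ → |f (.fin w) - f (M.infPt w)| < ε) :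
    Continuous f := by
  have h2' : Continuous fun q : M.WInf => f (.inf q) := by
    refine (isQuotientMap_quot_mk (r := M.setoid.r)).continuous_iff.2 (h2.congr fun w => ?_)
    rw [infPt_of_ne w.2]; rfl
  rw [continuous_def]
  intro O hO
  refine ⟨fun w hw => (hO.preimage h1).mem_nhds hw, fun p hp => ?_⟩
  obtain ⟨ε, hε, hb⟩ := Metric.isOpen_iff.1 hO _ hp
  obtain ⟨R, hR⟩ := h3 (ε / 2) (by positivity)
  refine ⟨_, (Metric.isOpen_ball (x := f (.inf p)) (ε := ε / 2)).preimage h2', ?_, max R 1,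
    by positivity, ?_, ?_⟩
  · simpa using hε
  · intro q hq
    exact hb (Metric.ball_subset_ball (by linarith) hq)
  · intro w hw hq hn
    apply hb
    have := hR w ((le_max_left _ _).trans_lt hn)
    rw [infPt_of_ne hw] at this
    have hq : |f (.inf (M.proj w hw)) - f (.inf p)| < ε / 2 := hq
    change |_| < ε
    calc |f (.fin w) - f (.inf p)| ≤ _ := abs_sub_le _ (f (.inf (M.proj w hw))) _
      _ < ε := by linarith

/-! ### Smoothness of the structure maps -/

/-- `(v, u) ↦ coord v u` as a bilinear map. -/
def coordB : V →ₗ[ℝ] V →ₗ[ℝ] C :=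
  LinearMap.mk₂ ℝ (fun v u => M.coord v u)
    (fun v v' u => ext_inner_left ℝ fun ζ => by
      simp only [inner_add_right, inner_coord, map_add, inner_add_left])
    (fun r v u => ext_inner_left ℝ fun ζ => by
      simp only [inner_smul_right, inner_coord, map_smul, inner_smul_left, conj_trivial])
    (fun v u u' => map_add _ _ _) (fun r v u => map_smul _ _ _)

lemma coordB_apply (v u : V) : M.coordB v u = M.coord v u := rfl

lemma contDiff_bilin {E F G : Type*} [NormedAddCommGroup E] [NormedSpace ℝ E]
    [NormedAddCommGroup F] [NormedSpace ℝ F] [NormedAddCommGroup G] [NormedSpace ℝ G]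
    [FiniteDimensional ℝ E] [FiniteDimensional ℝ F] (B : E →ₗ[ℝ] F →ₗ[ℝ] G) :
    ContDiff ℝ ∞ fun p : E × F => B p.1 p.2 :=
  (LinearMap.toContinuousLinearMap
    (LinearMap.toContinuousLinearMap.toLinearMap ∘ₗ B)).isBoundedBilinearMap.contDiff

lemma contDiff_lin {E F : Type*} [NormedAddCommGroup E] [NormedSpace ℝ E]
    [NormedAddCommGroup F] [NormedSpace ℝ F] [FiniteDimensional ℝ E] (B : E →ₗ[ℝ] F) :
    ContDiff ℝ ∞ B := (LinearMap.toContinuousLinearMap B).contDiff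

section smooth

variable {E : Type*} [NormedAddCommGroup E] [NormedSpace ℝ E] {x : E}

lemma contDiffAt_J {f : E → C} {g : E → V} (hf : ContDiffAt ℝ ∞ f x) (hg : ContDiffAt ℝ ∞ g x) :
    ContDiffAt ℝ ∞ (fun y => M.J (f y) (g y)) x :=
  (contDiff_bilin M.J).contDiffAt.comp x (hf.prodMk hg)

lemma contDiff_conj : ContDiff ℝ ∞ M.conj := contDiff_lin M.conjL

lemma contDiff_wfst : ContDiff ℝ ∞ (WithLp.fst : WSpace C V → C) :=
  contDiff_lin (WithLp.fstₗ 2 ℝ C V)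

lemma contDiff_wsnd : ContDiff ℝ ∞ (WithLp.snd : WSpace C V → V) :=
  contDiff_lin (WithLp.sndₗ 2 ℝ C V)

lemma contDiffAt_pr {f : E → C} {g : E → V} (hf : ContDiffAt ℝ ∞ f x)
    (hg : ContDiffAt ℝ ∞ g x) : ContDiffAt ℝ ∞ (fun y => pr (f y) (g y)) x :=
  (WithLp.prodContinuousLinearEquiv 2 ℝ C V).symm.contDiff.contDiffAt.comp x (hf.prodMk hg)

lemma contDiffAt_inv {f : E → C} (hf : ContDiffAt ℝ ∞ f x) (h : f x ≠ 0) :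
    ContDiffAt ℝ ∞ (fun y => M.inv (f y)) x :=
  ((hf.norm_sq ℝ).inv (pow_ne_zero _ (norm_ne_zero_iff.2 h))).smul
    (M.contDiff_conj.contDiffAt.comp x hf)

lemma contDiffAt_coord {f g : E → V} (hf : ContDiffAt ℝ ∞ f x) (hg : ContDiffAt ℝ ∞ g x) :
    ContDiffAt ℝ ∞ (fun y => M.coord (f y) (g y)) x := by
  have h := contDiff_bilin M.coordB
  simp only [coordB_apply] at h
  exact ContDiffAt.comp (f := fun y => (f y, g y)) x h.contDiffAt (hf.prodMk hg)

lemma contDiffAt_conj {f : E → C} (hf : ContDiffAt ℝ ∞ f x) :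
    ContDiffAt ℝ ∞ (fun y => M.conj (f y)) x := M.contDiff_conj.contDiffAt.comp x hf

lemma contDiffAt_wfst {f : E → WSpace C V} (hf : ContDiffAt ℝ ∞ f x) :
    ContDiffAt ℝ ∞ (fun y => (f y).fst) x := contDiff_wfst.contDiffAt.comp x hf

lemma contDiffAt_wsnd {f : E → WSpace C V} (hf : ContDiffAt ℝ ∞ f x) :
    ContDiffAt ℝ ∞ (fun y => (f y).snd) x := contDiff_wsnd.contDiffAt.comp x hf

lemma contDiffAt_Q {f g : E → WSpace C V} (hf : ContDiffAt ℝ ∞ f x) (hg : ContDiffAt ℝ ∞ g x) :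
    ContDiffAt ℝ ∞ (fun y => M.Q (f y) (g y)) x := by
  have f1 := contDiffAt_wfst hf
  have f2 := contDiffAt_wsnd hf
  have g1 := contDiffAt_wfst hg
  have g2 := contDiffAt_wsnd hg
  have h1 := M.contDiffAt_J g1 (M.contDiffAt_J (M.contDiffAt_conj f1) f2)
  have h4 := (M.contDiffAt_coord f2 g2).norm_sq ℝ
  have h5 := (f1.norm_sq ℝ).mul (g1.norm_sq ℝ)
  have h3 : ContDiffAt ℝ ∞ (fun y => (2 : ℝ) * inner ℝ
    (M.J (g y).fst (M.J (M.conj (f y).fst) (f y).snd)) (g y).snd) x :=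
    ContDiffAt.mul contDiffAt_const (h1.inner ℝ g2)
  exact (h5.add h3).add h4

end smooth

lemma continuous_Q {E : Type*} [TopologicalSpace E] {f g : E → WSpace C V} (hf : Continuous f)
    (hg : Continuous g) : Continuous fun y => M.Q (f y) (g y) := by
  have : Continuous fun p : WSpace C V × WSpace C V => M.Q p.1 p.2 :=
    (contDiff_iff_contDiffAt.2 fun _ =>
      M.contDiffAt_Q contDiff_fst.contDiffAt contDiff_snd.contDiffAt).continuous
  exact this.comp (hf.prodMk hg)

/-! ### Coordinate functions separating the points of `CPW` -/

/-- The function `1 / (1 + |w|²)` on `CPW`. -/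
def coordA : M.CPW → ℝ
  | .fin w => 1 / (1 + ‖w‖ ^ 2)
  | .inf _ => 0

/-- The function `⟨w, X⟩ / (1 + |w|²)` on `CPW`. -/
def coordI (X : WSpace C V) : M.CPW → ℝ
  | .fin w => inner ℝ w X / (1 + ‖w‖ ^ 2)
  | .inf _ => 0

lemma Q_div_eq_of_line {w w' : WSpace C V} (hw : w ≠ 0) (hw' : w' ≠ 0) (h : M.line w = M.line w')
    (X : WSpace C V) : M.Q w X / ‖w‖ ^ 2 = M.Q w' X / ‖w'‖ ^ 2 := by
  have h1 := norm_ne_zero_iff.2 hw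
  have h2 := norm_ne_zero_iff.2 hw'
  rw [Q_eq, Q_eq, h]
  field_simp

/-- The function on `CPW` that extends `|w|²|P_{Cw}X|² / (1 + |w|²)`. -/
def coordQ (X : WSpace C V) : M.CPW → ℝ
  | .fin w => M.Q w X / (1 + ‖w‖ ^ 2)
  | .inf q => Quotient.lift (s := M.setoid) (fun w => M.Q w.1 X / ‖w.1‖ ^ 2)
      (fun w w' h => M.Q_div_eq_of_line w.2 w'.2
        (M.line_eq_of_mem w.2 ((M.mem_line_iff w'.2 w.1).2 (Or.inr ⟨w.2, h⟩))) X) q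

lemma coordA_fin (w : WSpace C V) : M.coordA (.fin w) = 1 / (1 + ‖w‖ ^ 2) := rfl
lemma coordI_fin (X w : WSpace C V) : M.coordI X (.fin w) = inner ℝ w X / (1 + ‖w‖ ^ 2) := rfl
lemma coordQ_fin (X w : WSpace C V) : M.coordQ X (.fin w) = M.Q w X / (1 + ‖w‖ ^ 2) := rfl

variable {M} in
lemma coordA_infPt {w : WSpace C V} (hw : w ≠ 0) : M.coordA (M.infPt w) = 0 := by
  rw [infPt_of_ne hw]; rfl

variable {M} in
lemma coordI_infPt (X : WSpace C V) {w : WSpace C V} (hw : w ≠ 0) :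
    M.coordI X (M.infPt w) = 0 := by
  rw [infPt_of_ne hw]; rfl

variable {M} in
lemma coordQ_infPt (X : WSpace C V) {w : WSpace C V} (hw : w ≠ 0) :
    M.coordQ X (M.infPt w) = M.Q w X / ‖w‖ ^ 2 := by
  rw [infPt_of_ne hw]; rfl

lemma one_add_sq_pos (w : WSpace C V) : 0 < 1 + ‖w‖ ^ 2 := by positivity

lemma exists_radius {ε : ℝ} (hε : 0 < ε) (K : ℝ) :
    ∃ R, 1 ≤ R ∧ ∀ r, R < r → K * r < ε * (1 + r ^ 2) := by
  refine ⟨max 1 (K / ε), le_max_left _ _, fun r hr => ?_⟩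
  have h1 := (le_max_left _ _).trans_lt hr
  have h2 := (le_max_right _ _).trans_lt hr
  rw [div_lt_iff₀ hε] at h2
  nlinarith

lemma continuous_coordA : Continuous M.coordA := by
  refine M.continuous_of_close ?_ ?_ fun ε hε => ?_
  · simp only [coordA_fin]
    exact continuous_const.div (by fun_prop) fun w => (one_add_sq_pos w).ne'
  · exact continuous_const.congr fun w => (coordA_infPt w.2).symm
  · obtain ⟨R, hR1, hR⟩ := exists_radius hε 1
    refine ⟨R, fun w hw => ?_⟩
    have hw0 : w ≠ 0 := by rintro rfl; simp at hw; linarith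
    rw [coordA_fin, coordA_infPt hw0, sub_zero, abs_of_pos (by positivity),
      div_lt_iff₀ (one_add_sq_pos w)]
    linarith [hR _ hw]

lemma continuous_coordI (X : WSpace C V) : Continuous (M.coordI X) := by
  refine M.continuous_of_close ?_ ?_ fun ε hε => ?_
  · simp only [coordI_fin]
    exact Continuous.div (by fun_prop) (by fun_prop) fun w => (one_add_sq_pos w).ne'
  · exact continuous_const.congr fun w => (coordI_infPt X w.2).symm
  · obtain ⟨R, hR1, hR⟩ := exists_radius hε ‖X‖
    refine ⟨R, fun w hw => ?_⟩
    have hw0 : w ≠ 0 := by rintro rfl; simp at hw; linarith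
    rw [coordI_fin, coordI_infPt X hw0, sub_zero, abs_div, abs_of_pos (one_add_sq_pos w),
      div_lt_iff₀ (one_add_sq_pos w)]
    linarith [hR _ hw, abs_real_inner_le_norm w X]

lemma Q_nonneg (w X : WSpace C V) : 0 ≤ M.Q w X := by rw [Q_eq]; positivity

lemma continuous_coordQ (X : WSpace C V) : Continuous (M.coordQ X) := by
  refine M.continuous_of_close ?_ ?_ fun ε hε => ?_
  · simp only [coordQ_fin]
    exact Continuous.div (M.continuous_Q continuous_id continuous_const) (by fun_prop)
      fun w => (one_add_sq_pos w).ne'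
  · refine Continuous.congr (f := fun w : {w : WSpace C V // w ≠ 0} => M.Q w.1 X / ‖w.1‖ ^ 2) ?_
      fun w => (coordQ_infPt X w.2).symm
    exact Continuous.div (M.continuous_Q continuous_subtype_val continuous_const) (by fun_prop)
      fun w => pow_ne_zero _ (norm_ne_zero_iff.2 w.2)
  · obtain ⟨R, hR1, hR⟩ := exists_radius hε (‖X‖ ^ 2)
    refine ⟨R, fun w hw => ?_⟩
    have hw0 : w ≠ 0 := by rintro rfl; simp at hw; linarith
    have hn := norm_pos_iff.2 hw0
    rw [coordQ_fin, coordQ_infPt X hw0]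
    have h1 : M.Q w X / (1 + ‖w‖ ^ 2) - M.Q w X / ‖w‖ ^ 2
        = -(M.Q w X / ‖w‖ ^ 2 / (1 + ‖w‖ ^ 2)) := by field_simp; ring
    have h2 : M.Q w X / ‖w‖ ^ 2 ≤ ‖X‖ ^ 2 := by
      rw [div_le_iff₀ (by positivity), mul_comm]; exact M.Q_le w X
    have h3 : 0 ≤ M.Q w X / ‖w‖ ^ 2 := div_nonneg (M.Q_nonneg w X) (by positivity)
    rw [h1, abs_neg, abs_of_nonneg (by positivity), div_lt_iff₀ (one_add_sq_pos w)]
    have := hR _ hw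
    have : ‖X‖ ^ 2 ≤ ‖X‖ ^ 2 * ‖w‖ := le_mul_of_one_le_right (sq_nonneg _) (by linarith)
    linarith

/-- The Veronese-type map of `CPW` into a product of lines. -/
def veronese (p : M.CPW) : ℝ × (WSpace C V → ℝ) × (WSpace C V → ℝ) :=
  (M.coordA p, fun X => M.coordI X p, fun X => M.coordQ X p)

lemma continuous_veronese : Continuous M.veronese :=
  M.continuous_coordA.prodMk ((continuous_pi fun X => M.continuous_coordI X).prodMk
    (continuous_pi fun X => M.continuous_coordQ X))

/-- `coordA` vanishes exactly at infinity. At finite points it recovers 1+|w|², and then `coordI`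
recovers w. -/
lemma veronese_injective : Function.Injective M.veronese := by
  intro p q h
  obtain ⟨h1, h2⟩ := Prod.ext_iff.1 h
  obtain ⟨h2, h3⟩ := Prod.ext_iff.1 h2
  replace h2 : ∀ X, M.coordI X p = M.coordI X q := fun X => congrFun h2 X
  replace h3 : ∀ X, M.coordQ X p = M.coordQ X q := fun X => congrFun h3 X
  replace h1 : M.coordA p = M.coordA q := h1
  have hpos : ∀ w : WSpace C V, (1 / (1 + ‖w‖ ^ 2) : ℝ) ≠ 0 := fun w => by positivity
  rcases M.cpw_cases' p with ⟨w, rfl⟩ | ⟨w, hw, rfl⟩ <;>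
    rcases M.cpw_cases' q with ⟨w', rfl⟩ | ⟨w', hw', rfl⟩
  · rw [coordA_fin, coordA_fin] at h1
    refine congrArg CPW.fin (ext_inner_right ℝ fun X => ?_)
    have := h2 X
    rw [coordI_fin, coordI_fin, div_eq_mul_one_div, h1, div_eq_mul_one_div (inner ℝ w' X)] at this
    exact mul_right_cancel₀ (hpos w') this
  · rw [coordA_fin, coordA_infPt hw'] at h1
    exact absurd h1 (hpos w)
  · rw [coordA_fin, coordA_infPt hw] at h1
    exact absurd h1.symm (hpos w')
  -- Testing `coordQ` with X = w puts both values in the equality case of Bessel's inequality, so w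
  -- lies in Cw'.
  · refine M.infPt_eq_of_mem hw ?_
    have hn := norm_ne_zero_iff.2 hw
    have hn' := norm_ne_zero_iff.2 hw'
    have := h3 w
    rw [coordQ_infPt w hw, coordQ_infPt w hw', (M.mem_line_iff_Q hw w).1 (M.self_mem_line w)] at this
    rw [M.mem_line_iff_Q hw']
    field_simp at this
    linarith

/-! ### Compactness of `CPW` -/

/-- The closed hemisphere of `ℝ ⊕ W`, which parametrizes `CPW`. -/
def hemisphere (C V : Type*) [NormedAddCommGroup C] [InnerProductSpace ℝ C]
    [NormedAddCommGroup V] [InnerProductSpace ℝ V] : Set (ℝ × WSpace C V) :=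
  {x | 0 ≤ x.1 ∧ x.1 ^ 2 + ‖x.2‖ ^ 2 = 1}

lemma isCompact_hemisphere : IsCompact (hemisphere C V) := by
  apply Metric.isCompact_of_isClosed_isBounded
  · exact (isClosed_le continuous_const continuous_fst).inter
      (isClosed_eq (by fun_prop) continuous_const)
  · refine (Metric.isBounded_closedBall (x := (0 : ℝ × WSpace C V)) (r := 1)).subset ?_
    rintro ⟨t, w⟩ ⟨h1, h2⟩
    rw [mem_closedBall_zero_iff, Prod.norm_def, max_le_iff]
    simp only at h1 h2 ⊢
    rw [Real.norm_eq_abs]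
    exact ⟨abs_le_of_sq_le_sq' (by nlinarith [sq_nonneg ‖w‖]) zero_le_one |> abs_le.2,
      by nlinarith [norm_nonneg w, sq_nonneg t]⟩

open Classical in
/-- The map `(t, w) ↦ w / t` of the closed hemisphere onto `CPW`. -/
def hemiMap (x : hemisphere C V) : M.CPW :=
  if x.1.1 = 0 then M.infPt x.1.2 else .fin (x.1.1⁻¹ • x.1.2)

lemma infPt_smul {r : ℝ} (hr : r ≠ 0) {w : WSpace C V} (hw : w ≠ 0) :
    M.infPt (r • w) = M.infPt w :=
  M.infPt_eq_of_mem (smul_ne_zero hr hw) (Submodule.smul_mem _ _ (M.self_mem_line w))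

/-- At a boundary point (0,w) this is the definition of the topology at infinity: for small t > 0
the point w/t has the class of w, and its norm exceeds any given R. -/
lemma continuous_hemiMap : Continuous M.hemiMap := by
  rw [continuous_def]
  intro S hS
  rw [isOpen_iff_mem_nhds]
  rintro ⟨⟨t, w⟩, ht, hw⟩ hx
  simp only at ht hw
  have hc1 : Continuous fun y : hemisphere C V => y.1.1 := by fun_prop
  have hc2 : Continuous fun y : hemisphere C V => y.1.2 := by fun_prop
  by_cases h0 : t = 0
  · subst h0
    have hw0 : w ≠ 0 := by rintro rfl; simp at hw
    have hx' : CPW.inf (M.proj w hw0) ∈ S := by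
      rw [← infPt_of_ne hw0]
      simpa [hemiMap] using hx
    obtain ⟨U, hU, hpU, R, hR, hS1, hS2⟩ := hS.2 _ hx'
    have hev : ∀ᶠ y in 𝓝 w, ∃ hy : y ≠ 0, M.proj y hy ∈ U := by
      have h1 := (hU.preimage M.continuous_proj)
      rw [isOpen_induced_iff] at h1
      obtain ⟨O, hO, hO'⟩ := h1
      have hwO : w ∈ O := by
        have : (⟨w, hw0⟩ : {w : WSpace C V // w ≠ 0}) ∈ Subtype.val ⁻¹' O := hO' ▸ hpU
        exact this
      filter_upwards [hO.mem_nhds hwO, isOpen_ne.mem_nhds hw0] with y hy hy0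
      refine ⟨hy0, ?_⟩
      have : (⟨y, hy0⟩ : {w : WSpace C V // w ≠ 0}) ∈ Subtype.val ⁻¹' O := hy
      rw [hO'] at this
      exact this
    have hev1 : ∀ᶠ y : hemisphere C V in 𝓝 ⟨(0, w), ht, hw⟩, ∃ hy : y.1.2 ≠ 0,
      M.proj y.1.2 hy ∈ U := (hc2.tendsto ⟨(0, w), ht, hw⟩).eventually hev
    have hev2 : ∀ᶠ y : hemisphere C V in 𝓝 ⟨(0, w), ht, hw⟩, R * y.1.1 < ‖y.1.2‖ := by
      refine ((hc1.const_mul R).continuousAt.eventually_lt hc2.norm.continuousAt ?_)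
      simpa using hw0
    filter_upwards [hev1, hev2] with y ⟨hy, hyU⟩ hyR
    change M.hemiMap y ∈ S
    rw [hemiMap]
    split_ifs with h
    · rw [infPt_of_ne hy]; exact hS1 _ hyU
    · have hpos : 0 < y.1.1 := lt_of_le_of_ne y.2.1 (Ne.symm h)
      have hy' : y.1.1⁻¹ • y.1.2 ≠ 0 := smul_ne_zero (_root_.inv_ne_zero h) hy
      refine hS2 _ hy' ?_ ?_
      · have := M.infPt_smul (_root_.inv_ne_zero h) hy
        rw [infPt_of_ne hy', infPt_of_ne hy, CPW.inf.injEq] at this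
        rwa [this]
      · rw [norm_smul, _root_.norm_inv, Real.norm_eq_abs, abs_of_pos hpos, inv_mul_eq_div,
          lt_div_iff₀ hpos]
        exact hyR
  · have hx' : CPW.fin (t⁻¹ • w) ∈ S := by simpa [hemiMap, h0] using hx
    have hc : ContinuousAt (fun y : hemisphere C V => (CPW.fin (y.1.1⁻¹ • y.1.2) : M.CPW))
        ⟨(t, w), ht, hw⟩ :=
      M.continuous_fin.continuousAt.comp
        ((hc1.continuousAt.inv₀ h0).smul hc2.continuousAt)
    filter_upwards [hc.eventually (hS.mem_nhds hx'), (isOpen_ne.preimage hc1).mem_nhds h0]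
      with y hy hy0
    change M.hemiMap y ∈ S
    rw [hemiMap, if_neg hy0]
    exact hy

lemma hemiMap_surjective : Function.Surjective M.hemiMap := by
  intro p
  rcases M.cpw_cases' p with ⟨w, rfl⟩ | ⟨w, hw, rfl⟩
  · have hp := one_add_sq_pos w
    have hq := Real.sqrt_pos.2 hp
    refine ⟨⟨((√(1 + ‖w‖ ^ 2))⁻¹, (√(1 + ‖w‖ ^ 2))⁻¹ • w), by positivity, ?_⟩, ?_⟩
    · simp only [norm_smul, _root_.norm_inv, Real.norm_eq_abs, abs_of_pos hq, mul_pow, inv_pow,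
        Real.sq_sqrt hp.le]
      field_simp
    · rw [hemiMap, if_neg (_root_.inv_ne_zero hq.ne')]
      rw [smul_smul, inv_mul_cancel₀ (_root_.inv_ne_zero hq.ne'), one_smul]
  · have hn := norm_pos_iff.2 hw
    refine ⟨⟨(0, ‖w‖⁻¹ • w), le_rfl, ?_⟩, ?_⟩
    · simp only [norm_smul, _root_.norm_inv, norm_norm]
      field_simp; ring
    · rw [hemiMap, if_pos rfl]
      exact M.infPt_smul (_root_.inv_ne_zero hn.ne') hw

instance : CompactSpace M.CPW := by
  have := isCompact_iff_compactSpace.1 (isCompact_hemisphere (C := C) (V := V))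
  exact M.hemiMap_surjective.compactSpace M.continuous_hemiMap

/-- A continuous injection of a compact space into a Hausdorff space is a closed embedding. From
here on, continuity into `CPW` is tested on the coordinate functions, and `CPW` is Hausdorff. -/
lemma isClosedEmbedding_veronese : Topology.IsClosedEmbedding M.veronese :=
  M.continuous_veronese.isClosedEmbedding M.veronese_injective

instance : T2Space M.CPW := M.isClosedEmbedding_veronese.isEmbedding.t2Space

/-- Continuity of maps into `CPW` in terms of the coordinate functions. -/
lemma continuous_to_cpw {E : Type*} [TopologicalSpace E] {f : E → M.CPW}
    (h1 : Continuous fun e => M.coordA (f e)) (h2 : ∀ X, Continuous fun e => M.coordI X (f e))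
    (h3 : ∀ X, Continuous fun e => M.coordQ X (f e)) : Continuous f :=
  M.isClosedEmbedding_veronese.isInducing.continuous_iff.2
    (h1.prodMk ((continuous_pi h2).prodMk (continuous_pi h3)))

/-- Q is homogeneous of degree 2 in w, so the coordinates of f(t)/t become quotients with
denominator t² + |f(t)|², which is nonzero at t = 0. -/
lemma tendsto_infPt {w : WSpace C V} (hw : w ≠ 0) {f : ℝ → WSpace C V}
    (hf : Continuous f) (hf0 : f 0 = w) :
    Filter.Tendsto (fun t : ℝ => (CPW.fin (t⁻¹ • f t) : M.CPW)) (𝓝[≠] 0) (𝓝 (M.infPt w)) := by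
  rw [M.isClosedEmbedding_veronese.isInducing.tendsto_nhds_iff]
  have hn := norm_pos_iff.2 hw
  have key : ∀ t : ℝ, t ≠ 0 → (1 + ‖t⁻¹ • f t‖ ^ 2) = (t ^ 2 + ‖f t‖ ^ 2) / t ^ 2 := fun t ht => by
    rw [norm_smul, _root_.norm_inv, mul_pow, inv_pow, Real.norm_eq_abs, sq_abs]; field_simp
  have hQ : ∀ (t : ℝ) (y X : WSpace C V), M.Q (t • y) X = t ^ 2 * M.Q y X := fun t y X => by
    have := M.norm_coord_J (t • M.one) y.snd X.snd
    rw [map_smul, LinearMap.smul_apply, M.J_one, norm_smul, M.norm_one, _root_.mul_one,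
      Real.norm_eq_abs, sq_abs] at this
    simp only [Q, WithLp.smul_fst, WithLp.smul_snd, this, M.conj_smul, map_smul,
      LinearMap.smul_apply, inner_smul_left, norm_smul, mul_pow, Real.norm_eq_abs, sq_abs,
      conj_trivial]
    ring
  refine Filter.Tendsto.prodMk_nhds ?_ (Filter.Tendsto.prodMk_nhds (tendsto_pi_nhds.2 fun X => ?_)
    (tendsto_pi_nhds.2 fun X => ?_))
  · have : Filter.Tendsto (fun t : ℝ => t ^ 2 / (t ^ 2 + ‖f t‖ ^ 2)) (𝓝[≠] 0) (𝓝 0) := by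
      refine Filter.Tendsto.mono_left ?_ nhdsWithin_le_nhds
      have : ContinuousAt (fun t : ℝ => t ^ 2 / (t ^ 2 + ‖f t‖ ^ 2)) 0 :=
        ContinuousAt.div (by fun_prop) (by fun_prop) (by rw [hf0]; positivity)
      simpa [ContinuousAt] using this
    simp only [coordA_infPt hw]
    refine this.congr' ?_
    filter_upwards [self_mem_nhdsWithin] with t ht
    rw [coordA_fin, key t ht, one_div_div]
  · have : Filter.Tendsto (fun t : ℝ => t * inner ℝ (f t) X / (t ^ 2 + ‖f t‖ ^ 2)) (𝓝[≠] 0)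
        (𝓝 0) := by
      refine Filter.Tendsto.mono_left ?_ nhdsWithin_le_nhds
      have : ContinuousAt (fun t : ℝ => t * inner ℝ (f t) X / (t ^ 2 + ‖f t‖ ^ 2)) 0 :=
        ContinuousAt.div (by fun_prop) (by fun_prop) (by rw [hf0]; positivity)
      simpa [ContinuousAt] using this
    simp only [coordI_infPt X hw]
    refine this.congr' ?_
    filter_upwards [self_mem_nhdsWithin] with t ht
    have ht : t ≠ 0 := ht
    change _ = M.coordI X _
    simp only [coordI_fin, key t ht, inner_smul_left, conj_trivial]
    field_simp
  · have : Filter.Tendsto (fun t : ℝ => M.Q (f t) X / (t ^ 2 + ‖f t‖ ^ 2)) (𝓝[≠] 0)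
        (𝓝 (M.Q w X / ‖w‖ ^ 2)) := by
      refine Filter.Tendsto.mono_left ?_ nhdsWithin_le_nhds
      have : ContinuousAt (fun t : ℝ => M.Q (f t) X / (t ^ 2 + ‖f t‖ ^ 2)) 0 :=
        ContinuousAt.div (M.continuous_Q hf continuous_const).continuousAt (by fun_prop)
          (by rw [hf0]; positivity)
      simpa [ContinuousAt, hf0] using this
    simp only [coordQ_infPt X hw]
    refine this.congr' ?_
    filter_upwards [self_mem_nhdsWithin] with t ht
    have ht : t ≠ 0 := ht
    change _ = M.coordQ X _
    simp only [coordQ_fin, key t ht, hQ]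
    field_simp

lemma dense_range_fin : DenseRange (CPW.fin : WSpace C V → M.CPW) := by
  intro p
  rcases M.cpw_cases' p with ⟨w, rfl⟩ | ⟨w, hw, rfl⟩
  · exact subset_closure ⟨w, rfl⟩
  exact mem_closure_of_tendsto (M.tendsto_infPt hw continuous_const rfl)
    (Filter.Eventually.of_forall fun t => ⟨_, rfl⟩)

/-! ### Homeomorphisms of `CPW` -/

variable {M} in
/-- The extension of a line-preserving isometry to `CPW`. -/
def extFun {T : WSpace C V ≃ₗᵢ[ℝ] WSpace C V} (hT : M.IsSpread T) : M.CPW → M.CPW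
  | .fin w => .fin (T w)
  | .inf q => Quotient.lift (s := M.setoid) (fun w => M.infPt (T w.1))
      (fun w w' h => (M.infPt_eq_iff (by simpa using w.2) (by simpa using w'.2)).2
        (hT.line_eq (M.line_eq_of_mem w.2 ((M.mem_line_iff w'.2 w.1).2 (Or.inr ⟨w.2, h⟩))))) q

variable {M} in
lemma extFun_infPt {T : WSpace C V ≃ₗᵢ[ℝ] WSpace C V} (hT : M.IsSpread T) {w : WSpace C V}
    (hw : w ≠ 0) : extFun hT (M.infPt w) = M.infPt (T w) := by
  rw [infPt_of_ne hw]; rfl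

variable {M} in
lemma map_ne {T : WSpace C V ≃ₗᵢ[ℝ] WSpace C V} {w : WSpace C V} (hw : w ≠ 0) : T w ≠ 0 := by
  simpa using hw

variable {M} in
-- T preserves norms, inner products and Q, so it pulls the coordinate functions back to coordinate
-- functions.
lemma continuous_extFun {T : WSpace C V ≃ₗᵢ[ℝ] WSpace C V} (hT : M.IsSpread T) :
    Continuous (extFun hT) := by
  refine M.continuous_to_cpw ?_ (fun X => ?_) (fun X => ?_)
  · refine M.continuous_coordA.congr fun p => ?_
    rcases M.cpw_cases' p with ⟨w, rfl⟩ | ⟨w, hw, rfl⟩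
    · change _ = M.coordA (.fin (T w))
      rw [coordA_fin, coordA_fin, T.norm_map]
    · rw [extFun_infPt hT hw, coordA_infPt hw, coordA_infPt (map_ne hw)]
  · obtain ⟨X, rfl⟩ := T.surjective X
    refine (M.continuous_coordI X).congr fun p => ?_
    rcases M.cpw_cases' p with ⟨w, rfl⟩ | ⟨w, hw, rfl⟩
    · change _ = M.coordI _ (.fin (T w))
      rw [coordI_fin, coordI_fin, T.norm_map, T.inner_map_map]
    · rw [extFun_infPt hT hw, coordI_infPt _ hw, coordI_infPt _ (map_ne hw)]
  · obtain ⟨X, rfl⟩ := T.surjective X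
    refine (M.continuous_coordQ X).congr fun p => ?_
    rcases M.cpw_cases' p with ⟨w, rfl⟩ | ⟨w, hw, rfl⟩
    · change _ = M.coordQ _ (.fin (T w))
      rw [coordQ_fin, coordQ_fin, T.norm_map, hT.Q_map]
    · rw [extFun_infPt hT hw, coordQ_infPt _ hw, coordQ_infPt _ (map_ne hw), T.norm_map, hT.Q_map]

variable {M} in
/-- The extension of a line-preserving isometry to a homeomorphism of `CPW`. -/
def ext {T : WSpace C V ≃ₗᵢ[ℝ] WSpace C V} (hT : M.IsSpread T) : M.CPW ≃ₜ M.CPW where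
  toFun := extFun hT
  invFun := extFun hT.symm
  left_inv p := by
    rcases M.cpw_cases' p with ⟨w, rfl⟩ | ⟨w, hw, rfl⟩
    · change CPW.fin (T.symm (T w)) = _
      simp
    · rw [extFun_infPt hT hw, extFun_infPt hT.symm (map_ne hw)]; simp
  right_inv p := by
    rcases M.cpw_cases' p with ⟨w, rfl⟩ | ⟨w, hw, rfl⟩
    · change CPW.fin (T (T.symm w)) = _
      simp
    · rw [extFun_infPt hT.symm hw, extFun_infPt hT (map_ne hw)]; simp
  continuous_toFun := continuous_extFun hT
  continuous_invFun := continuous_extFun hT.symm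

variable {M} in
lemma ext_fin {T : WSpace C V ≃ₗᵢ[ℝ] WSpace C V} (hT : M.IsSpread T) (w : WSpace C V) :
    ext hT (.fin w) = .fin (T w) := rfl

variable {M} in
lemma ext_infPt {T : WSpace C V ≃ₗᵢ[ℝ] WSpace C V} (hT : M.IsSpread T) {w : WSpace C V}
    (hw : w ≠ 0) : ext hT (M.infPt w) = M.infPt (T w) := extFun_infPt hT hw

variable {M} in
lemma ext_symm {T : WSpace C V ≃ₗᵢ[ℝ] WSpace C V} (hT : M.IsSpread T) :
    (ext hT).symm = ext hT.symm := rfl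

/-! ### The inversion as a homeomorphism, and the charts as its conjugates -/

open Classical in
/-- The involution of `CPW` that extends `(ζ, v) ↦ (ζ⁻¹, ζ⁻¹v)`. -/
def inversionFun : M.CPW → M.CPW
  | .fin w => M.chartZero w
  | .inf q => Quotient.lift (s := M.setoid)
      (fun w => if w.1.fst = 0 then M.infPt w.1
        else .fin (pr 0 (M.J (M.inv w.1.fst) w.1.snd)))
      (fun w w' h => by
        have e : M.infPt w.1 = M.infPt w'.1 := (M.infPt_eq_iff w.2 w'.2).2
          (M.line_eq_of_mem w.2 ((M.mem_line_iff w'.2 w.1).2 (Or.inr ⟨w.2, h⟩)))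
        rcases h with ⟨h, h', _⟩ | ⟨h, h', h''⟩
        · simp only [h, h', if_true, e]
        · simp only [h, h', if_false, h'']) q

lemma inversionFun_fin {ζ : C} (h : ζ ≠ 0) (v : V) :
    M.inversionFun (.fin (pr ζ v)) = .fin (pr (M.inv ζ) (M.J (M.inv ζ) v)) := if_neg h

lemma inversionFun_fin_zero (v : V) :
    M.inversionFun (.fin (pr 0 v)) = M.infPt (pr M.one v) := by
  rw [infPt_of_ne (M.pr_one_ne v)]
  exact if_pos rfl

lemma inversionFun_infPt_one (v : V) :
    M.inversionFun (M.infPt (pr M.one v)) = .fin (pr 0 v) := by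
  rw [infPt_of_ne (M.pr_one_ne v)]
  refine (if_neg M.one_ne_zero).trans ?_
  simp [M.inv_one, M.J_one]

lemma inversionFun_infPt_zero {v : V} (hv : v ≠ 0) :
    M.inversionFun (M.infPt (pr 0 v)) = M.infPt (pr 0 v) := by
  conv_lhs => rw [infPt_of_ne (pr_zero_ne hv)]
  exact if_pos rfl

lemma inversionFun_involutive : Function.Involutive M.inversionFun := by
  intro p
  rcases M.cpw_cases p with ⟨ζ, v, h, rfl⟩ | ⟨v, rfl⟩ | ⟨v, rfl⟩ | ⟨v, h, rfl⟩
  · rw [M.inversionFun_fin h, M.inversionFun_fin (M.inv_ne_zero h), M.inv_inv h, M.J_J_inv h]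
  · rw [M.inversionFun_fin_zero, M.inversionFun_infPt_one]
  · rw [M.inversionFun_infPt_one, M.inversionFun_fin_zero]
  · rw [M.inversionFun_infPt_zero h, M.inversionFun_infPt_zero h]

lemma coord_zero_left (u : V) : M.coord (0 : V) u = 0 := by
  exact M.coordB.map_zero₂ u

lemma norm_inv_pr {ζ : C} (h : ζ ≠ 0) (v : V) :
    1 + ‖pr (M.inv ζ) (M.J (M.inv ζ) v)‖ ^ 2 = (1 + ‖pr ζ v‖ ^ 2) / ‖ζ‖ ^ 2 := by
  have := norm_pos_iff.2 h
  rw [norm_pr_sq, norm_pr_sq, M.norm_J, M.norm_inv]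
  field_simp; ring

/-- In homogeneous coordinates (1,ζ,v) the inversion exchanges the first two entries, and the
coordinate functions behave like the entries of the projector onto the corresponding line. So each
of them pulls back to a linear combination of coordinate functions; this and the next two lemmas
give the continuity of the inversion. -/
lemma coordA_inversion (p : M.CPW) : M.coordA (M.inversionFun p) = M.coordQ (pr M.one 0) p := by
  rcases M.cpw_cases p with ⟨ζ, v, h, rfl⟩ | ⟨v, rfl⟩ | ⟨v, rfl⟩ | ⟨v, h, rfl⟩
  · rw [M.inversionFun_fin h, coordA_fin, M.norm_inv_pr h, coordQ_fin]
    simp [Q, M.norm_one]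
  · rw [M.inversionFun_fin_zero, coordA_infPt (M.pr_one_ne v), coordQ_fin]
    simp [Q]
  · rw [M.inversionFun_infPt_one, coordA_fin, coordQ_infPt _ (M.pr_one_ne v), norm_pr_sq,
      norm_pr_sq]
    simp [Q, M.norm_one]
  · rw [M.inversionFun_infPt_zero h, coordA_infPt (pr_zero_ne h), coordQ_infPt _ (pr_zero_ne h)]
    simp [Q]

lemma coordI_inversion (ξ : C) (u : V) (p : M.CPW) :
    M.coordI (pr ξ u) (M.inversionFun p) = M.coordI (pr (M.conj ξ) 0) p +
      (1 / 2) * (M.coordQ (pr M.one u) p - M.coordQ (pr M.one 0) p - M.coordQ (pr 0 u) p) := by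
  have hc : ∀ x y : C, inner ℝ (M.conj x) y = inner ℝ x (M.conj y) := fun x y => by
    simp only [conj, inner_sub_left, inner_sub_right, inner_smul_left, inner_smul_right,
      conj_trivial, real_inner_comm x M.one]
    ring
  -- Polarization isolates the mixed term of Q, which is the pairing of ζ̄v with u.
  have hQ : ∀ w : WSpace C V, M.Q w (pr M.one u) - M.Q w (pr M.one 0) - M.Q w (pr 0 u)
      = 2 * inner ℝ (M.J (M.conj w.fst) w.snd) u := fun w => by
    simp [Q, M.J_one]; ring
  rcases M.cpw_cases p with ⟨ζ, v, h, rfl⟩ | ⟨v, rfl⟩ | ⟨v, rfl⟩ | ⟨v, h, rfl⟩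
  · have hn := norm_pos_iff.2 h
    rw [M.inversionFun_fin h, coordI_fin, M.norm_inv_pr h]
    simp only [coordQ_fin, coordI_fin, ← sub_div]
    rw [hQ, inner_pr, inner_pr, ← hc]
    simp only [WithLp.toLp_fst, WithLp.toLp_snd, inner_zero_right, add_zero, M.conj_eq_smul_inv h, map_smul, LinearMap.smul_apply,
      inner_smul_left, conj_trivial]
    have := one_add_sq_pos (pr ζ v)
    field_simp
  · rw [M.inversionFun_fin_zero, coordI_infPt _ (M.pr_one_ne v)]
    simp only [coordQ_fin, coordI_fin, ← sub_div]
    rw [hQ, inner_pr]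
    simp [M.conj_zero]
  · rw [M.inversionFun_infPt_one, coordI_fin, coordI_infPt _ (M.pr_one_ne v)]
    simp only [coordQ_infPt _ (M.pr_one_ne v), ← sub_div]
    rw [hQ, inner_pr, norm_pr_sq, norm_pr_sq]
    simp [M.conj_one, M.J_one, M.norm_one]
    ring
  · rw [M.inversionFun_infPt_zero h, coordI_infPt _ (pr_zero_ne h)]
    simp only [coordI_infPt _ (pr_zero_ne h), coordQ_infPt _ (pr_zero_ne h), ← sub_div]
    rw [hQ]
    simp [M.conj_zero]

lemma coordQ_inversion (ξ : C) (u : V) (p : M.CPW) :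
    M.coordQ (pr ξ u) (M.inversionFun p) = ‖ξ‖ ^ 2 * M.coordA p +
      2 * M.coordI (pr 0 (M.J (M.conj ξ) u)) p + M.coordQ (pr 0 u) p := by
  rcases M.cpw_cases p with ⟨ζ, v, h, rfl⟩ | ⟨v, rfl⟩ | ⟨v, rfl⟩ | ⟨v, h, rfl⟩
  · have hn := norm_pos_iff.2 h
    have hp := one_add_sq_pos (pr ζ v)
    rw [M.inversionFun_fin h, coordQ_fin, M.norm_inv_pr h, coordQ_fin, coordA_fin, coordI_fin]
    simp only [Q, inner_pr]
    have h1 : M.J (M.conj (M.inv ζ)) (M.J (M.inv ζ) v) = (‖ζ‖⁻¹ ^ 2) • v := by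
      rw [M.J_conj_J, M.norm_inv]
    simp only [WithLp.toLp_fst, WithLp.toLp_snd, h1, map_smul, inner_smul_left, M.inner_J_left ξ,
      conj_trivial, M.norm_coord_J, M.norm_inv]
    simp only [inner_zero_right, zero_add, map_zero, LinearMap.zero_apply, inner_zero_left,
      norm_zero]
    field_simp
    ring
  · rw [M.inversionFun_fin_zero, coordQ_infPt _ (M.pr_one_ne v), coordA_fin, coordI_fin,
      coordQ_fin, norm_pr_sq, norm_pr_sq, inner_pr]
    simp [Q, M.conj_one, M.J_one, M.norm_one, M.inner_J_left ξ]
    ring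
  · rw [M.inversionFun_infPt_one, coordQ_fin, coordA_infPt (M.pr_one_ne v),
      coordI_infPt _ (M.pr_one_ne v), coordQ_infPt _ (M.pr_one_ne v), norm_pr_sq, norm_pr_sq]
    simp [Q, M.conj_zero, M.norm_one]
  · rw [M.inversionFun_infPt_zero h, coordQ_infPt _ (pr_zero_ne h), coordA_infPt (pr_zero_ne h),
      coordI_infPt _ (pr_zero_ne h), coordQ_infPt _ (pr_zero_ne h)]
    simp [Q, M.conj_zero]

lemma continuous_inversionFun : Continuous M.inversionFun := by
  refine M.continuous_to_cpw ?_ (fun X => ?_) (fun X => ?_)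
  · exact (M.continuous_coordQ _).congr fun p => (M.coordA_inversion p).symm
  · have h := ((M.continuous_coordI (pr (M.conj X.fst) 0))).add
      ((((M.continuous_coordQ (pr M.one X.snd)).sub (M.continuous_coordQ (pr M.one 0))).sub
        (M.continuous_coordQ (pr 0 X.snd))).const_mul (1 / 2))
    exact h.congr fun p => (M.coordI_inversion X.fst X.snd p).symm
  · have h := ((M.continuous_coordA.const_mul (‖X.fst‖ ^ 2)).add
      ((M.continuous_coordI (pr 0 (M.J (M.conj X.fst) X.snd))).const_mul 2)).add
        (M.continuous_coordQ (pr 0 X.snd))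
    exact h.congr fun p => (M.coordQ_inversion X.fst X.snd p).symm

/-- The involution of `CPW` that extends `(ζ, v) ↦ (ζ⁻¹, ζ⁻¹v)`, as a homeomorphism. -/
def inversion : M.CPW ≃ₜ M.CPW where
  toFun := M.inversionFun
  invFun := M.inversionFun
  left_inv := M.inversionFun_involutive
  right_inv := M.inversionFun_involutive
  continuous_toFun := M.continuous_inversionFun
  continuous_invFun := M.continuous_inversionFun

lemma inversion_inversion (p : M.CPW) : M.inversion (M.inversion p) = p :=
  M.inversionFun_involutive p

lemma inversion_fin {ζ : C} (h : ζ ≠ 0) (v : V) :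
    M.inversion (.fin (pr ζ v)) = .fin (pr (M.inv ζ) (M.J (M.inv ζ) v)) := M.inversionFun_fin h v

lemma inversion_fin_zero (v : V) :
    M.inversion (.fin (pr 0 v)) = M.infPt (pr M.one v) := M.inversionFun_fin_zero v

lemma inversion_infPt_one (v : V) :
    M.inversion (M.infPt (pr M.one v)) = .fin (pr 0 v) := M.inversionFun_infPt_one v

lemma inversion_infPt_zero {v : V} (hv : v ≠ 0) :
    M.inversion (M.infPt (pr 0 v)) = M.infPt (pr 0 v) := M.inversionFun_infPt_zero hv

lemma inversion_infPt {ζ : C} (h : ζ ≠ 0) (v : V) :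
    M.inversion (M.infPt (pr ζ v)) = .fin (pr 0 (M.J (M.inv ζ) v)) := by
  rw [M.infPt_pr h, M.inversion_infPt_one]

/-- φ_v is φ₀ conjugated by the swap of C with Cv. Transition maps therefore become words in the
inversion and linear isometries. -/
lemma chartVec_eq {v : V} (hv : ‖v‖ = 1) (w : WSpace C V) : M.chartVec v hv w
    = ext (M.isSpread_swap hv) (M.inversion (ext (M.isSpread_swap hv) (.fin w))) := by
  obtain ⟨η, v', hx, hv'⟩ := M.exists_decomp hv w.snd
  have hη : M.coord v w.snd = η := by rw [hx, M.coord_add hv η hv']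
  have hw : w = pr w.fst (M.J η v + v') := by rw [← hx]; rfl
  have hs : M.swap hv w = pr η (M.J w.fst v + v') := by rw [hw, M.swap_apply hv hv']; rfl
  rw [ext_fin, hs]
  by_cases h : η = 0
  · have h' : M.coord v w.snd = 0 := hη.trans h
    rw [chartVec, dif_pos h', h, M.inversion_fin_zero, ext_infPt _ (M.pr_one_ne _)]
    have h1 := M.swap_apply hv hv' M.one w.fst
    rw [M.J_one] at h1
    rw [h1, ← infPt_of_ne (M.chartVec_aux hv h'), hx, h]
    simp
  · have h' : M.coord v w.snd ≠ 0 := fun h' => h (hη.symm.trans h')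
    rw [chartVec, dif_neg h', M.inversion_fin h, ext_fin, CPW.fin.injEq, hη]
    have h1 : M.J (M.inv η) (M.J w.fst v + v')
        = M.J (M.coord v (M.J (M.inv η) (M.J w.fst v))) v + M.J (M.inv η) v' := by
      rw [map_add, M.J_coord_of_mem hv]
      obtain ⟨ξ, hξ⟩ := M.exists_J_J (M.inv η) w.fst v
      exact ⟨ξ, hξ⟩
    rw [h1, M.swap_apply hv (M.orth_J hv' _), pr_inj]
    refine ⟨rfl, ?_⟩
    rw [hx]; simp

lemma eventually_add_smul_ne {E : Type*} [NormedAddCommGroup E] [NormedSpace ℝ E] (a : E) {b : E}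
    (hb : b ≠ 0) : ∀ᶠ t in 𝓝[≠] (0 : ℝ), a + t • b ≠ 0 := by
  by_cases ha : a = 0
  · filter_upwards [self_mem_nhdsWithin] with t ht
    rw [ha, zero_add]; exact smul_ne_zero ht hb
  · have hc : ContinuousAt (fun t : ℝ => a + t • b) 0 := by fun_prop
    exact (hc.eventually_ne (by simpa using ha)).filter_mono nhdsWithin_le_nhds

/-- The braid relation: the involutions `(ζ, v) ↦ (ζ⁻¹, ζ⁻¹v)` and `(ζ, ηv + v') ↦ (η, ζv + v')`
generate a symmetric group `S₃`. -/
lemma braid {v : V} (hv : ‖v‖ = 1) (p : M.CPW) :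
    ext (M.isSpread_swap hv) (M.inversion (ext (M.isSpread_swap hv) p))
      = M.inversion (ext (M.isSpread_swap hv) (M.inversion p)) := by
  set S := ext (M.isSpread_swap hv) with hS
  have hv0 : v ≠ 0 := by rintro rfl; simp at hv
  have key : ∀ w : WSpace C V, w.fst ≠ 0 → M.coord v w.snd ≠ 0 →
      S (M.inversion (S (.fin w))) = M.inversion (S (M.inversion (.fin w))) := by
    intro w hζ hη
    obtain ⟨η, v', hx, hv'⟩ := M.exists_decomp hv w.snd
    rw [hx, M.coord_add hv η hv'] at hη
    obtain ⟨ζ, rfl⟩ : ∃ ζ, w = pr ζ (M.J η v + v') := ⟨w.fst, by rw [← hx]; rfl⟩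
    replace hζ : ζ ≠ 0 := hζ
    have e1 : M.J (M.inv η) (M.J ζ v + v') = M.J (M.mul v (M.inv η) ζ) v + M.J (M.inv η) v' := by
      rw [map_add, M.J_mul hv]
    have e2 : M.J (M.inv ζ) (M.J η v + v') = M.J (M.mul v (M.inv ζ) η) v + M.J (M.inv ζ) v' := by
      rw [map_add, M.J_mul hv]
    have hθ : M.mul v (M.inv ζ) η ≠ 0 := by
      rw [← norm_ne_zero_iff, M.norm_mul hv]
      exact mul_ne_zero (norm_ne_zero_iff.2 (M.inv_ne_zero hζ)) (norm_ne_zero_iff.2 hη)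
    have hζ' := norm_pos_iff.2 hζ
    have hη' := norm_pos_iff.2 hη
    -- For ζ, η ≠ 0 the first components of the two words are η⁻¹ζ and (ζ⁻¹η)⁻¹. The V-components
    -- then agree because (η⁻¹ζ)(ζ⁻¹v) = η⁻¹v, and the same on v'.
    have e3 : M.inv (M.mul v (M.inv ζ) η) = M.mul v (M.inv η) ζ := by
      rw [inv, M.norm_mul hv, M.conj_mul hv, M.norm_inv, inv, M.conj_smul, M.conj_conj, inv]
      simp only [mul, map_smul, LinearMap.smul_apply, smul_smul]
      congr 1; field_simp
    have e4 : M.J (M.mul v (M.inv η) ζ) (M.J (M.inv ζ) v) = M.J (M.inv η) v := by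
      have := M.mul_mul_conj hv (M.inv η) ζ
      rw [← M.J_mul hv (M.mul v _ _), inv, inv]
      rw [inv] at this
      rw [mul, map_smul, LinearMap.smul_apply, map_smul, map_smul]
      rw [mul] at this
      rw [this, smul_smul, inv_mul_cancel₀ (by positivity), one_smul]
    rw [hS, ext_fin, M.swap_apply hv hv', M.inversion_fin hη, ext_fin, e1,
      M.swap_apply hv (M.orth_J hv' _), M.inversion_fin hζ, ext_fin, e2,
      M.swap_apply hv (M.orth_J hv' _), M.inversion_fin hθ, e3, map_add, e4,
      M.mul_J hv (M.orth_J hv' _), M.J_J_inv hζ]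
  -- The remaining points are reached by density: adding t(1,v) makes both coordinates nonzero for
  -- small t ≠ 0.
  have hd : DenseRange (fun w : {w : WSpace C V // w.fst ≠ 0 ∧ M.coord v w.snd ≠ 0} =>
      (CPW.fin w.1 : M.CPW)) := by
    intro p
    refine closure_minimal ?_ isClosed_closure (M.dense_range_fin p)
    rintro _ ⟨w, rfl⟩
    have hc : Continuous fun t : ℝ => (CPW.fin (w + t • pr M.one v) : M.CPW) :=
      M.continuous_fin.comp (by fun_prop)
    have ht : Filter.Tendsto (fun t : ℝ => (CPW.fin (w + t • pr M.one v) : M.CPW)) (𝓝[≠] 0)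
        (𝓝 (.fin w)) := by
      have := hc.tendsto 0
      rw [zero_smul, add_zero] at this
      exact this.mono_left nhdsWithin_le_nhds
    refine mem_closure_of_tendsto ht ?_
    filter_upwards [eventually_add_smul_ne w.fst M.one_ne_zero,
      eventually_add_smul_ne (M.coord v w.snd) M.one_ne_zero] with t h1 h2
    refine ⟨⟨w + t • pr M.one v, h1, ?_⟩, rfl⟩
    have h3 := M.coord_J' hv M.one
    rw [M.J_one] at h3
    have h4 : (w + t • pr M.one v).snd = w.snd + t • v := rfl
    rw [h4, map_add, map_smul, h3]
    exact h2
  refine congrFun (hd.equalizer ((S.continuous.comp M.inversion.continuous).comp S.continuous)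
    ((M.inversion.continuous.comp S.continuous).comp M.inversion.continuous) ?_) p
  funext w
  exact key w.1 w.2.1 w.2.2

/-- The extension to `CPW` of a translation of `W`, as a bijection. -/
def translation (b : WSpace C V) : M.CPW ≃ M.CPW where
  toFun p := match p with
    | .fin w => .fin (w + b)
    | .inf q => .inf q
  invFun p := match p with
    | .fin w => .fin (w - b)
    | .inf q => .inf q
  left_inv p := by rcases p with w | q <;> simp
  right_inv p := by rcases p with w | q <;> simp

lemma translation_fin (b w : WSpace C V) : M.translation b (.fin w) = .fin (w + b) := rfl

variable {M} in
lemma translation_infPt (b : WSpace C V) {w : WSpace C V} (hw : w ≠ 0) :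
    M.translation b (M.infPt w) = M.infPt w := by
  rw [infPt_of_ne hw]; rfl

/-! ### Maps that are isometric in charts -/

/-- Read in the parametrizations `φ`, `ψ`, the map `h` is near `x` the smooth map `F`. -/
def Rep (h : M.CPW → M.CPW) (φ ψ : WSpace C V → M.CPW) (x y : WSpace C V)
    (F : WSpace C V → WSpace C V) : Prop :=
  F x = y ∧ ContDiffAt ℝ ∞ F x ∧ ∀ᶠ x' in 𝓝 x, h (φ x') = ψ (F x')

/-- Read in the parametrizations `φ`, `ψ`, the map `h` is smooth and isometric at `x`. -/
def IsomAt (h : M.CPW → M.CPW) (φ ψ : WSpace C V → M.CPW) (x y : WSpace C V) : Prop :=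
  ∃ F, M.Rep h φ ψ x y F ∧
    ∀ X, M.metric y (fderiv ℝ F x X) (fderiv ℝ F x X) = M.metric x X X

lemma isIsom_iff (u : M.CPW ≃ₜ M.CPW) : M.IsIsom u ↔
    ∀ φ ∈ M.atlas, ∀ ψ ∈ M.atlas, ∀ x y, u (φ x) = ψ y → M.IsomAt u φ ψ x y := by
  refine forall₂_congr fun φ _ => forall₂_congr fun ψ _ => forall₃_congr fun x y _ => ?_
  constructor
  · rintro ⟨F, h1, h2, h3, h4⟩
    exact ⟨F, ⟨h1, h2, h3⟩, fun X => h4 X X⟩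
  · rintro ⟨F, ⟨h1, h2, h3⟩, h4⟩
    exact ⟨F, h1, h2, h3, M.metric_of_self h4⟩

variable {M} in
lemma Rep.comp {h h' : M.CPW → M.CPW} {φ χ ψ : WSpace C V → M.CPW} {x z y : WSpace C V}
    {F F' : WSpace C V → WSpace C V} (hF' : M.Rep h' χ ψ z y F') (hF : M.Rep h φ χ x z F) :
    M.Rep (h' ∘ h) φ ψ x y (F' ∘ F) := by
  obtain ⟨rfl, h2, h3⟩ := hF
  obtain ⟨rfl, h5, h6⟩ := hF'
  refine ⟨rfl, h5.comp x h2, ?_⟩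
  filter_upwards [h3, h2.continuousAt.eventually h6] with a ha hb
  rw [Function.comp_apply, ha, hb]; rfl

variable {M} in
lemma Rep.fderiv_comp_apply {h h' : M.CPW → M.CPW} {φ χ ψ : WSpace C V → M.CPW} {x z y : WSpace C V}
    {F F' : WSpace C V → WSpace C V} (hF' : M.Rep h' χ ψ z y F') (hF : M.Rep h φ χ x z F)
    (X : WSpace C V) : fderiv ℝ (F' ∘ F) x X = fderiv ℝ F' z (fderiv ℝ F x X) := by
  obtain ⟨rfl, h2, h3⟩ := hF
  rw [_root_.fderiv_comp x (hF'.2.1.differentiableAt (by simp)) (h2.differentiableAt (by simp))]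
  rfl

variable {M} in
lemma IsomAt.comp {h h' : M.CPW → M.CPW} {φ χ ψ : WSpace C V → M.CPW} {x z y : WSpace C V}
    (hF' : M.IsomAt h' χ ψ z y) (hF : M.IsomAt h φ χ x z) : M.IsomAt (h' ∘ h) φ ψ x y := by
  obtain ⟨F, h1, h2⟩ := hF
  obtain ⟨F', h3, h4⟩ := hF'
  refine ⟨F' ∘ F, h3.comp h1, fun X => ?_⟩
  rw [h3.fderiv_comp_apply h1, h4, h2]

variable {M} in
/-- The inverse function theorem for representatives. -/
lemma Rep.symm {h : M.CPW ≃ M.CPW} {φ ψ : WSpace C V → M.CPW} {x y : WSpace C V}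
    {F : WSpace C V → WSpace C V} (hF : M.Rep h φ ψ x y F)
    (hinj : Function.Injective (fderiv ℝ F x)) :
    ∃ G, M.Rep h.symm ψ φ y x G ∧ ∀ Y, fderiv ℝ F x (fderiv ℝ G y Y) = Y := by
  obtain ⟨rfl, h2, h3⟩ := hF
  let A : WSpace C V ≃L[ℝ] WSpace C V :=
    (LinearEquiv.ofInjectiveEndo (fderiv ℝ F x).toLinearMap hinj).toContinuousLinearEquiv
  have hA : HasFDerivAt F (A : WSpace C V →L[ℝ] WSpace C V) x := by
    have : (A : WSpace C V →L[ℝ] WSpace C V) = fderiv ℝ F x := by ext; rfl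
    rw [this]
    exact (h2.differentiableAt (by simp)).hasFDerivAt
  have hs : HasStrictFDerivAt F (A : WSpace C V →L[ℝ] WSpace C V) x :=
    h2.hasStrictFDerivAt' hA (by simp)
  set G := h2.localInverse hA (by simp) with hG
  have hGx : G (F x) = x := h2.localInverse_apply_image hA (by simp)
  have hGs : ContDiffAt ℝ ∞ G (F x) := h2.to_localInverse hA (by simp)
  have hr : ∀ᶠ y' in 𝓝 (F x), F (G y') = y' := hs.eventually_right_inverse
  refine ⟨G, ⟨hGx, hGs, ?_⟩, fun Y => ?_⟩
  · have h4 : ∀ᶠ y' in 𝓝 (F x), h (φ (G y')) = ψ (F (G y')) :=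
      hGs.continuousAt.eventually (by rwa [hGx])
    filter_upwards [hr, h4] with y' h5 h6
    rw [h5] at h6
    rw [← h6, Equiv.symm_apply_apply]
  · have h4 : fderiv ℝ (F ∘ G) (F x) = ContinuousLinearMap.id ℝ _ := by
      have hr' : F ∘ G =ᶠ[𝓝 (F x)] id := hr
      rw [hr'.fderiv_eq, fderiv_id]
    have h5 : fderiv ℝ (F ∘ G) (F x) = (fderiv ℝ F x).comp (fderiv ℝ G (F x)) := by
      rw [_root_.fderiv_comp (F x) (by rw [hGx]; exact h2.differentiableAt (by simp))
        (hGs.differentiableAt (by simp)), hGx]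
    rw [h5] at h4
    exact DFunLike.congr_fun h4 Y

lemma injective_of_metric {x y : WSpace C V} {A : WSpace C V →L[ℝ] WSpace C V}
    (h : ∀ X, M.metric y (A X) (A X) = M.metric x X X) : Function.Injective A := by
  refine (injective_iff_map_eq_zero A).2 fun X hX => ?_
  by_contra h0
  have h1 := M.metric_pos x h0
  rw [← h, hX, metric_self] at h1
  simp [Q] at h1

variable {M} in
lemma IsomAt.symm {h : M.CPW ≃ M.CPW} {φ ψ : WSpace C V → M.CPW} {x y : WSpace C V}
    (hF : M.IsomAt h φ ψ x y) : M.IsomAt h.symm ψ φ y x := by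
  obtain ⟨F, h1, h2⟩ := hF
  obtain ⟨G, h3, h4⟩ := h1.symm (M.injective_of_metric h2)
  exact ⟨G, h3, fun X => by rw [← h2, h4]⟩

variable {M} in
lemma IsIsom.comp {u u' : M.CPW ≃ₜ M.CPW} (hu : M.IsIsom u) (hu' : M.IsIsom u') :
    M.IsIsom (u.trans u') := by
  rw [isIsom_iff] at *
  intro φ hφ ψ hψ x y h
  obtain ⟨χ, hχ, z, hz⟩ := M.exists_atlas (u (φ x))
  exact (hu' χ hχ ψ hψ z y (by rw [hz]; exact h)).comp (hu φ hφ χ hχ x z hz.symm)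

variable {M} in
lemma IsIsom.symm {u : M.CPW ≃ₜ M.CPW} (hu : M.IsIsom u) : M.IsIsom u.symm := by
  rw [isIsom_iff] at *
  intro φ hφ ψ hψ x y h
  exact IsomAt.symm (h := u.toEquiv) (hu ψ hψ φ hφ y x (by rw [← h, Homeomorph.apply_symm_apply]))

/-- `h` is smooth and isometric where it maps points of `W` to points of `W`. -/
def LocIsom (h : M.CPW → M.CPW) : Prop :=
  ∀ x y, h (.fin x) = .fin y → M.IsomAt h .fin .fin x y

/-- Every parametrization is a homeomorphism s of `CPW` restricted to W. A chart expression of h is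
hence the expression of t⁻¹hs on W. -/
lemma isomAt_of_conj {h : M.CPW → M.CPW} (s t : M.CPW ≃ₜ M.CPW) {φ ψ : WSpace C V → M.CPW}
    (hφ : ∀ x, φ x = s (.fin x)) (hψ : ∀ x, ψ x = t (.fin x))
    (hl : M.LocIsom (t.symm ∘ h ∘ s)) {x y : WSpace C V} (hxy : h (φ x) = ψ y) :
    M.IsomAt h φ ψ x y := by
  obtain ⟨F, ⟨h1, h2, h3⟩, h4⟩ := hl x y (by
    simp only [Function.comp_apply, ← hφ, hxy, hψ, Homeomorph.symm_apply_apply])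
  refine ⟨F, ⟨h1, h2, ?_⟩, h4⟩
  filter_upwards [h3] with x' hx'
  rw [hφ, hψ, ← hx']; simp

variable {M} in
lemma IsomAt.congr {h : M.CPW → M.CPW} {x y : WSpace C V}
    {T S : WSpace C V ≃ₗᵢ[ℝ] WSpace C V} (hT : M.IsSpread T) (hS : M.IsSpread S)
    (hi : M.IsomAt h .fin .fin (S x) (T.symm y)) :
    M.IsomAt (ext hT ∘ h ∘ ext hS) .fin .fin x y := by
  have key : ∀ {R : WSpace C V ≃ₗᵢ[ℝ] WSpace C V} (hR : M.IsSpread R) (a : WSpace C V),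
      M.IsomAt (ext hR) .fin .fin a (R a) := fun {R} hR a =>
    ⟨R, ⟨rfl, R.contDiff.contDiffAt, Filter.Eventually.of_forall fun b => ext_fin hR b⟩,
      fun X => by
        have : fderiv ℝ R a = (R.toContinuousLinearEquiv : WSpace C V →L[ℝ] WSpace C V) :=
          R.toContinuousLinearEquiv.fderiv
        rw [this]; exact hR.metric a X⟩
  have h1 := key hT (T.symm y)
  rw [T.apply_symm_apply] at h1
  exact h1.comp (hi.comp (key hS x))

lemma LocIsom.congr {h : M.CPW → M.CPW} (hh : M.LocIsom h)
    {T S : WSpace C V ≃ₗᵢ[ℝ] WSpace C V} (hT : M.IsSpread T) (hS : M.IsSpread S) :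
    M.LocIsom (ext hT ∘ h ∘ ext hS) := by
  intro x y hxy
  refine IsomAt.congr hT hS (hh _ _ ?_)
  have := congrArg (ext hT).symm hxy
  simp only [Function.comp_apply, Homeomorph.symm_apply_apply] at this
  exact this

lemma locIsom_id : M.LocIsom id := by
  intro x y hxy
  obtain rfl : x = y := by simpa using hxy
  exact ⟨id, ⟨rfl, contDiffAt_id, Filter.Eventually.of_forall fun _ => rfl⟩, fun X => by simp⟩

lemma locIsom_ext {T : WSpace C V ≃ₗᵢ[ℝ] WSpace C V} (hT : M.IsSpread T) :
    M.LocIsom (ext hT) :=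
  LocIsom.congr M M.locIsom_id hT IsSpread.refl |> fun h => by
    convert h using 1
    funext p
    rcases M.cpw_cases' p with ⟨w, rfl⟩ | ⟨w, hw, rfl⟩
    · rfl
    · simp [ext_infPt _ hw]

/-! ### The inversion is isometric -/

/-- For a unit vector v, the action of a respects Cv and its complement, and on Cv it is the
norm-multiplicative product. -/
lemma norm_coord_J_right (v x : V) (a : C) : ‖M.coord v (M.J a x)‖ = ‖a‖ * ‖M.coord v x‖ := by
  by_cases hv : v = 0
  · subst hv; simp [coord_zero_left]
  obtain ⟨v₁, hv₁, h⟩ := exists_unit hv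
  have hs : ∀ y, M.coord v y = ‖v‖ • M.coord v₁ y := fun y => by
    conv_lhs => rw [h]
    exact M.coordB.map_smul₂ _ _ _
  obtain ⟨η, x', rfl, hx'⟩ := M.exists_decomp hv₁ x
  rw [hs, hs, M.coord_add hv₁ η hx', map_add, ← M.J_mul hv₁, M.coord_add hv₁ _ (M.orth_J hx' a),
    norm_smul, norm_smul, M.norm_mul hv₁]
  ring

/-- The map `(ζ, v) ↦ (ζ⁻¹, ζ⁻¹v)` of `W`. -/
def invW (w : WSpace C V) : WSpace C V := pr (M.inv w.fst) (M.J (M.inv w.fst) w.snd)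

lemma contDiffAt_invW {w : WSpace C V} (hw : w.fst ≠ 0) : ContDiffAt ℝ ∞ M.invW w :=
  contDiffAt_pr (M.contDiffAt_inv contDiff_wfst.contDiffAt hw)
    (M.contDiffAt_J (M.contDiffAt_inv contDiff_wfst.contDiffAt hw) contDiff_wsnd.contDiffAt)

lemma hasDerivAt_J {a : ℝ → C} {b : ℝ → V} {a' : C} {b' : V} {t : ℝ} (ha : HasDerivAt a a' t)
    (hb : HasDerivAt b b' t) :
    HasDerivAt (fun s => M.J (a s) (b s)) (M.J (a t) b' + M.J a' (b t)) t :=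
  (LinearMap.toContinuousLinearMap
    (LinearMap.toContinuousLinearMap.toLinearMap ∘ₗ M.J)).hasDerivAt_of_bilinear
      (fun _ => ha) (fun _ => hb)

lemma hasDerivAt_wfst {a : ℝ → WSpace C V} {a' : WSpace C V} {t : ℝ} (ha : HasDerivAt a a' t) :
    HasDerivAt (fun s => (a s).fst) a'.fst t :=
  (LinearMap.toContinuousLinearMap (WithLp.fstₗ 2 ℝ C V)).hasFDerivAt.comp_hasDerivAt t ha

lemma hasDerivAt_wsnd {a : ℝ → WSpace C V} {a' : WSpace C V} {t : ℝ} (ha : HasDerivAt a a' t) :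
    HasDerivAt (fun s => (a s).snd) a'.snd t :=
  (LinearMap.toContinuousLinearMap (WithLp.sndₗ 2 ℝ C V)).hasFDerivAt.comp_hasDerivAt t ha

/-- Differentiate ζ(ζ⁻¹x) = x with x fixed, and ζ(ζ⁻¹v) = v, along the line w + tX. The derivative
of the inverse is described by its action on V, so no product on C is needed. -/
lemma fderiv_invW {w : WSpace C V} (hw : w.fst ≠ 0) (X : WSpace C V) :
    (∀ x, M.J (fderiv ℝ M.invW w X).fst x
      = - M.J (M.inv w.fst) (M.J X.fst (M.J (M.inv w.fst) x))) ∧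
    (fderiv ℝ M.invW w X).snd
      = M.J (M.inv w.fst) (X.snd - M.J X.fst (M.J (M.inv w.fst) w.snd)) := by
  have hγ : HasDerivAt (fun t : ℝ => w + t • X) X 0 := by
    simpa using ((hasDerivAt_id (0 : ℝ)).smul_const X).const_add w
  have hF : HasDerivAt (fun t : ℝ => M.invW (w + t • X)) (fderiv ℝ M.invW w X) 0 := by
    have h1 : HasFDerivAt M.invW (fderiv ℝ M.invW w) (w + (0 : ℝ) • X) := by
      rw [zero_smul, add_zero]
      exact ((M.contDiffAt_invW hw).differentiableAt (by simp)).hasFDerivAt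
    exact h1.comp_hasDerivAt (0 : ℝ) hγ
  have hne : ∀ᶠ t : ℝ in 𝓝 0, (w + t • X).fst ≠ 0 := by
    have : ContinuousAt (fun t : ℝ => w.fst + t • X.fst) 0 := by fun_prop
    exact this.eventually_ne (by simpa using hw)
  constructor
  · intro x
    have h1 := M.hasDerivAt_J (hasDerivAt_wfst hγ)
      (M.hasDerivAt_J (hasDerivAt_wfst hF) (hasDerivAt_const 0 x))
    have h2 : HasDerivAt (fun _ : ℝ => x) 0 0 := hasDerivAt_const _ _
    have h3 := h1.unique (h2.congr_of_eventuallyEq (by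
      filter_upwards [hne] with t ht using M.J_J_inv ht x))
    simp only [zero_smul, add_zero, map_zero, zero_add] at h3
    have h4 := congrArg (M.J (M.inv w.fst)) h3
    rw [map_add, M.J_inv_J hw, map_zero] at h4
    rw [eq_neg_iff_add_eq_zero]
    exact h4
  · have h1 := M.hasDerivAt_J (hasDerivAt_wfst hγ) (hasDerivAt_wsnd hF)
    have h3 := h1.unique ((hasDerivAt_wsnd hγ).congr_of_eventuallyEq (by
      filter_upwards [hne] with t ht using M.J_J_inv ht _))
    simp only [zero_smul, add_zero] at h3
    have h4 := congrArg (M.J (M.inv w.fst)) h3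
    rw [map_add, M.J_inv_J hw] at h4
    rw [map_sub, ← h4]
    exact (add_sub_cancel_right _ _).symm

lemma metric_invW [Nontrivial V] {w : WSpace C V} (hw : w.fst ≠ 0) (X : WSpace C V) :
    M.metric (M.invW w) (fderiv ℝ M.invW w X) (fderiv ℝ M.invW w X) = M.metric w X X := by
  obtain ⟨hD, hU⟩ := M.fderiv_invW hw X
  set D := (fderiv ℝ M.invW w X).fst with hDdef
  obtain ⟨x₀, hx₀⟩ := exists_ne (0 : V)
  have hζ := norm_pos_iff.2 hw
  -- The norm of D is read off from its action on a nonzero vector of V.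
  have hnD : ‖D‖ ^ 2 = ‖X.fst‖ ^ 2 / (‖w.fst‖ ^ 2) ^ 2 := by
    have h := congrArg norm (hD x₀)
    rw [norm_neg, M.norm_J, M.norm_J, M.norm_J, M.norm_J, M.norm_inv] at h
    have h' : ‖D‖ = ‖w.fst‖⁻¹ * (‖X.fst‖ * ‖w.fst‖⁻¹) :=
      mul_right_cancel₀ (norm_ne_zero_iff.2 hx₀) (by rw [h]; ring)
    rw [h']; field_simp
  obtain ⟨ε, hε⟩ := M.exists_J_J X.fst (M.inv w.fst) w.snd
  set e := M.J X.fst (M.J (M.inv w.fst) w.snd) with he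
  have hne : ‖e‖ ^ 2 = ‖X.fst‖ ^ 2 * ‖w.snd‖ ^ 2 / ‖w.fst‖ ^ 2 := by
    rw [he, M.norm_J, M.norm_J, M.norm_inv]; field_simp
  have hce : ‖M.coord w.snd (X.snd - e)‖ ^ 2 = ‖M.coord w.snd X.snd‖ ^ 2
      - 2 * ‖w.snd‖ ^ 2 * inner ℝ e X.snd + ‖w.snd‖ ^ 2 * ‖e‖ ^ 2 := by
    rw [map_sub, norm_sub_sq_real]
    have h1 : M.coord w.snd e = ‖w.snd‖ ^ 2 • ε := by rw [hε, M.coord_J]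
    have h2 : inner ℝ (M.coord w.snd X.snd) ε = inner ℝ e X.snd := by
      rw [real_inner_comm, M.inner_coord, ← hε]
    rw [h1, inner_smul_right, h2, norm_smul, hε, M.norm_J, Real.norm_eq_abs, abs_of_nonneg
      (by positivity)]
    ring
  have hQ : M.Q (M.invW w) (fderiv ℝ M.invW w X) = ‖X.fst‖ ^ 2 / (‖w.fst‖ ^ 2) ^ 3
      - 2 * (inner ℝ e X.snd - ‖e‖ ^ 2) / (‖w.fst‖ ^ 2) ^ 2
      + (‖M.coord w.snd X.snd‖ ^ 2
      - 2 * ‖w.snd‖ ^ 2 * inner ℝ e X.snd + ‖w.snd‖ ^ 2 * ‖e‖ ^ 2) / (‖w.fst‖ ^ 2) ^ 2 := by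
    rw [Q, ← hDdef, hU, hnD]
    have h1 : (M.invW w).fst = M.inv w.fst := rfl
    have h2 : (M.invW w).snd = M.J (M.inv w.fst) w.snd := rfl
    rw [h1, h2, M.J_conj_J, map_smul, inner_smul_left, hD, inner_neg_left, M.inner_J_same,
      M.norm_coord_J, M.norm_coord_J_right, mul_pow, hce, M.norm_inv, inner_sub_right,
      real_inner_self_eq_norm_sq, conj_trivial]
    field_simp
    ring
  have hN : 1 + ‖M.invW w‖ ^ 2 = (1 + ‖w‖ ^ 2) / ‖w.fst‖ ^ 2 := M.norm_inv_pr hw w.snd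
  have hX : ‖fderiv ℝ M.invW w X‖ ^ 2 = ‖X.fst‖ ^ 2 / (‖w.fst‖ ^ 2) ^ 2
      + (‖X.snd‖ ^ 2 - 2 * inner ℝ e X.snd + ‖e‖ ^ 2) / ‖w.fst‖ ^ 2 := by
    rw [wnorm_sq, ← hDdef, hnD, hU, M.norm_J, M.norm_inv, mul_pow, norm_sub_sq_real,
      real_inner_comm]
    field_simp
  have hQ0 : M.Q w X = ‖w.fst‖ ^ 2 * ‖X.fst‖ ^ 2 + 2 * ‖w.fst‖ ^ 2 * inner ℝ e X.snd
      + ‖M.coord w.snd X.snd‖ ^ 2 := by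
    rw [Q, M.conj_eq_smul_inv hw, LinearMap.map_smul₂, map_smul, inner_smul_left, conj_trivial]
    ring
  rw [metric_self, metric_self, hQ, hN, hX, hQ0, hne, wnorm_sq, wnorm_sq X]
  have hN' : 0 < 1 + (‖w.fst‖ ^ 2 + ‖w.snd‖ ^ 2) := by positivity
  field_simp
  ring

lemma locIsom_inversion [Nontrivial V] : M.LocIsom M.inversion := by
  intro x y hxy
  have hx : x.fst ≠ 0 := by
    intro h
    rw [← pr_eta x, h, M.inversion_fin_zero] at hxy
    exact infPt_ne_fin (M.pr_one_ne _) hxy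
  have h1 : ∀ z : WSpace C V, z.fst ≠ 0 → M.inversion (.fin z) = .fin (M.invW z) := fun z hz =>
    M.inversion_fin hz z.snd
  rw [h1 x hx, CPW.fin.injEq] at hxy
  refine ⟨M.invW, ⟨hxy, M.contDiffAt_invW hx, ?_⟩, fun X => ?_⟩
  · have hc : ContinuousAt (fun z : WSpace C V => z.fst) x := contDiff_wfst.continuous.continuousAt
    filter_upwards [hc.eventually_ne hx] with z hz using h1 z hz
  · rw [← hxy]; exact M.metric_invW hx X

/-! ### The transition maps between charts -/

lemma ext_comp {T S : WSpace C V ≃ₗᵢ[ℝ] WSpace C V} (hT : M.IsSpread T) (hS : M.IsSpread S)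
    (p : M.CPW) : ext hT (ext hS p) = ext (hS.trans hT) p := by
  rcases M.cpw_cases' p with ⟨w, rfl⟩ | ⟨w, hw, rfl⟩
  · rfl
  · rw [ext_infPt hS hw, ext_infPt hT (map_ne hw), ext_infPt _ hw]; rfl

lemma ext_refl (p : M.CPW) : ext IsSpread.refl p = p := by
  rcases M.cpw_cases' p with ⟨w, rfl⟩ | ⟨w, hw, rfl⟩
  · rfl
  · rw [ext_infPt _ hw]; rfl

/-- The expression of `û₀ T̂ û₀` on `W`. -/
def conjW (T : WSpace C V ≃ₗᵢ[ℝ] WSpace C V) (w : WSpace C V) : WSpace C V :=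
  pr ((‖(T (pr M.one w.snd)).fst‖ ^ 2)⁻¹ •
      M.conj (T (pr (M.conj w.fst) (M.J (M.conj w.fst) w.snd))).fst)
    (M.J (M.inv (T (pr M.one w.snd)).fst) (T (pr M.one w.snd)).snd)

lemma contDiffAt_conjW (T : WSpace C V ≃ₗᵢ[ℝ] WSpace C V) {w : WSpace C V}
    (h : (T (pr M.one w.snd)).fst ≠ 0) : ContDiffAt ℝ ∞ (M.conjW T) w := by
  have h1 : ContDiffAt ℝ ∞ (fun w : WSpace C V => T (pr M.one w.snd)) w :=
    T.contDiff.contDiffAt.comp w (contDiffAt_pr contDiffAt_const contDiff_wsnd.contDiffAt)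
  have h2 : ContDiffAt ℝ ∞ (fun w : WSpace C V => M.conj w.fst) w :=
    M.contDiffAt_conj contDiff_wfst.contDiffAt
  have h3 : ContDiffAt ℝ ∞ (fun w : WSpace C V =>
      T (pr (M.conj w.fst) (M.J (M.conj w.fst) w.snd))) w :=
    T.contDiff.contDiffAt.comp w (contDiffAt_pr h2 (M.contDiffAt_J h2 contDiff_wsnd.contDiffAt))
  have h4 := contDiffAt_wfst h1
  exact contDiffAt_pr (((h4.norm_sq ℝ).inv (pow_ne_zero _ (norm_ne_zero_iff.2 h))).smul
    (M.contDiffAt_conj (contDiffAt_wfst h3)))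
    (M.contDiffAt_J (M.contDiffAt_inv h4 h) (contDiffAt_wsnd h1))

variable {M} in
-- With T(1,u) = (α,β), the point (ζ⁻¹,ζ⁻¹u) goes to some (μ,μ(α⁻¹β)), and inversion gives
-- (μ⁻¹,α⁻¹β). Since |μ| = |α|/|ζ|, μ⁻¹ is the conjugate of the first component of T(ζ̄,ζ̄u),
-- divided by |α|². This expression has no singularity at ζ = 0.
lemma conj_ext_fin_of_ne {T : WSpace C V ≃ₗᵢ[ℝ] WSpace C V} (hT : M.IsSpread T) {w : WSpace C V}
    (h : (T (pr M.one w.snd)).fst ≠ 0) :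
    M.inversion (ext hT (M.inversion (.fin w))) = .fin (M.conjW T w) ∧
      (w.fst ≠ 0 → (T (M.invW w)).fst ≠ 0) := by
  obtain ⟨ζ, u, rfl⟩ : ∃ ζ v, w = pr ζ v := ⟨_, _, rfl⟩
  obtain ⟨α, β, hαβ⟩ : ∃ α β, T (pr M.one u) = pr α β := ⟨_, _, rfl⟩
  replace h : α ≠ 0 := by
    have : T (pr M.one (pr ζ u).snd) = pr α β := hαβ
    rwa [this] at h
  have hW : M.conjW T (pr ζ u) = pr ((‖α‖ ^ 2)⁻¹ •
      M.conj (T (pr (M.conj ζ) (M.J (M.conj ζ) u))).fst) (M.J (M.inv α) β) := by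
    rw [conjW]; simp only [WithLp.toLp_fst, WithLp.toLp_snd, hαβ]
  rw [hW]
  by_cases hζ : ζ = 0
  · subst hζ
    refine ⟨?_, fun h0 => absurd rfl h0⟩
    rw [M.inversion_fin_zero, ext_infPt hT (M.pr_one_ne u), hαβ, M.inversion_infPt h]
    have : (pr (0 : C) (0 : V)) = 0 := rfl
    simp [M.conj_zero, this]
  · set x := pr (M.inv ζ) (M.J (M.inv ζ) u) with hx
    have hmem : T x ∈ M.line (pr M.one (M.J (M.inv α) β)) := by
      rw [← M.line_of_ne h, ← hαβ, hT, mem_line_one]; rfl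
    rw [mem_line_one] at hmem
    set μ := (T x).fst with hμ
    have hTx : T x = pr μ (M.J μ (M.J (M.inv α) β)) := by rw [← hmem]; rfl
    have hζ' := norm_pos_iff.2 hζ
    have hα' := norm_pos_iff.2 h
    have hn1 : ‖μ‖ ^ 2 * (1 + ‖M.J (M.inv α) β‖ ^ 2) = (‖ζ‖ ^ 2)⁻¹ * (1 + ‖u‖ ^ 2) := by
      have := congrArg (fun y => ‖y‖ ^ 2) hTx
      simp only [T.norm_map] at this
      rw [hx, norm_pr_sq, norm_pr_sq, M.norm_J, M.norm_inv, M.norm_J μ] at this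
      have e : (‖ζ‖ ^ 2)⁻¹ = ‖ζ‖⁻¹ ^ 2 := by field_simp
      rw [e]; linarith
    have hn2 : ‖α‖ ^ 2 * (1 + ‖M.J (M.inv α) β‖ ^ 2) = 1 + ‖u‖ ^ 2 := by
      have := congrArg (fun y => ‖y‖ ^ 2) hαβ
      simp only [T.norm_map] at this
      rw [norm_pr_sq, norm_pr_sq, M.norm_one] at this
      rw [M.norm_J, M.norm_inv]
      field_simp
      linarith
    -- T is isometric, and both (1,u) and (ζ⁻¹,ζ⁻¹u) have images on the graph of slope α⁻¹β;
    -- comparing lengths gives |μ|.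
    have hn3 : ‖μ‖ ^ 2 = ‖α‖ ^ 2 / ‖ζ‖ ^ 2 := by
      have hp : 0 < 1 + ‖M.J (M.inv α) β‖ ^ 2 := by positivity
      refine mul_right_cancel₀ hp.ne' ?_
      rw [hn1, ← hn2]; field_simp
    have hμ0 : μ ≠ 0 := by
      rintro h0
      rw [h0] at hn3
      have : 0 < ‖α‖ ^ 2 / ‖ζ‖ ^ 2 := by positivity
      rw [← hn3, norm_zero] at this
      norm_num at this
    refine ⟨?_, fun _ => hμ0⟩
    rw [M.inversion_fin hζ, ext_fin, ← hx, hTx, M.inversion_fin hμ0, M.J_inv_J hμ0]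
    have hconj : T (pr (M.conj ζ) (M.J (M.conj ζ) u)) = ‖ζ‖ ^ 2 • T x := by
      rw [← map_smul, hx, smul_pr, ← M.conj_eq_smul_inv hζ, ← LinearMap.smul_apply, ← map_smul,
        ← M.conj_eq_smul_inv hζ]
    rw [hconj, WithLp.smul_fst, ← hμ, M.conj_smul, smul_smul, inv, hn3]
    congr 4
    field_simp

variable {M} in
-- If T(1,u) = (0,β), then T maps C(1,u) into 0 ⊕ V, and the last inversion would end at infinity.
lemma conj_ext_fin_of_eq {T : WSpace C V ≃ₗᵢ[ℝ] WSpace C V} (hT : M.IsSpread T) {w y : WSpace C V}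
    (h : M.inversion (ext hT (M.inversion (.fin w))) = .fin y) :
    (T (pr M.one w.snd)).fst ≠ 0 := by
  obtain ⟨ζ, u, rfl⟩ : ∃ ζ v, w = pr ζ v := ⟨_, _, rfl⟩
  obtain ⟨α, β, hαβ⟩ : ∃ α β, T (pr M.one u) = pr α β := ⟨_, _, rfl⟩
  intro h0
  have hα : α = 0 := by
    have : T (pr M.one (pr ζ u).snd) = pr α β := hαβ
    rwa [this] at h0
  subst hα
  have hβ : β ≠ 0 := by
    rintro rfl
    exact M.pr_one_ne u (T.map_eq_zero_iff.1 (hαβ.trans rfl))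
  by_cases hζ : ζ = 0
  · rw [hζ, M.inversion_fin_zero, ext_infPt hT (M.pr_one_ne u), hαβ,
      M.inversion_infPt_zero hβ] at h
    exact infPt_ne_fin (pr_zero_ne hβ) h
  · rw [M.inversion_fin hζ, ext_fin] at h
    have hmem : T (pr (M.inv ζ) (M.J (M.inv ζ) u)) ∈ M.line (pr 0 β) := by
      rw [← hαβ, hT, mem_line_one]; rfl
    rw [mem_line_zero] at hmem
    rw [← pr_eta (T _), hmem.1, M.inversion_fin_zero] at h
    exact infPt_ne_fin (M.pr_one_ne _) h

variable {M} in
lemma Rep.fderiv_unique {h : M.CPW → M.CPW} {φ : WSpace C V → M.CPW} {x y y' : WSpace C V}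
    {F F' : WSpace C V → WSpace C V} (hF : M.Rep h φ .fin x y F) (hF' : M.Rep h φ .fin x y' F') :
    fderiv ℝ F x = fderiv ℝ F' x := by
  refine Filter.EventuallyEq.fderiv_eq ?_
  filter_upwards [hF.2.2, hF'.2.2] with a h1 h2
  rw [h1, CPW.fin.injEq] at h2
  exact h2

lemma tendsto_metric {ι : Type*} {l : Filter ι} {f g : ι → WSpace C V} {a b : WSpace C V}
    (hf : Filter.Tendsto f l (𝓝 a)) (hg : Filter.Tendsto g l (𝓝 b)) :
    Filter.Tendsto (fun i => M.metric (f i) (g i) (g i)) l (𝓝 (M.metric a b b)) := by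
  have hc : Continuous fun p : WSpace C V × WSpace C V => M.Q p.1 p.2 :=
    M.continuous_Q continuous_fst continuous_snd
  have hQ : Filter.Tendsto (fun i => M.Q (f i) (g i)) l (𝓝 (M.Q a b)) := by
    have h := hc.tendsto (a, b)
    exact Filter.Tendsto.comp (g := fun p : WSpace C V × WSpace C V => M.Q p.1 p.2)
      (f := fun i => (f i, g i)) h (hf.prodMk_nhds hg)
  simp only [metric_self]
  have h1 : Filter.Tendsto (fun i => 1 + ‖f i‖ ^ 2) l (𝓝 (1 + ‖a‖ ^ 2)) :=
    (hf.norm.pow 2).const_add 1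
  exact ((h1.mul (hg.norm.pow 2)).sub hQ).div (h1.pow 2) (pow_ne_zero _ (one_add_sq_pos a).ne')

/-- Off ζ = 0 the map is a composition of three local isometries. The formula `conjW` is smooth
across ζ = 0, and the metric identity extends there by continuity. -/
lemma locIsom_conj_ext [Nontrivial V] {T : WSpace C V ≃ₗᵢ[ℝ] WSpace C V} (hT : M.IsSpread T) :
    M.LocIsom (M.inversion ∘ ext hT ∘ M.inversion) := by
  intro x y hxy
  have hx := conj_ext_fin_of_eq hT hxy
  have hrep : ∀ z : WSpace C V, (T (pr M.one z.snd)).fst ≠ 0 →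
      M.Rep (M.inversion ∘ ext hT ∘ M.inversion) .fin .fin z (M.conjW T z) (M.conjW T) := by
    intro z hz
    refine ⟨rfl, M.contDiffAt_conjW T hz, ?_⟩
    have hc : Continuous fun z : WSpace C V => (T (pr M.one z.snd)).fst :=
      contDiff_wfst.continuous.comp (T.continuous.comp ((WithLp.prod_continuous_toLp 2 C V).comp
        (continuous_const.prodMk contDiff_wsnd.continuous)))
    filter_upwards [hc.continuousAt.eventually_ne hz] with z' hz'
    exact (conj_ext_fin_of_ne hT hz').1
  have hiso : ∀ z : WSpace C V, (T (pr M.one z.snd)).fst ≠ 0 → z.fst ≠ 0 → ∀ X,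
      M.metric (M.conjW T z) (fderiv ℝ (M.conjW T) z X) (fderiv ℝ (M.conjW T) z X)
        = M.metric z X X := by
    intro z hz hz' X
    have h1 := M.locIsom_inversion z (M.invW z) (M.inversion_fin hz' z.snd)
    have h2 := M.locIsom_ext hT (M.invW z) (T (M.invW z)) rfl
    have hne := (conj_ext_fin_of_ne hT hz).2 hz'
    have h3 := M.locIsom_inversion (T (M.invW z)) (M.invW (T (M.invW z)))
      (M.inversion_fin hne _)
    obtain ⟨F, hF, hF'⟩ := h3.comp (h2.comp h1)
    have hy : M.conjW T z = M.invW (T (M.invW z)) := by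
      have := hF.2.2.self_of_nhds
      change M.inversion (ext hT (M.inversion (.fin z))) = _ at this
      rw [hF.1, (conj_ext_fin_of_ne hT hz).1, CPW.fin.injEq] at this
      exact this
    rw [(hrep z hz).fderiv_unique hF, hy]
    exact hF' X
  have hy : M.conjW T x = y := by
    have := (conj_ext_fin_of_ne hT hx).1.symm.trans hxy
    simpa using this
  refine ⟨M.conjW T, hy ▸ hrep x hx, fun X => ?_⟩
  rw [← hy]
  have hs := M.contDiffAt_conjW T hx
  -- Approach x in the direction (1,0): the V-component, and with it the nonvanishing condition on
  -- T, stays unchanged.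
  have hγ : Filter.Tendsto (fun t : ℝ => x + t • pr M.one (0 : V)) (𝓝[≠] 0) (𝓝 x) := by
    have hc : Continuous fun t : ℝ => x + t • pr M.one (0 : V) := by fun_prop
    have := hc.tendsto 0
    rw [zero_smul, add_zero] at this
    exact this.mono_left nhdsWithin_le_nhds
  have hd : ContinuousAt (fderiv ℝ (M.conjW T)) x :=
    (hs.fderiv_right (m := ∞) (by simp)).continuousAt
  have hdX : ContinuousAt (fun z => fderiv ℝ (M.conjW T) z X) x :=
    hd.clm_apply continuousAt_const
  have h1 := M.tendsto_metric (hs.continuousAt.tendsto.comp hγ) (hdX.tendsto.comp hγ)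
  have h2 := M.tendsto_metric hγ (tendsto_const_nhds (x := X))
  refine tendsto_nhds_unique (h1.congr' ?_) h2
  filter_upwards [eventually_add_smul_ne x.fst M.one_ne_zero] with t ht
  refine hiso (x + t • pr M.one (0 : V)) ?_ ht X
  have : (x + t • pr M.one (0 : V)).snd = x.snd := by
    simp
  rw [this]; exact hx

/-- The maps `T̂` and `T̂ û₀ Ŝ`. -/
def IsShort (h : M.CPW → M.CPW) : Prop :=
  (∃ (T : WSpace C V ≃ₗᵢ[ℝ] WSpace C V) (hT : M.IsSpread T), h = ext hT) ∨
    ∃ (T S : WSpace C V ≃ₗᵢ[ℝ] WSpace C V) (hT : M.IsSpread T) (hS : M.IsSpread S),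
      h = ext hT ∘ M.inversion ∘ ext hS

lemma isShort_inversion : M.IsShort M.inversion :=
  Or.inr ⟨_, _, IsSpread.refl, IsSpread.refl, by funext p; simp [ext_refl]⟩

variable {M} in
-- A product of two short words contains at most two inversions, so after merging adjacent linear
-- isometries only the inversion, or two inversions around one linear isometry, remain.
lemma IsShort.locIsom_comp [Nontrivial V] {a b : M.CPW → M.CPW} (ha : M.IsShort a)
    (hb : M.IsShort b) : M.LocIsom (a ∘ b) := by
  rcases ha with ⟨T, hT, rfl⟩ | ⟨T, S, hT, hS, rfl⟩ <;>
    rcases hb with ⟨T', hT', rfl⟩ | ⟨T', S', hT', hS', rfl⟩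
  · exact LocIsom.congr M M.locIsom_id hT hT'
  · convert LocIsom.congr M M.locIsom_inversion (hT'.trans hT) hS' using 1
    funext p; simp [ext_comp]
  · convert LocIsom.congr M M.locIsom_inversion hT (hT'.trans hS) using 1
    funext p; simp [ext_comp]
  · convert LocIsom.congr M (M.locIsom_conj_ext (hT'.trans hS)) hT hS' using 1
    funext p; simp [ext_comp]

/-- The last clause keeps inversion∘s short, so that inversion read in any two charts is again a
product of two short words. For φ_v this is where the braid relation enters. -/
lemma exists_of_mem_atlas {φ : WSpace C V → M.CPW} (h : φ ∈ M.atlas) :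
    ∃ s : M.CPW ≃ₜ M.CPW, (∀ x, φ x = s (.fin x)) ∧ M.IsShort s ∧ M.IsShort s.symm ∧
      M.IsShort (M.inversion ∘ s) := by
  have hid : M.IsShort (id : M.CPW → M.CPW) :=
    Or.inl ⟨_, IsSpread.refl, by funext p; simp [ext_refl]⟩
  rcases h with (rfl | rfl) | ⟨v, hv, rfl⟩
  · exact ⟨Homeomorph.refl _, fun _ => rfl, hid, hid, M.isShort_inversion⟩
  · refine ⟨M.inversion, fun _ => rfl, M.isShort_inversion, M.isShort_inversion, ?_⟩
    convert hid using 1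
    funext p; simp [inversion_inversion]
  · have hs := M.isSpread_swap hv
    refine ⟨(ext hs).trans (M.inversion.trans (ext hs)), M.chartVec_eq hv,
      Or.inr ⟨_, _, hs, hs, rfl⟩, Or.inr ⟨_, _, hs, hs, rfl⟩,
      Or.inr ⟨_, _, hs, IsSpread.refl, ?_⟩⟩
    funext p
    change M.inversion (ext hs (M.inversion (ext hs p))) = ext hs (M.inversion (ext _ p))
    rw [M.braid hv, M.inversion_inversion, ext_refl]

lemma isIsom_ext [Nontrivial V] {T : WSpace C V ≃ₗᵢ[ℝ] WSpace C V} (hT : M.IsSpread T) :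
    M.IsIsom (ext hT) := by
  rw [isIsom_iff]
  intro φ hφ ψ hψ x y hxy
  obtain ⟨s, h1, h2, h3, h4⟩ := M.exists_of_mem_atlas hφ
  obtain ⟨t, k1, k2, k3, k4⟩ := M.exists_of_mem_atlas hψ
  refine M.isomAt_of_conj s t h1 k1 (k3.locIsom_comp ?_) hxy
  rcases h2 with ⟨T', hT', h⟩ | ⟨T', S', hT', hS', h⟩
  · exact Or.inl ⟨_, hT'.trans hT, by rw [h]; funext p; simp [ext_comp]⟩
  · exact Or.inr ⟨_, _, hT'.trans hT, hS', by rw [h]; funext p; simp [ext_comp]⟩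

lemma isIsom_inversion [Nontrivial V] : M.IsIsom M.inversion := by
  rw [isIsom_iff]
  intro φ hφ ψ hψ x y hxy
  obtain ⟨s, h1, h2, h3, h4⟩ := M.exists_of_mem_atlas hφ
  obtain ⟨t, k1, k2, k3, k4⟩ := M.exists_of_mem_atlas hψ
  exact M.isomAt_of_conj s t h1 k1 (k3.locIsom_comp h4) hxy

/-! ### The isometry group generated by linear isometries and the inversion -/

/-- The group generated by the `T̂` and by `û₀`. -/
inductive Gen : (M.CPW ≃ₜ M.CPW) → Prop
  | ext {T : WSpace C V ≃ₗᵢ[ℝ] WSpace C V} (hT : M.IsSpread T) : Gen (ext hT)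
  | inversion : Gen M.inversion
  | trans {u u' : M.CPW ≃ₜ M.CPW} : Gen u → Gen u' → Gen (u.trans u')

variable {M} in
lemma Gen.symm {u : M.CPW ≃ₜ M.CPW} (h : M.Gen u) : M.Gen u.symm := by
  induction h with
  | ext hT => exact Gen.ext hT.symm
  | inversion => exact Gen.inversion
  | trans _ _ h1 h2 => exact Gen.trans h2 h1

variable {M} in
lemma Gen.isIsom [Nontrivial V] {u : M.CPW ≃ₜ M.CPW} (h : M.Gen u) : M.IsIsom u := by
  induction h with
  | ext hT => exact M.isIsom_ext hT
  | inversion => exact M.isIsom_inversion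
  | trans _ _ h1 h2 => exact h1.comp h2

/-- A point at infinity is rotated to [a,0], which the inversion sends to the origin. A finite point
w ≠ 0 is rotated into 0 ⊕ V, which the inversion sends to infinity. -/
lemma exists_gen_zero [Nontrivial V] (p : M.CPW) : ∃ u, M.Gen u ∧ u p = .fin 0 := by
  have hinf : ∀ w, w ≠ 0 → ∃ u, M.Gen u ∧ u (M.infPt w) = .fin 0 := by
    intro w hw
    obtain ⟨T, hT, a, ha, h⟩ := M.exists_isSpread_fst hw
    refine ⟨_, (Gen.ext hT).trans Gen.inversion, ?_⟩
    rw [Homeomorph.trans_apply, ext_infPt hT hw, h, M.inversion_infPt ha, map_zero]; rfl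
  rcases M.cpw_cases' p with ⟨w, rfl⟩ | ⟨w, hw, rfl⟩
  · by_cases hw : w = 0
    · exact ⟨_, Gen.ext IsSpread.refl, by rw [hw]; rfl⟩
    obtain ⟨T, hT, u, hu, h⟩ := M.exists_isSpread_snd hw
    obtain ⟨k, hk, hk'⟩ := hinf _ (M.pr_one_ne u)
    refine ⟨_, ((Gen.ext hT).trans Gen.inversion).trans hk, ?_⟩
    rw [Homeomorph.trans_apply, Homeomorph.trans_apply, ext_fin, h, M.inversion_fin_zero, hk']
  · exact hinf w hw

/-! ### Isometries that fix the origin -/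

/-- A radial vector lies in its own C-line, so only the factor (1+|tw|²)⁻² is involved; rays have
the length element of arctan. -/
lemma metric_radial (t : ℝ) (w : WSpace C V) :
    M.metric (t • w) w w = ‖w‖ ^ 2 / (1 + ‖t • w‖ ^ 2) ^ 2 := by
  rw [metric_self]
  congr 1
  by_cases h : t • w = 0
  · rw [h]; simp [Q, coord_zero_left]
  · have : w ∈ M.line (t • w) := by
      have h0 : t ≠ 0 := by rintro rfl; simp at h
      have := Submodule.smul_mem _ t⁻¹ (M.self_mem_line (t • w))
      rwa [smul_smul, inv_mul_cancel₀ h0, one_smul] at this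
    rw [(M.mem_line_iff_Q h w).1 this]; ring

/-- This plays the part of the Gauss lemma: the radial vector is metrically orthogonal to the
Euclidean orthogonal complement of w. -/
lemma metric_self_left (w Y : WSpace C V) :
    M.metric w w Y = inner ℝ w Y / (1 + ‖w‖ ^ 2) ^ 2 := by
  rw [metric, Submodule.starProjection_eq_self_iff.2 (M.self_mem_line w), sub_self,
    inner_zero_left, zero_div, add_zero]
  congr 1
  have h2 : inner ℝ (Y - (M.line w).starProjection Y) w = 0 :=
    (M.line w).starProjection_inner_eq_zero Y _ (M.self_mem_line w)
  rw [inner_sub_left, sub_eq_zero] at h2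
  rw [real_inner_comm, ← h2, real_inner_comm]

/-- The radial speed of a curve is bounded by its Riemannian speed. -/
lemma inner_sq_le_metric (w X : WSpace C V) :
    inner ℝ w X ^ 2 ≤ ‖w‖ ^ 2 * (1 + ‖w‖ ^ 2) ^ 2 * M.metric w X X := by
  have h := M.Q_le w X
  have hp := one_add_sq_pos w
  have h1 : inner ℝ w X ^ 2 ≤ (‖w‖ * ‖X‖) ^ 2 := by
    rw [sq_le_sq, abs_of_nonneg (a := ‖w‖ * ‖X‖) (by positivity)]
    exact abs_real_inner_le_norm w X
  have h2 : ‖w‖ ^ 2 * (1 + ‖w‖ ^ 2) ^ 2 * M.metric w X X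
      = ‖w‖ ^ 2 * ((1 + ‖w‖ ^ 2) * ‖X‖ ^ 2 - M.Q w X) := by
    rw [metric_self]; field_simp
  rw [h2]
  refine h1.trans ?_
  rw [mul_pow]
  gcongr
  linarith

/-- The distance of a point of `CPW` from the origin. -/
def dist0 (p : M.CPW) : ℝ := Real.arccos (√(M.coordA p))

lemma continuous_dist0 : Continuous M.dist0 :=
  Real.continuous_arccos.comp (Real.continuous_sqrt.comp M.continuous_coordA)

lemma dist0_fin (w : WSpace C V) : M.dist0 (.fin w) = Real.arctan ‖w‖ := by
  rw [dist0, coordA_fin, Real.arctan_eq_arccos (norm_nonneg w), Real.sqrt_div zero_le_one,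
    Real.sqrt_one, one_div]

variable {M} in
lemma dist0_infPt {w : WSpace C V} (hw : w ≠ 0) : M.dist0 (M.infPt w) = Real.pi / 2 := by
  rw [dist0, coordA_infPt hw]; simp

lemma dist0_le (p : M.CPW) : M.dist0 p ≤ Real.pi / 2 := by
  rw [dist0, Real.arccos_le_pi_div_two]; positivity

lemma eventually_neg_of_deriv_neg {f : ℝ → ℝ} {f' x : ℝ} (hf : HasDerivAt f f' x) (h0 : f x = 0)
    (h : f' < 0) : ∀ᶠ z in 𝓝[>] x, f z < 0 := by
  have h1 := (hasDerivWithinAt_iff_tendsto_slope' (s := Set.Ioi x) (by simp)).1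
    (hf.hasDerivWithinAt)
  filter_upwards [h1.eventually (gt_mem_nhds h), self_mem_nhdsWithin] with z hz hz'
  rw [slope_def_field, h0, sub_zero] at hz
  have : 0 < z - x := sub_pos.2 hz'
  by_contra hc
  exact absurd hz (not_lt.2 (div_nonneg (not_lt.1 hc) this.le))

variable {M} in
lemma IsIsom.isomAt_fin {u : M.CPW ≃ₜ M.CPW} (hu : M.IsIsom u) {x y : WSpace C V}
    (h : u (.fin x) = .fin y) : M.IsomAt u .fin .fin x y :=
  (M.isIsom_iff u).1 hu _ (Or.inl (Or.inl rfl)) _ (Or.inl (Or.inl rfl)) x y h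

variable {M} in
-- The image of the ray tw has the same speed as the ray, and its distance from the origin grows no
-- faster than its length arctan(t|w|). This comparison of derivatives is run by continuous
-- induction on [0,1].
lemma IsIsom.dist0_le {u : M.CPW ≃ₜ M.CPW} (hu : M.IsIsom u) (h0 : u (.fin 0) = .fin 0)
    (w : WSpace C V) : M.dist0 (u (.fin w)) ≤ Real.arctan ‖w‖ := by
  by_cases hw : w = 0
  · rw [hw, h0, dist0_fin]
  have hw' := norm_pos_iff.2 hw
  suffices h : ∀ ε > 0, M.dist0 (u (.fin w)) ≤ Real.arctan ‖w‖ + ε * 2 by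
    refine le_of_forall_pos_le_add fun ε hε => ?_
    have := h (ε / 2) (by positivity)
    linarith
  intro ε hε
  set d : ℝ → ℝ := fun t => M.dist0 (u (.fin (t • w))) with hd
  -- The slope ε makes the comparison of derivatives strict; the constant ε gives B(0) > 0, which
  -- keeps a point of contact away from the origin, where the distance is not differentiable.
  set B : ℝ → ℝ := fun t => Real.arctan (t * ‖w‖) + ε * (1 + t) with hB
  have hdc : Continuous d :=
    M.continuous_dist0.comp (u.continuous.comp (M.continuous_fin.comp (by fun_prop)))
  have hBc : Continuous B := by fun_prop
  have hBd : ∀ t, HasDerivAt B (‖w‖ / (1 + ‖t • w‖ ^ 2) + ε) t := by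
    intro t
    have h1 : HasDerivAt (fun t : ℝ => t * ‖w‖) ‖w‖ t := by
      simpa using (hasDerivAt_id t).mul_const ‖w‖
    have h2 : HasDerivAt (fun t : ℝ => ε * (1 + t)) ε t := by
      simpa using ((hasDerivAt_id t).const_add 1).const_mul ε
    have e : ‖w‖ / (1 + ‖t • w‖ ^ 2) + ε = 1 / (1 + (t * ‖w‖) ^ 2) * ‖w‖ + ε := by
      rw [norm_smul, mul_pow, mul_pow, Real.norm_eq_abs, sq_abs]
      ring
    rw [e]
    exact h1.arctan.add h2
  have key : Set.Icc (0 : ℝ) 1 ⊆ {t | d t ≤ B t} := by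
    refine IsClosed.Icc_subset_of_forall_exists_gt
      ((isClosed_le hdc hBc).inter isClosed_Icc) ?_ ?_
    · simp [hd, hB, h0, dist0_fin, hε.le]
    · rintro x ⟨hx, hx0, hx1⟩ y hy
      have hev : ∀ᶠ z in 𝓝[>] x, d z ≤ B z := by
        rcases lt_or_ge (B x) (Real.pi / 2) with hBx | hBx
        · rcases lt_or_eq_of_le (show d x ≤ B x from hx) with hlt | heq
          · exact ((hdc.continuousAt.eventually_lt hBc.continuousAt hlt).filter_mono
              nhdsWithin_le_nhds).mono fun z hz => hz.le
          · have hBpos : 0 < B x := by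
              have : 0 ≤ Real.arctan (x * ‖w‖) := Real.arctan_nonneg.2 (by positivity)
              simp only [hB]; positivity
            rcases M.cpw_cases' (u (.fin (x • w))) with ⟨y₀, hy₀⟩ | ⟨y₀, hy0, hy₀⟩
            · obtain ⟨F, hF, hF'⟩ := hu.isomAt_fin hy₀
              have hdx : d x = Real.arctan ‖y₀‖ := by simp only [hd]; rw [hy₀, dist0_fin]
              have hy0 : y₀ ≠ 0 := by
                rintro rfl
                rw [norm_zero, Real.arctan_zero] at hdx
                linarith
              have hyn := norm_pos_iff.2 hy0
              set Y := fderiv ℝ F (x • w) w with hY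
              have hγ : HasDerivAt (fun t : ℝ => t • w) w x := by
                simpa using (hasDerivAt_id x).smul_const w
              have hg : HasDerivAt (fun t : ℝ => F (t • w)) Y x :=
                ((hF.2.1.differentiableAt (by simp)).hasFDerivAt).comp_hasDerivAt x hγ
              have hg2 := hg.norm_sq
              rw [hF.1] at hg2
              have hg3 : HasDerivAt (fun t : ℝ => Real.arctan √(‖F (t • w)‖ ^ 2))
                  (1 / (1 + ‖y₀‖ ^ 2) * (2 * inner ℝ y₀ Y / (2 * ‖y₀‖))) x := by
                have := (hg2.sqrt (by rw [hF.1]; positivity)).arctan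
                rw [hF.1, Real.sqrt_sq hyn.le] at this
                exact this
              have hdd : HasDerivAt d (1 / (1 + ‖y₀‖ ^ 2) * (2 * inner ℝ y₀ Y / (2 * ‖y₀‖))) x := by
                refine hg3.congr_of_eventuallyEq ?_
                filter_upwards [hγ.continuousAt.eventually hF.2.2] with t ht
                simp only [hd]
                rw [ht, dist0_fin, Real.sqrt_sq (norm_nonneg _)]
              have hbound : 1 / (1 + ‖y₀‖ ^ 2) * (2 * inner ℝ y₀ Y / (2 * ‖y₀‖))
                  ≤ ‖w‖ / (1 + ‖x • w‖ ^ 2) := by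
                have h1 := M.inner_sq_le_metric y₀ Y
                rw [hF', metric_radial] at h1
                have h2 : (1 / (1 + ‖y₀‖ ^ 2) * (2 * inner ℝ y₀ Y / (2 * ‖y₀‖))) ^ 2
                    ≤ (‖w‖ / (1 + ‖x • w‖ ^ 2)) ^ 2 := by
                  have e : (1 / (1 + ‖y₀‖ ^ 2) * (2 * inner ℝ y₀ Y / (2 * ‖y₀‖))) ^ 2
                    = inner ℝ y₀ Y ^ 2 / (‖y₀‖ ^ 2 * (1 + ‖y₀‖ ^ 2) ^ 2) := by field_simp
                  rw [e, div_le_iff₀ (by positivity), div_pow]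
                  linarith
                exact (le_abs_self _).trans (abs_le_of_sq_le_sq h2 (by positivity))
              have hneg := eventually_neg_of_deriv_neg (hdd.sub (hBd x)) (by simp [heq])
                (by linarith)
              filter_upwards [hneg] with z hz
              simp only [Pi.sub_apply] at hz
              linarith
            · have : d x = Real.pi / 2 := by simp only [hd]; rw [hy₀, dist0_infPt hy0]
              linarith
        -- Once the barrier has reached π/2 nothing remains to be shown, as no distance exceeds π/2.
        · filter_upwards [self_mem_nhdsWithin] with z hz
          refine (M.dist0_le _).trans (hBx.trans ?_)
          have hz : x < z := hz
          simp only [hB]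
          have := Real.arctan_strictMono.monotone (mul_le_mul_of_nonneg_right hz.le hw'.le)
          nlinarith
      have := hev.and (Ioc_mem_nhdsGT hy)
      obtain ⟨z, hz1, hz2⟩ := this.exists
      exact ⟨z, hz1, hz2⟩
  have := key (Set.right_mem_Icc.2 zero_le_one)
  simp only [hd, hB, Set.mem_ofPred_eq, one_smul, _root_.one_mul] at this
  linarith

variable {M} in
lemma IsIsom.exists_fin {u : M.CPW ≃ₜ M.CPW} (hu : M.IsIsom u) (h0 : u (.fin 0) = .fin 0)
    (w : WSpace C V) : ∃ y, u (.fin w) = .fin y ∧ ‖y‖ ≤ ‖w‖ := by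
  have h := hu.dist0_le h0 w
  rcases M.cpw_cases' (u (.fin w)) with ⟨y, hy⟩ | ⟨y, hy0, hy⟩
  · rw [hy, dist0_fin, Real.arctan_strictMono.le_iff_le] at h
    exact ⟨y, hy, h⟩
  · rw [hy, dist0_infPt hy0] at h
    exact absurd (Real.arctan_lt_pi_div_two ‖w‖) (not_lt.2 h)

variable {M} in
/-- An isometry that fixes the origin is linear. -/
lemma IsIsom.eq_ext {u : M.CPW ≃ₜ M.CPW} (hu : M.IsIsom u) (h0 : u (.fin 0) = .fin 0) :
    ∃ (T : WSpace C V ≃ₗᵢ[ℝ] WSpace C V) (hT : M.IsSpread T), u = ext hT := by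
  choose F hF hle using hu.exists_fin h0
  -- The distance bound is applied to u and to its inverse.
  have hn : ∀ w, ‖F w‖ = ‖w‖ := by
    intro w
    refine le_antisymm (hle w) ?_
    have h0' : u.symm (.fin 0) = .fin 0 := by rw [← h0, Homeomorph.symm_apply_apply, h0]
    obtain ⟨y, hy, hy'⟩ := hu.symm.exists_fin h0' (F w)
    rw [← hF w, Homeomorph.symm_apply_apply, CPW.fin.injEq] at hy
    rwa [← hy] at hy'
  have hrep : ∀ w, M.Rep u .fin .fin w (F w) F ∧
      ∀ X, M.metric (F w) (fderiv ℝ F w X) (fderiv ℝ F w X) = M.metric w X X := by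
    intro w
    obtain ⟨G, hG, hG'⟩ := hu.isomAt_fin (hF w)
    have he : F =ᶠ[𝓝 w] G := by
      filter_upwards [hG.2.2] with a ha
      rw [hF a, CPW.fin.injEq] at ha
      exact ha
    have hrep : M.Rep u .fin .fin w (F w) F :=
      ⟨rfl, hG.2.1.congr_of_eventuallyEq he, Filter.Eventually.of_forall hF⟩
    exact ⟨hrep, fun X => by rw [he.fderiv_eq]; exact hG' X⟩
  have hdiff : ∀ w, HasFDerivAt F (fderiv ℝ F w) w := fun w =>
    ((hrep w).1.2.1.differentiableAt (by simp)).hasFDerivAt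
  -- Differentiating |F|² = |·|² gives ⟨F(w),AX⟩ = ⟨w,X⟩. With the Gauss lemma, Aw - F(w) is
  -- metrically orthogonal to every AX, and A is surjective.
  have heuler : ∀ w, fderiv ℝ F w w = F w := by
    intro w
    set A := fderiv ℝ F w with hA
    have hm := M.metric_of_self (hrep w).2
    have h1 : ∀ X, inner ℝ (F w) (A X) = inner ℝ w X := by
      intro X
      have hγ : HasDerivAt (fun t : ℝ => w + t • X) X 0 := by
        simpa using ((hasDerivAt_id (0 : ℝ)).smul_const X).const_add w
      have hg : HasDerivAt (fun t : ℝ => F (w + t • X)) (A X) 0 := by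
        have h2 : HasFDerivAt F A (w + (0 : ℝ) • X) := by simpa using hdiff w
        exact h2.comp_hasDerivAt (0 : ℝ) hγ
      have h3 := hg.norm_sq
      have h4 := hγ.norm_sq
      simp only [hn] at h3
      have := h3.unique h4
      simp only [zero_smul, add_zero] at this
      linarith
    have hsurj : Function.Surjective A := by
      have := LinearMap.injective_iff_surjective (f := A.toLinearMap)
      exact this.1 (M.injective_of_metric (hrep w).2)
    obtain ⟨X, hX⟩ := hsurj (A w - F w)
    by_contra hne
    have h2 := M.metric_pos (F w) (sub_ne_zero.2 hne)
    have h3 : M.metric (F w) (A w - F w) (A X) = 0 := by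
      have h4 : M.metric (F w) (A w - F w) (A X)
          = M.metric (F w) (A w) (A X) - M.metric (F w) (F w) (A X) := by
        simp only [J2CModule.metric, map_sub, inner_sub_left]
        ring
      rw [h4, hm, metric_self_left, metric_self_left, h1, hn, sub_self]
    rw [hX] at h3
    exact h2.ne' h3
  -- Euler's relation makes e⁻ˢF(eˢw) constant in s.
  have hhom : ∀ w (t : ℝ), 0 < t → F (t • w) = t • F w := by
    intro w t ht
    have hd : ∀ s : ℝ, HasDerivAt (fun s : ℝ => Real.exp (-s) • F (Real.exp s • w)) 0 s := by
      intro s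
      have h1 : HasDerivAt (fun s : ℝ => Real.exp s • w) (Real.exp s • w) s :=
        (Real.hasDerivAt_exp s).smul_const w
      have h2 := (hdiff (Real.exp s • w)).comp_hasDerivAt s h1
      rw [heuler] at h2
      have h3 : HasDerivAt (fun s : ℝ => Real.exp (-s)) (-Real.exp (-s)) s := by
        simpa using (hasDerivAt_neg s).exp
      have h4 := h3.smul h2
      have e : Real.exp (-s) • F (Real.exp s • w) + (-Real.exp (-s)) • F (Real.exp s • w) = 0 := by
        rw [neg_smul, add_neg_cancel]
      rw [← e]
      exact h4
    have h1 := is_const_of_deriv_eq_zero (fun s => (hd s).differentiableAt)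
      (fun s => (hd s).deriv) (Real.log t) 0
    simp only [Real.exp_neg, Real.exp_log ht, neg_zero, Real.exp_zero, one_smul] at h1
    rw [← h1, smul_smul, mul_inv_cancel₀ ht.ne', one_smul]
  have hF0 : F 0 = 0 := by simpa using hn 0
  -- A positively homogeneous map of degree one equals its derivative at 0.
  have hlin : ∀ w, F w = fderiv ℝ F 0 w := by
    intro w
    have hγ : HasDerivAt (fun t : ℝ => t • w) w 0 := by
      simpa using (hasDerivAt_id (0 : ℝ)).smul_const w
    have h1 : HasDerivAt (fun t : ℝ => F (t • w)) (fderiv ℝ F 0 w) 0 := by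
      have h2 : HasFDerivAt F (fderiv ℝ F 0) ((0 : ℝ) • w) := by simpa using hdiff 0
      exact h2.comp_hasDerivAt (0 : ℝ) hγ
    have h2 : HasDerivAt (fun t : ℝ => t • F w) (F w) 0 := by
      simpa using (hasDerivAt_id (0 : ℝ)).smul_const (F w)
    have h3 : HasDerivWithinAt (fun t : ℝ => t • F w) (fderiv ℝ F 0 w) (Set.Ioi 0) 0 := by
      refine (h1.hasDerivWithinAt (s := Set.Ioi 0)).congr (fun t ht => (hhom w t ht).symm) ?_
      simp [hF0]
    exact (uniqueDiffWithinAt_Ioi (0 : ℝ)).eq_deriv _ h2.hasDerivWithinAt h3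
  let T : WSpace C V ≃ₗᵢ[ℝ] WSpace C V := LinearIsometry.toLinearIsometryEquiv
    ⟨(fderiv ℝ F 0).toLinearMap, fun w => by
      change ‖fderiv ℝ F 0 w‖ = _
      rw [← hlin, hn]⟩ rfl
  have hTF : ∀ w, T w = F w := fun w => (hlin w).symm
  -- With norms and metric preserved, Q is preserved as well, and Q determines the lines.
  have hT : M.IsSpread T := by
    refine M.isSpread_of_Q fun w X => ?_
    have h1 : fderiv ℝ F w X = T X := by
      have : F = fderiv ℝ F 0 := funext hlin
      conv_lhs => rw [this]
      rw [ContinuousLinearMap.fderiv, hTF, hlin]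
    have h2 := (hrep w).2 X
    rw [h1, ← hTF, metric_self, metric_self, T.norm_map, T.norm_map] at h2
    have hp := one_add_sq_pos w
    field_simp at h2
    linarith
  refine ⟨T, hT, Homeomorph.ext fun p => ?_⟩
  refine congrFun (M.dense_range_fin.equalizer u.continuous (ext hT).continuous ?_) p
  funext w
  change u (.fin w) = .fin (T w)
  rw [hF, hTF]

/-! ### Projective lines -/

lemma coord_comm (v u : V) : M.coord v u = M.conj (M.coord u v) := by
  refine ext_inner_left ℝ fun ζ => ?_
  have h : ∀ a b : C, inner ℝ (M.conj a) (M.conj b) = inner ℝ a b := by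
    intro a b
    simp only [conj, inner_sub_left, inner_sub_right, inner_smul_left, inner_smul_right,
      M.inner_one_one, conj_trivial]
    rw [real_inner_comm M.one a]
    ring
  rw [inner_coord, inner_J_left, real_inner_comm, ← inner_coord, ← h, conj_conj]

/-- Q behaves like the squared modulus of a Hermitian product, although no such product with values
in C is available here. -/
lemma Q_comm (w X : WSpace C V) : M.Q w X = M.Q X w := by
  have h : inner ℝ (M.J X.fst (M.J (M.conj w.fst) w.snd)) X.snd
      = inner ℝ (M.J w.fst (M.J (M.conj X.fst) X.snd)) w.snd := by
    rw [inner_J_left, inner_J_left, conj_conj, real_inner_comm]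
  rw [Q, Q, h, M.coord_comm w.snd, M.norm_conj]
  ring

lemma line_le_line {x z : WSpace C V} (hz : z ∈ M.line x) : M.line z ≤ M.line x := by
  by_cases h : z = 0
  · rw [h, line_zero]; exact bot_le
  · rw [M.line_eq_of_mem h hz]

/-- The closure in `CPW` of the affine line `w₀ + Cw`. -/
def projLine (w₀ w : WSpace C V) : Set M.CPW := insert (M.infPt w) (CPW.fin '' M.affineLine w₀ w)

/-- The points at infinity of the sum of two lines. -/
def infLine (x y : WSpace C V) : Set M.CPW :=
  {p | ∃ z ∈ M.line x ⊔ M.line y, z ≠ 0 ∧ p = M.infPt z}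

lemma infPt_mem_projLine (w₀ w : WSpace C V) : M.infPt w ∈ M.projLine w₀ w := Or.inl rfl

variable {M} in
lemma fin_mem_projLine {w₀ w x : WSpace C V} (hw : w ≠ 0) :
    CPW.fin x ∈ M.projLine w₀ w ↔ x - w₀ ∈ M.line w := by
  constructor
  · rintro (h | ⟨_, ⟨y, hy, rfl⟩, h⟩)
    · exact absurd h.symm (infPt_ne_fin hw)
    · rw [CPW.fin.injEq] at h
      rw [← h, add_sub_cancel_left]; exact hy
  · intro h
    exact Or.inr ⟨x, ⟨_, h, by abel⟩, rfl⟩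

variable {M} in
lemma infPt_mem_projLine_iff {w₀ w z : WSpace C V} (hw : w ≠ 0) (hz : z ≠ 0) :
    M.infPt z ∈ M.projLine w₀ w ↔ M.line z = M.line w := by
  rw [← M.infPt_eq_iff hz hw]
  constructor
  · rintro (h | ⟨y, _, h⟩)
    · exact h
    · exact absurd h.symm (infPt_ne_fin hz)
  · intro h; exact Or.inl h

variable {M} in
lemma projLine_congr {w₀ w w₀' w' : WSpace C V} (hw : w ≠ 0) (hw' : w' ≠ 0)
    (h : M.line w = M.line w') (h0 : w₀' - w₀ ∈ M.line w) :
    M.projLine w₀ w = M.projLine w₀' w' := by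
  ext p
  rcases M.cpw_cases' p with ⟨x, rfl⟩ | ⟨z, hz, rfl⟩
  · rw [fin_mem_projLine hw, fin_mem_projLine hw', ← h]
    have : x - w₀ = (x - w₀') + (w₀' - w₀) := by abel
    rw [this, Submodule.add_mem_iff_left _ h0]
  · rw [infPt_mem_projLine_iff hw hz, infPt_mem_projLine_iff hw' hz, h]

lemma exists_orthogonal_projLine (w₀ : WSpace C V) {w : WSpace C V} (hw : w ≠ 0) :
    ∃ w₁, (∀ y ∈ M.line w, inner ℝ w₁ y = 0) ∧ M.projLine w₀ w = M.projLine w₁ w := by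
  refine ⟨w₀ - (M.line w).starProjection w₀, fun y hy =>
    (M.line w).starProjection_inner_eq_zero _ _ hy, projLine_congr hw hw rfl ?_⟩
  rw [sub_sub_cancel_left]
  exact Submodule.neg_mem _ ((M.line w).starProjection_apply_mem _)

variable {M} in
-- With w₁ orthogonal to Cw the set is cut out by equations in the coordinate functions. Those for
-- `coordI` describe the affine part; the one for `coordQ` follows there by Pythagoras and singles
-- out [w] at infinity.
lemma isClosed_projLine {w₀ w : WSpace C V} (hw : w ≠ 0) : IsClosed (M.projLine w₀ w) := by
  obtain ⟨w₁, h1, h2⟩ := M.exists_orthogonal_projLine w₀ hw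
  have hnw : ‖w‖ ^ 2 ≠ 0 := pow_ne_zero _ (norm_ne_zero_iff.2 hw)
  have key : M.projLine w₁ w =
      {p | M.coordQ w p = ‖w‖ ^ 2 * (1 - (1 + ‖w₁‖ ^ 2) * M.coordA p)} ∩
        ⋂ X ∈ (M.line w)ᗮ, {p | M.coordI X p = inner ℝ w₁ X * M.coordA p} := by
    ext p
    simp only [Set.mem_inter_iff, Set.mem_ofPred_eq, Set.mem_iInter]
    rcases M.cpw_cases' p with ⟨x, rfl⟩ | ⟨z, hz, rfl⟩
    · rw [fin_mem_projLine hw]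
      simp only [coordQ_fin, coordA_fin, coordI_fin]
      have hp := one_add_sq_pos x
      have hX : (∀ X ∈ (M.line w)ᗮ, inner ℝ x X / (1 + ‖x‖ ^ 2)
          = inner ℝ w₁ X * (1 / (1 + ‖x‖ ^ 2))) ↔ x - w₁ ∈ M.line w := by
        rw [← Submodule.orthogonal_orthogonal (M.line w), Submodule.mem_orthogonal']
        rw [Submodule.orthogonal_orthogonal]
        refine forall₂_congr fun X hX => ?_
        rw [inner_sub_left, sub_eq_zero]
        field_simp
      rw [hX]
      refine ⟨fun h => ⟨?_, h⟩, fun h => h.2⟩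
      have h3 : (M.line w).starProjection x = x - w₁ := by
        refine (Submodule.eq_starProjection_of_mem_of_inner_eq_zero h fun y hy => ?_)
        rw [sub_sub_cancel]; exact h1 y hy
      have h4 : ‖x‖ ^ 2 = ‖x - w₁‖ ^ 2 + ‖w₁‖ ^ 2 := by
        have h5 := norm_add_sq_real (x - w₁) w₁
        rw [sub_add_cancel, real_inner_comm, h1 _ h] at h5
        linarith
      rw [Q_comm, Q_eq, h3]
      have h5 : 1 - (1 + ‖w₁‖ ^ 2) * (1 / (1 + ‖x‖ ^ 2)) = ‖x - w₁‖ ^ 2 / (1 + ‖x‖ ^ 2) := by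
        rw [h4]; rw [h4] at hp; field_simp; ring
      rw [h5]; ring
    · rw [infPt_mem_projLine_iff hw hz]
      simp only [coordQ_infPt _ hz, coordA_infPt hz, coordI_infPt _ hz, mul_zero, sub_zero,
        implies_true, and_true]
      have hnz : ‖z‖ ^ 2 ≠ 0 := pow_ne_zero _ (norm_ne_zero_iff.2 hz)
      rw [_root_.mul_one, div_eq_iff hnz, mul_comm, ← M.mem_line_iff_Q hz]
      exact ⟨fun h => h ▸ M.self_mem_line w, fun h => (M.line_eq_of_mem hw h).symm⟩
  rw [h2, key]
  refine (isClosed_eq (M.continuous_coordQ w)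
    (continuous_const.mul (continuous_const.sub (continuous_const.mul M.continuous_coordA)))).inter
    (isClosed_biInter fun X _ => isClosed_eq (M.continuous_coordI X)
      (continuous_const.mul M.continuous_coordA))

variable {M} in
lemma closure_affineLine {w₀ w : WSpace C V} (hw : w ≠ 0) :
    closure (CPW.fin '' M.affineLine w₀ w) = M.projLine w₀ w := by
  refine subset_antisymm (closure_minimal (Set.subset_insert _ _) (isClosed_projLine hw)) ?_
  rintro p (rfl | h)
  · have h := M.tendsto_infPt hw (f := fun t => t • w₀ + w) (by fun_prop) (by simp)
    refine mem_closure_of_tendsto h ?_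
    filter_upwards [self_mem_nhdsWithin] with t ht
    have ht : t ≠ 0 := ht
    refine ⟨_, ⟨t⁻¹ • w, Submodule.smul_mem _ _ (M.self_mem_line w), ?_⟩, rfl⟩
    rw [smul_add, inv_smul_smul₀ ht]
  · exact subset_closure h

/-! ### Standard lines and their images under the generators -/

/-- The sets that are shown to be the projective lines. -/
def IsStd (L : Set M.CPW) : Prop :=
  (∃ w₀ w : WSpace C V, w ≠ 0 ∧ L = M.projLine w₀ w) ∨
    ∃ x y : WSpace C V, x ≠ 0 ∧ y ∉ M.line x ∧ L = M.infLine x y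

lemma image_ext_projLine {T : WSpace C V ≃ₗᵢ[ℝ] WSpace C V} (hT : M.IsSpread T)
    (w₀ : WSpace C V) {w : WSpace C V} (hw : w ≠ 0) :
    ext hT '' M.projLine w₀ w = M.projLine (T w₀) (T w) := by
  ext p
  rw [← (ext hT).preimage_symm, Set.mem_preimage, ext_symm]
  rcases M.cpw_cases' p with ⟨x, rfl⟩ | ⟨z, hz, rfl⟩
  · rw [ext_fin, fin_mem_projLine hw, fin_mem_projLine (map_ne hw), ← hT, map_sub,
      LinearIsometryEquiv.apply_symm_apply]
  · rw [ext_infPt _ hz, infPt_mem_projLine_iff hw (map_ne hz),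
      infPt_mem_projLine_iff (map_ne hw) hz]
    constructor
    · intro h
      simpa using hT.line_eq h
    · intro h
      simpa using hT.symm.line_eq h

variable {M} in
lemma IsSpread.map_line {T : WSpace C V ≃ₗᵢ[ℝ] WSpace C V} (hT : M.IsSpread T)
    (w : WSpace C V) : (M.line w).map (T : WSpace C V →ₗ[ℝ] WSpace C V) = M.line (T w) := by
  ext x
  constructor
  · rintro ⟨y, hy, rfl⟩
    exact (hT w y).2 hy
  · intro h
    refine ⟨T.symm x, ?_, T.apply_symm_apply x⟩
    rw [SetLike.mem_coe, ← hT, T.apply_symm_apply]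
    exact h

lemma image_ext_infLine {T : WSpace C V ≃ₗᵢ[ℝ] WSpace C V} (hT : M.IsSpread T)
    (x y : WSpace C V) : ext hT '' M.infLine x y = M.infLine (T x) (T y) := by
  have hm : ∀ z, z ∈ M.line x ⊔ M.line y → T z ∈ M.line (T x) ⊔ M.line (T y) := by
    intro z hz
    rw [← hT.map_line, ← hT.map_line, ← Submodule.map_sup]
    exact ⟨z, hz, rfl⟩
  ext p
  constructor
  · rintro ⟨_, ⟨z, hz, hz0, rfl⟩, rfl⟩
    exact ⟨T z, hm z hz, map_ne hz0, ext_infPt hT hz0⟩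
  · rintro ⟨z, hz, hz0, rfl⟩
    rw [← hT.map_line, ← hT.map_line, ← Submodule.map_sup] at hz
    obtain ⟨z', hz', rfl⟩ := hz
    have h0 : z' ≠ 0 := by rintro rfl; exact hz0 (map_zero _)
    exact ⟨_, ⟨z', hz', h0, rfl⟩, ext_infPt hT h0⟩

variable {M} in
lemma IsStd.ext {L : Set M.CPW} (hL : M.IsStd L) {T : WSpace C V ≃ₗᵢ[ℝ] WSpace C V}
    (hT : M.IsSpread T) : M.IsStd (ext hT '' L) := by
  rcases hL with ⟨w₀, w, hw, rfl⟩ | ⟨x, y, hx, hy, rfl⟩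
  · exact Or.inl ⟨_, _, map_ne hw, M.image_ext_projLine hT w₀ hw⟩
  · exact Or.inr ⟨_, _, map_ne hx, fun h => hy ((hT x y).1 h), M.image_ext_infLine hT x y⟩

lemma image_inversion {A B : Set M.CPW} (h : ∀ p ∈ A, M.inversion p ∈ B)
    (h' : ∀ p ∈ B, M.inversion p ∈ A) : M.inversion '' A = B := by
  ext p
  refine ⟨?_, fun hp => ⟨_, h' p hp, M.inversion_inversion p⟩⟩
  rintro ⟨q, hq, rfl⟩
  exact h q hq

/-- The points (ζ, a + ζu) go to (ζ⁻¹, u + ζ⁻¹a): the inversion exchanges intercept and slope. -/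
lemma image_inversion_projLine_one (a u : V) : M.inversion '' M.projLine (pr 0 a) (pr M.one u)
    = M.projLine (pr 0 u) (pr M.one a) := by
  have key : ∀ a u : V, ∀ p ∈ M.projLine (pr 0 a) (pr M.one u),
      M.inversion p ∈ M.projLine (pr 0 u) (pr M.one a) := by
    intro a u p hp
    rcases hp with rfl | ⟨x, ⟨y, hy, rfl⟩, rfl⟩
    · rw [inversion_infPt_one, fin_mem_projLine (M.pr_one_ne a), sub_self]
      exact Submodule.zero_mem _
    · rw [mem_line_one] at hy
      obtain ⟨ζ, v, rfl⟩ : ∃ ζ v, y = pr ζ v := ⟨_, _, rfl⟩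
      have hy : v = M.J ζ u := hy
      rw [pr_add, zero_add, hy]
      by_cases hζ : ζ = 0
      · rw [hζ, map_zero, LinearMap.zero_apply, add_zero, inversion_fin_zero]
        exact M.infPt_mem_projLine _ _
      · rw [M.inversion_fin hζ, map_add, M.J_inv_J hζ, fin_mem_projLine (M.pr_one_ne a),
          mem_line_one]
        change _ - _ = M.J (M.inv ζ - 0) a
        rw [sub_zero]
        exact add_sub_cancel_right _ _
  exact M.image_inversion (key a u) (key u a)

lemma image_inversion_projLine_zero {ζ : C} (hζ : ζ ≠ 0) (u : V) {a : V} (ha : a ≠ 0) :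
    M.inversion '' M.projLine (pr ζ u) (pr 0 a)
      = M.projLine (pr (M.inv ζ) (M.J (M.inv ζ) u)) (pr 0 a) := by
  have key : ∀ ζ : C, ζ ≠ 0 → ∀ u : V, ∀ p ∈ M.projLine (pr ζ u) (pr 0 a),
      M.inversion p ∈ M.projLine (pr (M.inv ζ) (M.J (M.inv ζ) u)) (pr 0 a) := by
    intro ζ hζ u p hp
    rcases hp with rfl | ⟨x, ⟨y, hy, rfl⟩, rfl⟩
    · rw [M.inversion_infPt_zero ha]
      exact M.infPt_mem_projLine _ _
    · rw [mem_line_zero] at hy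
      obtain ⟨h0, ξ, hξ⟩ := hy
      rw [← pr_eta y, h0, hξ, pr_add, add_zero, M.inversion_fin hζ,
        fin_mem_projLine (pr_zero_ne ha), mem_line_zero]
      obtain ⟨θ, hθ⟩ := M.exists_J_J (M.inv ζ) ξ a
      refine ⟨sub_self _, θ, ?_⟩
      change M.J _ _ - M.J _ _ = _
      rw [map_add, add_sub_cancel_left, hθ]
  refine M.image_inversion (key ζ hζ u) ?_
  have := key (M.inv ζ) (M.inv_ne_zero hζ) (M.J (M.inv ζ) u)
  rwa [M.inv_inv hζ, M.J_J_inv hζ] at this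

lemma mem_infLine_aux {u a : V} {z : WSpace C V} :
    z ∈ M.line (pr M.one u) ⊔ M.line (pr 0 a) ↔
      ∃ ξ, z.snd = M.J z.fst u + M.J ξ a := by
  rw [Submodule.mem_sup]
  constructor
  · rintro ⟨x, hx, y, hy, rfl⟩
    rw [mem_line_one] at hx
    rw [mem_line_zero] at hy
    obtain ⟨h0, ξ, hξ⟩ := hy
    refine ⟨ξ, ?_⟩
    rw [WithLp.add_snd, WithLp.add_fst, h0, add_zero, hx, hξ]
  · rintro ⟨ξ, hξ⟩
    refine ⟨pr z.fst (M.J z.fst u), (M.mem_line_one).2 rfl, pr 0 (M.J ξ a),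
      (M.mem_line_zero).2 ⟨rfl, ξ, rfl⟩, ?_⟩
    rw [pr_add, add_zero, ← hξ]; rfl

/-- A finite point (0,x) goes to [1,x], so a line inside 0 ⊕ V becomes the line at infinity of a
plane. -/
lemma image_inversion_projLine_zero_zero (u : V) {a : V} (ha : a ≠ 0) :
    M.inversion '' M.projLine (pr 0 u) (pr 0 a) = M.infLine (pr M.one u) (pr 0 a) := by
  refine M.image_inversion ?_ ?_
  · rintro p (rfl | ⟨x, ⟨y, hy, rfl⟩, rfl⟩)
    · rw [M.inversion_infPt_zero ha]
      exact ⟨_, Submodule.mem_sup_right (M.self_mem_line _), pr_zero_ne ha, rfl⟩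
    · rw [mem_line_zero] at hy
      obtain ⟨h0, ξ, hξ⟩ := hy
      rw [← pr_eta y, h0, hξ, pr_add, add_zero, M.inversion_fin_zero]
      refine ⟨_, ?_, M.pr_one_ne _, rfl⟩
      rw [mem_infLine_aux]
      exact ⟨ξ, by simp [M.J_one]⟩
  · rintro p ⟨z, hz, hz0, rfl⟩
    rw [mem_infLine_aux] at hz
    obtain ⟨ξ, hξ⟩ := hz
    obtain ⟨ζ, v, rfl⟩ : ∃ ζ v, z = pr ζ v := ⟨_, _, rfl⟩
    have hξ : v = M.J ζ u + M.J ξ a := hξ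
    rw [hξ] at hz0 ⊢
    by_cases hζ : ζ = 0
    · subst hζ
      rw [map_zero, LinearMap.zero_apply, zero_add] at hz0 ⊢
      have h1 : M.J ξ a ≠ 0 := fun h => hz0 (pr_eq_zero.2 ⟨rfl, h⟩)
      rw [M.inversion_infPt_zero h1, infPt_mem_projLine_iff (pr_zero_ne ha) hz0]
      exact M.line_eq_of_mem hz0 ((M.mem_line_zero).2 ⟨rfl, ξ, rfl⟩)
    · rw [M.inversion_infPt hζ, map_add, M.J_inv_J hζ, fin_mem_projLine (pr_zero_ne ha),
        mem_line_zero]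
      obtain ⟨θ, hθ⟩ := M.exists_J_J (M.inv ζ) ξ a
      refine ⟨sub_self _, θ, ?_⟩
      change (u + _) - u = _
      rw [add_sub_cancel_left, hθ]

lemma infLine_congr {x y x' y' : WSpace C V} (h : M.line x ⊔ M.line y = M.line x' ⊔ M.line y') :
    M.infLine x y = M.infLine x' y' := by
  rw [infLine, infLine, h]

/-- A line at infinity that is not contained in the hyperplane at infinity of `0 ⊕ V`. -/
lemma exists_infLine_eq {x y : WSpace C V} (hx : x.fst ≠ 0) (hy : y ∉ M.line x) :
    ∃ u b : V, b ≠ 0 ∧ M.infLine x y = M.infLine (pr M.one u) (pr 0 b) := by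
  have hxl : M.line x = M.line (pr M.one (M.J (M.inv x.fst) x.snd)) := M.line_of_ne hx x.snd
  set u := M.J (M.inv x.fst) x.snd
  rw [hxl] at hy
  by_cases h : y.fst = 0
  · have e : y = pr 0 y.snd := by rw [← h]; rfl
    refine ⟨u, y.snd, ?_, M.infLine_congr ?_⟩
    · intro h0
      apply hy
      rw [e, h0]; exact Submodule.zero_mem _
    · rw [hxl, ← e]
  · have hyl : M.line y = M.line (pr M.one (M.J (M.inv y.fst) y.snd)) := M.line_of_ne h y.snd
    set t := M.J (M.inv y.fst) y.snd
    refine ⟨u, t - u, ?_, M.infLine_congr ?_⟩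
    · intro h0
      rw [sub_eq_zero] at h0
      apply hy
      rw [← h0, ← hyl]; exact M.self_mem_line y
    · rw [hxl, hyl]
      refine le_antisymm (sup_le le_sup_left fun z hz => ?_) (sup_le le_sup_left fun z hz => ?_)
      · rw [mem_line_one] at hz
        exact M.mem_infLine_aux.2 ⟨z.fst, by rw [hz, ← map_add, add_sub_cancel]⟩
      · rw [mem_line_zero] at hz
        obtain ⟨h0, ξ, hξ⟩ := hz
        have e : z = -pr ξ (M.J ξ u) + pr ξ (M.J ξ t) := by
          refine wext ?_ ?_
          · rw [h0]; exact (neg_add_cancel _).symm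
          · rw [hξ, map_sub]; change _ = -M.J ξ u + M.J ξ t; abel
        rw [e]
        exact Submodule.add_mem _ (Submodule.mem_sup_left (Submodule.neg_mem _ ((M.mem_line_one).2 rfl)))
          (Submodule.mem_sup_right ((M.mem_line_one).2 rfl))

variable {M} in
-- Lines not parallel to 0 ⊕ V are graphs and stay affine; those parallel to it stay affine unless
-- they lie in it, when they go to infinity. A line at infinity inside [0 ⊕ V] is fixed pointwise,
-- and any other one is the inverse image of an affine line.
lemma IsStd.inversion {L : Set M.CPW} (hL : M.IsStd L) : M.IsStd (M.inversion '' L) := by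
  rcases hL with ⟨w₀, w, hw, rfl⟩ | ⟨x, y, hx, hy, rfl⟩
  · rcases M.line_cases hw with ⟨u, hu⟩ | ⟨a, ha, rfl⟩
    · have e : M.projLine w₀ w = M.projLine (pr 0 (w₀.snd - M.J w₀.fst u)) (pr M.one u) := by
        refine projLine_congr hw (M.pr_one_ne u) hu ?_
        rw [hu, mem_line_one]
        change w₀.snd - M.J w₀.fst u - w₀.snd = M.J (0 - w₀.fst) u
        rw [zero_sub, map_neg, LinearMap.neg_apply]; abel
      rw [e, image_inversion_projLine_one]
      exact Or.inl ⟨_, _, M.pr_one_ne _, rfl⟩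
    · by_cases h : w₀.fst = 0
      · rw [← pr_eta w₀, h, M.image_inversion_projLine_zero_zero _ ha]
        refine Or.inr ⟨_, _, M.pr_one_ne _, ?_, rfl⟩
        rw [mem_line_one]
        intro h'
        have h' : a = M.J 0 w₀.snd := h'
        rw [map_zero] at h'
        exact ha h'
      · rw [← pr_eta w₀, M.image_inversion_projLine_zero h _ ha]
        exact Or.inl ⟨_, _, pr_zero_ne ha, rfl⟩
  · have key : ∀ {x y : WSpace C V}, x.fst ≠ 0 → y ∉ M.line x →
        M.IsStd (M.inversion '' M.infLine x y) := by
      intro x y hx hy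
      obtain ⟨u, b, hb, h⟩ := M.exists_infLine_eq hx hy
      rw [h, ← M.image_inversion_projLine_zero_zero u hb, ← Set.image_comp]
      refine Or.inl ⟨pr 0 u, pr 0 b, pr_zero_ne hb, ?_⟩
      convert Set.image_id _
      funext p
      exact M.inversion_inversion p
    by_cases hx1 : x.fst = 0
    · by_cases hy1 : y.fst = 0
      · refine Or.inr ⟨x, y, hx, hy, ?_⟩
        have hfix : ∀ p ∈ M.infLine x y, M.inversion p = p := by
          rintro p ⟨z, hz, hz0, rfl⟩
          obtain ⟨a, ha, b, hb, rfl⟩ := Submodule.mem_sup.1 hz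
          rw [← pr_eta x, hx1, mem_line_zero] at ha
          rw [← pr_eta y, hy1, mem_line_zero] at hb
          have h0 : (a + b).fst = 0 := by rw [WithLp.add_fst, ha.1, hb.1, add_zero]
          rw [← pr_eta (a + b), h0] at hz0 ⊢
          exact M.inversion_infPt_zero fun h => hz0 (pr_eq_zero.2 ⟨rfl, h⟩)
        rw [Set.image_congr hfix, Set.image_id']
      · have hxy : x ∉ M.line y := fun h => hy (M.line_eq_of_mem hx h ▸ M.self_mem_line y)
        have e : M.infLine x y = M.infLine y x := M.infLine_congr (sup_comm _ _)
        rw [e]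
        exact key hy1 hxy
    · exact key hx1 hy

variable {M} in
lemma IsStd.gen {L : Set M.CPW} (hL : M.IsStd L) {u : M.CPW ≃ₜ M.CPW} (hu : M.Gen u) :
    M.IsStd (u '' L) := by
  induction hu generalizing L with
  | ext hT => exact hL.ext hT
  | inversion => exact hL.inversion
  | @trans u u' _ _ h1 h2 =>
    have := h2 (h1 hL)
    rwa [← Set.image_comp] at this

variable {M} in
-- Translations are in general not isometric, but they permute parallel affine lines and fix every
-- point at infinity.
lemma IsStd.translation {L : Set M.CPW} (hL : M.IsStd L) (b : WSpace C V) :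
    M.IsStd (M.translation b '' L) := by
  rcases hL with ⟨w₀, w, hw, rfl⟩ | ⟨x, y, hx, hy, rfl⟩
  · refine Or.inl ⟨w₀ + b, w, hw, ?_⟩
    rw [projLine, Set.image_insert_eq, translation_infPt b hw, projLine]
    congr 1
    ext p
    constructor
    · rintro ⟨_, ⟨x, ⟨y, hy, rfl⟩, rfl⟩, rfl⟩
      exact ⟨_, ⟨y, hy, rfl⟩, by rw [translation_fin]; congr 1; abel⟩
    · rintro ⟨_, ⟨y, hy, rfl⟩, rfl⟩
      exact ⟨_, ⟨_, ⟨y, hy, rfl⟩, rfl⟩, by rw [translation_fin]; congr 1; abel⟩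
  · refine Or.inr ⟨x, y, hx, hy, ?_⟩
    have hfix : ∀ p ∈ M.infLine x y, M.translation b p = p := by
      rintro p ⟨z, hz, hz0, rfl⟩
      exact translation_infPt b hz0
    rw [Set.image_congr hfix, Set.image_id']

variable {M} in
-- Transitivity of the generated group reduces to an isometry that fixes the origin, and that is
-- linear.
lemma IsIsom.gen [Nontrivial V] {u : M.CPW ≃ₜ M.CPW} (hu : M.IsIsom u) : M.Gen u := by
  obtain ⟨r, hr, h0⟩ := M.exists_gen_zero (u (.fin 0))
  obtain ⟨T, hT, h⟩ := (hu.comp hr.isIsom).eq_ext h0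
  have e : u = (ext hT).trans r.symm := by
    rw [← h]
    ext p
    simp
  rw [e]
  exact (Gen.ext hT).trans hr.symm

/-- All isometries are generated by maps that preserve standard lines. Conversely, a rotation
followed by the inversion brings a line at infinity to an affine line. -/
lemma isProjLine_iff [Nontrivial V] (L : Set M.CPW) : M.IsProjLine L ↔ M.IsStd L := by
  constructor
  · rintro ⟨u, hu, w₀, w, hw, rfl⟩
    rw [closure_affineLine hw]
    exact IsStd.gen (Or.inl ⟨_, _, hw, rfl⟩) hu.gen
  · rintro (⟨w₀, w, hw, rfl⟩ | ⟨x, y, hx, hy, rfl⟩)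
    · refine ⟨ext IsSpread.refl, M.isIsom_ext _, w₀, w, hw, ?_⟩
      rw [closure_affineLine hw, M.image_ext_projLine _ _ hw]; rfl
    · obtain ⟨T, hT, a, ha, h⟩ := M.exists_isSpread_fst hx
      have hx' : (T x).fst ≠ 0 := by rw [h]; exact ha
      obtain ⟨u, b, hb, h'⟩ := M.exists_infLine_eq hx' (fun h => hy ((hT x y).1 h))
      refine ⟨((ext hT).trans M.inversion).symm, ((M.isIsom_ext hT).comp M.isIsom_inversion).symm,
        pr 0 u, pr 0 b, pr_zero_ne hb, ?_⟩
      rw [closure_affineLine (pr_zero_ne hb), ← Homeomorph.preimage_symm, Homeomorph.symm_symm]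
      change _ = ext hT ⁻¹' (M.inversion ⁻¹' M.projLine (pr 0 u) (pr 0 b))
      have e : M.inversion ⁻¹' M.projLine (pr 0 u) (pr 0 b) = M.infLine (pr M.one u) (pr 0 b) := by
        rw [← M.image_inversion_projLine_zero_zero u hb, ← Homeomorph.image_symm]; rfl
      rw [e, ← h', ← M.image_ext_infLine hT, Set.preimage_image_eq _ (ext hT).injective]

/-! ### Moving a projective line to infinity -/

/-- The conjugate by the inversion of the translation by `(b, 0)`. -/
def kelvin (b : C) : M.CPW ≃ M.CPW :=
  M.inversion.toEquiv.trans ((M.translation (pr b 0)).trans M.inversion.toEquiv)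

lemma kelvin_apply (b : C) (p : M.CPW) :
    M.kelvin b p = M.inversion (M.translation (pr b 0) (M.inversion p)) := rfl

/-- The denominator in the expression of `kelvin` on `W`. -/
def kelvinDenom (b : C) (w : WSpace C V) : ℝ :=
  1 + 2 * inner ℝ (M.conj w.fst) b + ‖w.fst‖ ^ 2 * ‖b‖ ^ 2

/-- The second-order part of the expression of `kelvin` on `W`. -/
def kelvinQuad (b : C) (w : WSpace C V) : WSpace C V :=
  pr (‖w.fst‖ ^ 2 • M.conj b) (M.J (M.conj b) (M.J (M.conj w.fst) w.snd))

/-- The expression of `kelvin` on `W`. -/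
def kelvinW (b : C) (w : WSpace C V) : WSpace C V :=
  (M.kelvinDenom b w)⁻¹ • (w + M.kelvinQuad b w)

/-- For ζ ≠ 0 the denominator is |ζ|²|ζ⁻¹ + b|². Multiplying out removes the singularity of the
inversion at ζ = 0. -/
lemma kelvin_fin (b : C) {w : WSpace C V} (h : M.kelvinDenom b w ≠ 0) :
    M.kelvin b (.fin w) = .fin (M.kelvinW b w) := by
  obtain ⟨ζ, v, rfl⟩ : ∃ ζ v, w = pr ζ v := ⟨_, _, rfl⟩
  change 1 + 2 * inner ℝ (M.conj ζ) b + ‖ζ‖ ^ 2 * ‖b‖ ^ 2 ≠ 0 at h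
  have hW : M.kelvinW b (pr ζ v) = (1 + 2 * inner ℝ (M.conj ζ) b + ‖ζ‖ ^ 2 * ‖b‖ ^ 2)⁻¹ •
    pr (ζ + ‖ζ‖ ^ 2 • M.conj b) (v + M.J (M.conj b) (M.J (M.conj ζ) v)) := rfl
  rw [hW, kelvin_apply]
  by_cases hζ : ζ = 0
  · subst hζ
    rw [M.inversion_fin_zero, translation_infPt _ (M.pr_one_ne v), M.inversion_infPt_one]
    simp [M.conj_zero]
  · have hζ' : ‖ζ‖ ^ 2 ≠ 0 := pow_ne_zero _ (norm_ne_zero_iff.2 hζ)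
    set c := M.inv ζ + b with hc
    have hD : 1 + 2 * inner ℝ (M.conj ζ) b + ‖ζ‖ ^ 2 * ‖b‖ ^ 2 = ‖ζ‖ ^ 2 * ‖c‖ ^ 2 := by
      rw [hc, norm_add_sq_real, M.norm_inv, inv_pow, M.conj_eq_smul_inv hζ, real_inner_smul_left]
      field_simp
    rw [hD] at h ⊢
    have hc0 : c ≠ 0 := by rintro h0; rw [h0] at h; simp at h
    have hcc : M.conj c = (‖ζ‖ ^ 2)⁻¹ • ζ + M.conj b := by
      rw [hc, M.conj_add, inv, M.conj_smul, conj_conj]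
    rw [M.inversion_fin hζ, translation_fin, pr_add, add_zero, ← hc, M.inversion_fin hc0, smul_pr]
    have e1 : M.inv c = (‖ζ‖ ^ 2 * ‖c‖ ^ 2)⁻¹ • (ζ + ‖ζ‖ ^ 2 • M.conj b) := by
      rw [inv, hcc, mul_inv, mul_comm, mul_smul, smul_add _ ζ, smul_smul _ _ (M.conj b),
        inv_mul_cancel₀ hζ', one_smul]
    have e2 : M.J (M.inv c) (M.J (M.inv ζ) v)
        = (‖ζ‖ ^ 2 * ‖c‖ ^ 2)⁻¹ • (v + M.J (M.conj b) (M.J (M.conj ζ) v)) := by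
      rw [e1, map_smul, LinearMap.smul_apply, map_add, LinearMap.add_apply, M.J_J_inv hζ,
        map_smul, LinearMap.smul_apply, M.conj_eq_smul_inv hζ, map_smul, LinearMap.smul_apply,
        map_smul]
    rw [e2, e1]

lemma kelvinDenom_zero (b : C) : M.kelvinDenom b (0 : WSpace C V) = 1 := by
  simp [kelvinDenom, M.conj_zero]

lemma kelvinQuad_smul (b : C) (t : ℝ) (w : WSpace C V) :
    M.kelvinQuad b (t • w) = t ^ 2 • M.kelvinQuad b w := by
  rw [kelvinQuad, kelvinQuad, smul_pr (t ^ 2), WithLp.smul_fst, WithLp.smul_snd, norm_smul, M.conj_smul,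
    map_smul, map_smul, map_smul, LinearMap.smul_apply, map_smul, smul_smul, smul_smul, mul_pow,
    Real.norm_eq_abs, sq_abs, sq]

lemma contDiff_kelvinDenom (b : C) : ContDiff ℝ ∞ (M.kelvinDenom (V := V) b) :=
  (contDiff_const.add (contDiff_const.mul
    ((M.contDiff_conj.comp contDiff_wfst).inner ℝ contDiff_const))).add
    ((contDiff_wfst.norm_sq ℝ).mul contDiff_const)

lemma contDiffAt_kelvinW (b : C) : ContDiffAt ℝ ∞ (M.kelvinW b) (0 : WSpace C V) := by
  have h1 : ContDiffAt ℝ ∞ (M.kelvinQuad b) (0 : WSpace C V) :=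
    contDiffAt_pr (((contDiff_wfst.norm_sq ℝ).smul contDiff_const).contDiffAt)
      (M.contDiffAt_J contDiffAt_const (M.contDiffAt_J
        (M.contDiffAt_conj contDiff_wfst.contDiffAt) contDiff_wsnd.contDiffAt))
  exact ((M.contDiff_kelvinDenom b).contDiffAt.inv (by rw [kelvinDenom_zero]; norm_num)).smul
    (contDiffAt_id.add h1)

lemma kelvinW_zero (b : C) : M.kelvinW b (0 : WSpace C V) = 0 := by
  simp [kelvinW, kelvinQuad, M.conj_zero]

lemma rep_kelvin (b : C) : M.Rep (M.kelvin b) .fin .fin 0 0 (M.kelvinW b) := by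
  refine ⟨M.kelvinW_zero b, M.contDiffAt_kelvinW b, ?_⟩
  filter_upwards [(M.contDiff_kelvinDenom b).continuous.continuousAt.eventually_ne
    (show M.kelvinDenom b (0 : WSpace C V) ≠ 0 by rw [kelvinDenom_zero]; norm_num)] with w hw
  exact M.kelvin_fin b hw

/-- The denominator is 1 at the origin and the correction to w in the numerator is quadratic, so the
differential at 0 is the identity. -/
lemma fderiv_kelvinW (b : C) (X : WSpace C V) : fderiv ℝ (M.kelvinW b) 0 X = X := by
  have h1 : HasDerivAt (fun t : ℝ => t • X) X 0 := by
    simpa using (hasDerivAt_id (0 : ℝ)).smul_const X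
  have h2 : HasDerivAt (fun t : ℝ => M.kelvinW b (t • X)) (fderiv ℝ (M.kelvinW b) 0 X) 0 := by
    have h := ((M.contDiffAt_kelvinW b).differentiableAt (by simp)).hasFDerivAt
    have h' : HasFDerivAt (M.kelvinW b) (fderiv ℝ (M.kelvinW b) 0) ((0 : ℝ) • X) := by
      simpa using h
    exact h'.comp_hasDerivAt (0 : ℝ) h1
  set g : ℝ → WSpace C V := fun t => (M.kelvinDenom b (t • X))⁻¹ • (X + t • M.kelvinQuad b X)
    with hg
  have hgc : ContinuousAt g 0 := by
    refine ContinuousAt.smul (ContinuousAt.inv₀ ?_ ?_) (f := fun t => (M.kelvinDenom b (t • X))⁻¹)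
      (g := fun t : ℝ => X + t • M.kelvinQuad b X) (by fun_prop)
    · exact ((M.contDiff_kelvinDenom b).continuous.comp (by fun_prop)).continuousAt
    · rw [zero_smul, kelvinDenom_zero]; norm_num
  have hg0 : g 0 = X := by simp [hg, kelvinDenom_zero]
  have h3 : (fun t : ℝ => M.kelvinW b (t • X)) = fun t => t • g t := by
    funext t
    rw [kelvinW, kelvinQuad_smul, hg]
    simp only
    rw [smul_comm, smul_add t, smul_smul t t, sq]
  have h4 : HasDerivAt (fun t : ℝ => t • g t) X 0 := by
    rw [hasDerivAt_iff_tendsto_slope]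
    have : Filter.Tendsto g (𝓝[≠] 0) (𝓝 X) := by
      have := hgc.tendsto
      rw [hg0] at this
      exact this.mono_left nhdsWithin_le_nhds
    refine this.congr' ?_
    filter_upwards [self_mem_nhdsWithin] with t ht
    have ht : t ≠ 0 := ht
    rw [slope_def_module, sub_zero, zero_smul, sub_zero, inv_smul_smul₀ ht]
  rw [h3] at h2
  exact h2.unique h4

variable {M} in
lemma IsStd.kelvin {L : Set M.CPW} (hL : M.IsStd L) (b : C) : M.IsStd (M.kelvin b '' L) := by
  have h := (hL.inversion.translation (pr b 0)).inversion
  rwa [← Set.image_comp, ← Set.image_comp] at h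

variable {M} in
/-- A line that misses the origin is moved to infinity by a bijection that preserves lines and is
conformal at the origin. -/
lemma IsStd.exists_move {N : Set M.CPW} (hN : M.IsStd N) (h0 : CPW.fin 0 ∉ N) :
    ∃ K : M.CPW ≃ M.CPW, (∀ L, M.IsStd L → M.IsStd (K '' L)) ∧
      (∀ p ∈ N, ∃ w, w ≠ 0 ∧ K p = M.infPt w) ∧
      ∃ F, M.Rep K .fin .fin 0 0 F ∧ ∀ X, ‖fderiv ℝ F 0 X‖ = ‖X‖ := by
  rcases hN with ⟨w₀, w, hw, rfl⟩ | ⟨x, y, hx, hy, rfl⟩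
  · obtain ⟨w₁, h1, h2⟩ := M.exists_orthogonal_projLine w₀ hw
    rw [h2] at h0 ⊢
    have hw1 : w₁ ≠ 0 := by
      rintro rfl
      apply h0
      rw [fin_mem_projLine hw, sub_self]
      exact Submodule.zero_mem _
    obtain ⟨T, hT, a, ha, h⟩ := M.exists_isSpread_fst hw1
    -- Since w₁ is orthogonal to Cw, Q vanishes on the pair. Once w₁ is rotated to (a,0), this
    -- forces the direction of the line into 0 ⊕ V.
    have hproj : (M.line w).starProjection w₁ = 0 := by
      refine Submodule.eq_starProjection_of_mem_of_inner_eq_zero (Submodule.zero_mem _)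
        fun y hy => ?_
      rw [sub_zero]; exact h1 y hy
    have hQ : M.Q (pr a 0) (T w) = 0 := by
      rw [← h, hT.Q_map, Q_comm, Q_eq, hproj]; simp
    have hfst : (T w).fst = 0 := by
      rw [Q] at hQ
      have : ‖a‖ ^ 2 * ‖(T w).fst‖ ^ 2 = 0 := by
        simpa [coord_zero_left] using hQ
      simpa [ha] using this
    have hTw : T w = pr 0 (T w).snd := by rw [← hfst]; rfl
    have hc : (T w).snd ≠ 0 := by
      intro h'
      rw [h'] at hTw
      exact map_ne (T := T) hw hTw
    -- The inversion takes the rotated line to one at height a⁻¹. Translation by -a⁻¹ puts it into 0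
    -- ⊕ V, and the second inversion sends it to infinity.
    refine ⟨(J2CModule.ext hT).toEquiv.trans (M.kelvin (-M.inv a)), fun L hL => ?_, fun p hp => ?_,
      M.kelvinW (-M.inv a) ∘ T, ?_, fun X => ?_⟩
    · have := (hL.ext hT).kelvin (-M.inv a)
      rwa [← Set.image_comp] at this
    · have hp' : J2CModule.ext hT p ∈ M.projLine (pr a 0) (pr 0 (T w).snd) := by
        rw [← hTw, ← h, ← M.image_ext_projLine hT _ hw]
        exact ⟨p, hp, rfl⟩
      change ∃ w', w' ≠ 0 ∧ M.kelvin (-M.inv a) (J2CModule.ext hT p) = M.infPt w'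
      have hi : M.inversion (J2CModule.ext hT p) ∈ M.projLine (pr (M.inv a) 0) (pr 0 (T w).snd) := by
        have := M.image_inversion_projLine_zero ha 0 hc
        rw [map_zero] at this
        rw [← this]
        exact ⟨_, hp', rfl⟩
      rw [kelvin_apply]
      rcases hi with hi | ⟨x, ⟨y, hy, rfl⟩, hi⟩
      · rw [hi, translation_infPt _ (pr_zero_ne hc), M.inversion_infPt_zero hc]
        exact ⟨_, pr_zero_ne hc, rfl⟩
      · rw [mem_line_zero] at hy
        rw [← hi, translation_fin, ← pr_eta y, hy.1, pr_add, pr_add, add_zero, add_neg_cancel,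
          M.inversion_fin_zero]
        exact ⟨_, M.pr_one_ne _, rfl⟩
    · refine (M.rep_kelvin _).comp (χ := .fin) (z := 0) ⟨map_zero _, T.contDiff.contDiffAt, ?_⟩
      exact Filter.Eventually.of_forall fun x => rfl
    · have hd : fderiv ℝ (M.kelvinW (-M.inv a) ∘ T) 0 X
          = fderiv ℝ (M.kelvinW (-M.inv a)) 0 (T X) := by
        have h := ((M.contDiffAt_kelvinW (-M.inv a)).differentiableAt (by simp)).hasFDerivAt
        have h' : HasFDerivAt (M.kelvinW (-M.inv a)) (fderiv ℝ (M.kelvinW (-M.inv a)) 0) (T 0) := by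
          rwa [map_zero]
        rw [(h'.comp 0 T.toContinuousLinearEquiv.hasFDerivAt).fderiv]
        rfl
      rw [hd, fderiv_kelvinW, T.norm_map]
  · refine ⟨Equiv.refl _, fun L hL => by simpa using hL, ?_, id,
      ⟨rfl, contDiffAt_id, Filter.Eventually.of_forall fun _ => rfl⟩, fun X => by simp⟩
    rintro p ⟨z, hz, hz0, rfl⟩
    exact ⟨z, hz0, rfl⟩

/-! ### The fundamental theorem on a plane -/

/-- The plane `C ⊕ Cv`. -/
abbrev plane (v : V) : Submodule ℝ (WSpace C V) := M.line (pr M.one 0) ⊔ M.line (pr 0 v)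

lemma exists_plane_notMem {v : V} (hv : v ≠ 0) (x : WSpace C V) :
    ∃ z ∈ M.plane v, z ∉ M.line x := by
  by_cases h : pr M.one 0 ∈ M.line x
  · refine ⟨pr 0 v, Submodule.mem_sup_right (M.self_mem_line _), ?_⟩
    rw [← M.line_eq_of_mem (M.pr_one_ne 0) h, mem_line_one]
    intro h'
    have h' : v = M.J 0 0 := h'
    rw [map_zero] at h'
    exact hv h'
  · exact ⟨_, Submodule.mem_sup_left (M.self_mem_line _), h⟩

/-- A bijection of `CPW` that preserves projective lines, fixes the origin, and maps the points at
infinity of a plane to points at infinity, is linear on the plane. -/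
lemma exists_linear_of_isStd {v : V} (hv : v ≠ 0) (G : M.CPW ≃ M.CPW)
    (hG : ∀ L, M.IsStd L → M.IsStd (G '' L)) (h0 : G (.fin 0) = .fin 0)
    (hc : ContinuousAt G (.fin 0))
    (hinf : ∀ p ∈ M.infLine (pr M.one 0) (pr 0 v), ∃ w, w ≠ 0 ∧ G p = M.infPt w) :
    ∃ f : M.plane v →L[ℝ] WSpace C V,
      (∀ x : M.plane v, G (.fin x) = .fin (f x)) ∧
        ∀ x y : M.plane v, (y : WSpace C V) ∈ M.line (x : WSpace C V) ↔ f y ∈ M.line (f x) := by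
  -- The image contains the finite point x', so it is not a line at infinity; its point at infinity
  -- is the image of [y].
  have hline : ∀ x x' y : WSpace C V, y ∈ M.plane v → y ≠ 0 → G (.fin x) = .fin x' →
      ∃ w, w ≠ 0 ∧ G '' M.projLine x y = M.projLine x' w ∧ G (M.infPt y) = M.infPt w := by
    intro x x' y hy hy0 hx
    obtain ⟨w, hw, hyw⟩ := hinf _ ⟨y, hy, hy0, rfl⟩
    have hx' : CPW.fin x' ∈ G '' M.projLine x y := ⟨.fin x, by
      rw [fin_mem_projLine hy0, sub_self]; exact Submodule.zero_mem _, hx⟩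
    have hy' : M.infPt w ∈ G '' M.projLine x y := ⟨_, M.infPt_mem_projLine _ _, hyw⟩
    refine ⟨w, hw, ?_, hyw⟩
    rcases hG _ (Or.inl ⟨x, y, hy0, rfl⟩) with ⟨w₀, w', hw', e⟩ | ⟨a, b, ha, hb, e⟩
    · rw [e] at hx' hy' ⊢
      rw [infPt_mem_projLine_iff hw' hw] at hy'
      exact projLine_congr hw' hw hy'.symm ((fin_mem_projLine hw').1 hx')
    · rw [e] at hx'
      obtain ⟨z, _, hz, h⟩ := hx'
      exact absurd h.symm (infPt_ne_fin hz)
  have hfin : ∀ x : M.plane v, ∃ x' : WSpace C V, G (.fin x) = .fin x' := by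
    rintro ⟨x, hx⟩
    by_cases hx0 : x = 0
    · exact ⟨0, by rw [← h0]; congr 2⟩
    obtain ⟨w, hw, h1, h2⟩ := hline 0 0 x hx hx0 h0
    have h3 : G (.fin x) ∈ M.projLine 0 w := by
      rw [← h1]
      exact ⟨_, by rw [fin_mem_projLine hx0, sub_zero]; exact M.self_mem_line x, rfl⟩
    rcases h3 with h3 | ⟨x', _, h3⟩
    · rw [← h2] at h3
      exact absurd (G.injective h3).symm (infPt_ne_fin hx0)
    · exact ⟨x', h3.symm⟩
  choose f hf using hfin
  have hf0 : f 0 = 0 := by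
    have := (hf 0).symm.trans h0
    simpa using this
  have hfne : ∀ x : M.plane v, x ≠ 0 → f x ≠ 0 := by
    intro x hx h
    apply hx
    have h1 := hf x
    rw [h, ← h0] at h1
    have := G.injective h1
    rw [CPW.fin.injEq] at this
    exact Subtype.ext this
  -- The image direction depends only on [y], so parallels go to parallels. Comparison with the line
  -- through the origin shows that this direction is that of f(y).
  have hmem : ∀ x y z : M.plane v, y ≠ 0 →
      ((z : WSpace C V) - x ∈ M.line (y : WSpace C V) ↔ f z - f x ∈ M.line (f y)) := by
    have hdir : ∀ x y : M.plane v, y ≠ 0 → ∃ w, w ≠ 0 ∧ M.infPt w = G (M.infPt y) ∧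
        ∀ z : M.plane v, ((z : WSpace C V) - x ∈ M.line (y : WSpace C V) ↔ f z - f x ∈ M.line w) := by
      intro x y hy
      have hy0 : (y : WSpace C V) ≠ 0 := fun h => hy (Subtype.ext h)
      obtain ⟨w, hw, h1, h2⟩ := hline x (f x) y y.2 hy0 (hf x)
      refine ⟨w, hw, h2.symm, fun z => ?_⟩
      rw [← fin_mem_projLine hy0, ← fin_mem_projLine hw, ← h1, ← hf z,
        G.injective.mem_set_image]
    intro x y z hy
    obtain ⟨w, hw, h1, h2⟩ := hdir x y hy
    obtain ⟨w', hw', h1', h2'⟩ := hdir 0 y hy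
    have h3 := (h2' y).1 (by rw [Submodule.coe_zero, sub_zero]; exact M.self_mem_line _)
    rw [hf0, sub_zero] at h3
    rw [h2, M.line_eq_of_mem (hfne y hy) h3, (M.infPt_eq_iff hw hw').1 (h1.trans h1'.symm)]
  have hmem0 : ∀ x y : M.plane v, (y : WSpace C V) ∈ M.line (x : WSpace C V) ↔ f y ∈ M.line (f x) := by
    intro x y
    by_cases hx : x = 0
    · rw [hx, hf0, Submodule.coe_zero, line_zero, Submodule.mem_bot, Submodule.mem_bot]
      refine ⟨fun h => ?_, fun h => ?_⟩
      · have : y = 0 := Subtype.ext h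
        rw [this, hf0]
      · by_contra hy
        exact hfne y (fun h' => hy (by rw [h']; rfl)) h
    · have := hmem 0 x y hx
      rwa [Submodule.coe_zero, sub_zero, hf0, sub_zero] at this
  -- Parallelogram: f(x + y) lies on the parallel to Cf(y) through f(x) and on the parallel to Cf(x)
  -- through f(y). These meet only in f(x) + f(y), since the two lines through 0 are different.
  have hadd1 : ∀ x y : M.plane v, (y : WSpace C V) ∉ M.line (x : WSpace C V) → f (x + y) = f x + f y := by
    intro x y hxy
    by_cases hx : x = 0
    · rw [hx, hf0, zero_add, zero_add]
    have hy : y ≠ 0 := by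
      rintro rfl
      exact hxy (Submodule.zero_mem _)
    have h1 : f (x + y) - f x ∈ M.line (f y) := by
      rw [← hmem x y _ hy, Submodule.coe_add, add_sub_cancel_left]
      exact M.self_mem_line _
    have h2 : f (x + y) - f y ∈ M.line (f x) := by
      rw [← hmem y x _ hx, Submodule.coe_add, add_sub_cancel_right]
      exact M.self_mem_line _
    by_contra hne
    have hd : f (x + y) - f x - f y ≠ 0 := by
      intro h
      apply hne
      rw [sub_sub, sub_eq_zero] at h
      exact h
    have h3 : f (x + y) - f x - f y ∈ M.line (f y) := Submodule.sub_mem _ h1 (M.self_mem_line _)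
    have h4 : f (x + y) - f x - f y ∈ M.line (f x) := by
      rw [sub_right_comm]
      exact Submodule.sub_mem _ h2 (M.self_mem_line _)
    apply hxy
    rw [hmem0, M.line_eq_or_disjoint hd h4 h3]
    exact M.self_mem_line _
  have hadd : ∀ x y : M.plane v, f (x + y) = f x + f y := by
    intro x y
    by_cases hxy : (y : WSpace C V) ∈ M.line (x : WSpace C V)
    · by_cases hx : x = 0
      · rw [hx, hf0, zero_add, zero_add]
      have hx0 : (x : WSpace C V) ≠ 0 := fun h => hx (Subtype.ext h)
      -- For dependent x and y, an auxiliary z off Cx reduces to the generic case, by evaluating f(x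
      -- + y + z) in two ways.
      obtain ⟨z, hz, hzx⟩ := M.exists_plane_notMem hv x
      lift z to M.plane v using hz
      have hle : ∀ a : M.plane v, (a : WSpace C V) ∈ M.line (x : WSpace C V) →
          (z : WSpace C V) ∉ M.line (a : WSpace C V) := fun a ha h => hzx (M.line_le_line ha h)
      have h1 := hadd1 (x + y) z (hle _ (Submodule.add_mem _ (M.self_mem_line _) hxy))
      have h2 := hadd1 x (y + z) (by
        rw [Submodule.coe_add, Submodule.add_mem_iff_right _ hxy]; exact hzx)
      rw [hadd1 y z (hle y hxy), ← add_assoc, h1, ← add_assoc] at h2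
      exact add_right_cancel h2
    · exact hadd1 x y hxy
  have hcont : Continuous (AddMonoidHom.mk' f hadd) := by
    refine continuous_of_continuousAt_zero _ ?_
    change Filter.Tendsto f (𝓝 0) (𝓝 (f 0))
    rw [hf0, ← M.tendsto_fin]
    have h1 : Filter.Tendsto (fun x : M.plane v => (CPW.fin (x : WSpace C V) : M.CPW)) (𝓝 0)
        (𝓝 (.fin 0)) := M.tendsto_fin.2 (continuous_subtype_val.tendsto (0 : M.plane v))
    have h2 : Filter.Tendsto G (𝓝 (.fin 0)) (𝓝 (.fin 0)) := by
      have := hc.tendsto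
      rwa [h0] at this
    exact (h2.comp h1).congr hf
  exact ⟨(AddMonoidHom.mk' f hadd).toRealLinearMap hcont, hf, hmem0⟩

/-! ### Conformality of line-preserving linear maps -/

/-- A quadratic identity that characterizes similarities of `C`. -/
lemma norm_eq_of_norm_conj (A : C →ₗ[ℝ] C)
    (h : ∀ ζ, ‖A ζ‖ * ‖A (M.conj ζ)‖ = ‖ζ‖ ^ 2 * ‖A M.one‖ ^ 2) (ζ : C) :
    ‖A ζ‖ = ‖A M.one‖ * ‖ζ‖ := by
  set a : ℝ := inner ℝ M.one ζ with ha
  set z := ζ - a • M.one with hz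
  have hz1 : inner ℝ M.one z = 0 := by
    rw [hz, inner_sub_right, inner_smul_right, M.inner_one_one, _root_.mul_one, sub_self]
  have hζ : ∀ r : ℝ, M.conj (r • M.one + z) = r • M.one - z := by
    intro r
    rw [M.conj_add, M.conj_smul, M.conj_one, conj, hz1]
    module
  have hn : ∀ r : ℝ, ‖r • M.one + z‖ ^ 2 = r ^ 2 + ‖z‖ ^ 2 := by
    intro r
    rw [norm_add_sq_real, norm_smul, M.norm_one, real_inner_smul_left, hz1, Real.norm_eq_abs,
      _root_.mul_one, sq_abs]
    ring
  set n := ‖A M.one‖ ^ 2 with hn'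
  set β : ℝ := inner ℝ (A M.one) (A z) with hβ
  have hA : ∀ r : ℝ, ‖A (r • M.one + z)‖ ^ 2 = r ^ 2 * n + 2 * r * β + ‖A z‖ ^ 2 := by
    intro r
    rw [map_add, map_smul, norm_add_sq_real, norm_smul, real_inner_smul_left, mul_pow,
      Real.norm_eq_abs, sq_abs]
    ring
  have hA' : ∀ r : ℝ, ‖A (r • M.one - z)‖ ^ 2 = r ^ 2 * n - 2 * r * β + ‖A z‖ ^ 2 := by
    intro r
    rw [map_sub, map_smul, norm_sub_sq_real, norm_smul, real_inner_smul_left, mul_pow,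
      Real.norm_eq_abs, sq_abs]
    ring
  -- The hypothesis is applied to r + z with z orthogonal to 1. The value r = 0 gives |Az|² =
  -- |z|²|A1|², and then r = 1 gives that A1 and Az are orthogonal.
  have key : ∀ r : ℝ, (r ^ 2 * n + 2 * r * β + ‖A z‖ ^ 2) * (r ^ 2 * n - 2 * r * β + ‖A z‖ ^ 2)
      = ((r ^ 2 + ‖z‖ ^ 2) * n) ^ 2 := by
    intro r
    have := congrArg (· ^ 2) (h (r • M.one + z))
    simp only [mul_pow] at this
    rw [hζ, hn, hA, hA'] at this
    rw [this, mul_pow]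
  have h0 : ‖A z‖ ^ 2 = ‖z‖ ^ 2 * n := by
    have := key 0
    have h1 : (‖A z‖ ^ 2) ^ 2 = (‖z‖ ^ 2 * n) ^ 2 := by linarith
    exact (sq_eq_sq₀ (by positivity) (by positivity)).1 h1
  have hβ0 : β = 0 := by
    have := key 1
    rw [h0] at this
    have : β ^ 2 = 0 := by linarith
    exact pow_eq_zero_iff (two_ne_zero) |>.1 this
  have hfin : ‖A ζ‖ ^ 2 = (‖A M.one‖ * ‖ζ‖) ^ 2 := by
    have e : ζ = a • M.one + z := by rw [hz]; abel
    rw [e, hA, hβ0, h0, mul_pow, hn]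
    ring
  exact (sq_eq_sq₀ (norm_nonneg _) (by positivity)).1 hfin

/-- An injective linear map of the plane `C ⊕ Cv` that maps lines to lines, and the line `C ⊕ 0` to
itself, is a similarity on `C ⊕ 0`. -/
lemma similarity_of_linear {v : V} (hv : v ≠ 0)
    (f : M.plane v →L[ℝ] WSpace C V)
    (hf : ∀ x y : M.plane v, (y : WSpace C V) ∈ M.line (x : WSpace C V) ↔ f y ∈ M.line (f x))
    {α : C} (h1 : f ⟨pr M.one 0, Submodule.mem_sup_left (M.self_mem_line _)⟩ = pr α 0) :
    α ≠ 0 ∧ ∃ A : C →ₗ[ℝ] C, (∀ ζ, ∀ x : M.plane v, (x : WSpace C V) = pr ζ 0 → f x = pr (A ζ) 0) ∧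
      ∀ ζ, ‖A ζ‖ = ‖α‖ * ‖ζ‖ := by
  have hmem : ∀ ζ ξ : C, pr ζ (M.J ξ v) ∈ M.plane v := fun ζ ξ =>
    M.mem_infLine_aux.2 ⟨ξ, by rw [map_zero, zero_add]; rfl⟩
  let ι : C × C →ₗ[ℝ] M.plane v := LinearMap.codRestrict (M.plane v)
    ((WithLp.linearEquiv 2 ℝ (C × V)).symm.toLinearMap ∘ₗ
      (LinearMap.prodMap LinearMap.id (M.J.flip v))) fun c => hmem c.1 c.2
  have hι : ∀ ζ ξ, (ι (ζ, ξ) : WSpace C V) = pr ζ (M.J ξ v) := fun ζ ξ => rfl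
  have hfz : ∀ x : M.plane v, f x = 0 → x = 0 := by
    intro x hx
    have := (hf 0 x).2 (by rw [map_zero, hx]; exact Submodule.zero_mem _)
    rw [Submodule.coe_zero, line_zero, Submodule.mem_bot] at this
    exact Subtype.ext this
  have hι1 : f (ι (M.one, 0)) = pr α 0 := by
    rw [← h1]; congr 1
    refine Subtype.ext ?_
    rw [hι, map_zero, LinearMap.zero_apply]
  have hα : α ≠ 0 := by
    rintro rfl
    have h := hfz _ hι1
    have h' : (ι (M.one, 0) : WSpace C V) = 0 := by rw [h]; rfl
    exact M.pr_one_ne _ h'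
  have hC : ∀ w : WSpace C V, w ∈ M.line (pr α (0 : V)) ↔ w.snd = 0 := by
    intro w
    rw [M.line_of_ne hα, map_zero, mem_line_one, map_zero]
  set A : C →ₗ[ℝ] C := WithLp.fstₗ 2 ℝ C V ∘ₗ f.toLinearMap ∘ₗ ι ∘ₗ LinearMap.inl ℝ C C with hA
  have hAf : ∀ ζ, f (ι (ζ, 0)) = pr (A ζ) 0 := by
    intro ζ
    have h2 : (f (ι (ζ, 0))).snd = 0 := by
      rw [← hC, ← hι1, ← hf, hι, hι, mem_line_one]
      simp
    rw [← h2]; rfl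
  have hA1 : A M.one = α := by
    have := (hAf M.one).symm.trans hι1
    exact (pr_inj.1 this).1
  set S : C →ₗ[ℝ] C := WithLp.fstₗ 2 ℝ C V ∘ₗ f.toLinearMap ∘ₗ ι ∘ₗ LinearMap.inr ℝ C C with hS
  set B : C →ₗ[ℝ] V := WithLp.sndₗ 2 ℝ C V ∘ₗ f.toLinearMap ∘ₗ ι ∘ₗ LinearMap.inr ℝ C C with hB
  have hSB : ∀ ζ ξ, f (ι (ζ, ξ)) = pr (A ζ + S ξ) (B ξ) := by
    intro ζ ξ
    have e : ((ζ, ξ) : C × C) = (ζ, 0) + (0, ξ) := by simp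
    rw [e, map_add, map_add, hAf]
    refine wext rfl ?_
    exact zero_add _
  have hB0 : ∀ ξ, B ξ = 0 → ξ = 0 := by
    intro ξ hξ
    have h2 : f (ι (0, ξ)) ∈ M.line (f (ι (M.one, 0))) := by
      rw [hι1, hC, hSB]; exact hξ
    rw [← hf, hι, hι, map_zero, LinearMap.zero_apply, mem_line_one, map_zero] at h2
    exact (M.J_eq_zero.1 h2).resolve_right hv
  -- The points (1,tξv) and (ζ,tθv) lie on one line. After f is applied and the V-component divided
  -- by t, letting t → 0 removes the unknown shear S.
  have key : ∀ ζ ξ θ, M.J ζ (M.J ξ v) = M.J θ v → B θ = M.J (A ζ) (M.J (M.inv α) (B ξ)) := by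
    intro ζ ξ θ h
    have hcurve : ∀ t : ℝ, α + t • S ξ ≠ 0 → t ≠ 0 →
        B θ = M.J (A ζ + t • S θ) (M.J (M.inv (α + t • S ξ)) (B ξ)) := by
      intro t ht ht0
      have h2 : f (ι (ζ, t • θ)) ∈ M.line (f (ι (M.one, t • ξ))) := by
        rw [← hf, hι, hι, mem_line_one]
        change M.J (t • θ) v = M.J ζ (M.J (t • ξ) v)
        rw [map_smul, map_smul, LinearMap.smul_apply, LinearMap.smul_apply, map_smul, h]
      rw [hSB, hSB, map_smul, map_smul, map_smul, map_smul, hA1, M.line_of_ne ht,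
        mem_line_one] at h2
      have h3 : t • B θ = M.J (A ζ + t • S θ) (M.J (M.inv (α + t • S ξ)) (t • B ξ)) := h2
      rw [map_smul, map_smul] at h3
      exact smul_right_injective V ht0 h3
    have hev : ∀ᶠ t : ℝ in 𝓝[≠] 0,
        M.J (A ζ + t • S θ) (M.J (M.inv (α + t • S ξ)) (B ξ)) = B θ := by
      have hc : Continuous fun t : ℝ => α + t • S ξ := by fun_prop
      have h3 : ∀ᶠ t : ℝ in 𝓝 0, α + t • S ξ ≠ 0 :=
        hc.continuousAt.eventually_ne (by simpa using hα)
      filter_upwards [h3.filter_mono nhdsWithin_le_nhds, self_mem_nhdsWithin] with t h4 h5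
      exact (hcurve t h4 h5).symm
    have hcont : ContinuousAt
        (fun t : ℝ => M.J (A ζ + t • S θ) (M.J (M.inv (α + t • S ξ)) (B ξ))) 0 := by
      refine (M.contDiffAt_J (E := ℝ) (x := 0) (f := fun t : ℝ => A ζ + t • S θ)
        (g := fun t : ℝ => M.J (M.inv (α + t • S ξ)) (B ξ)) ?_ (M.contDiffAt_J
          (M.contDiffAt_inv ?_ (by simpa using hα)) contDiffAt_const)).continuousAt
      · exact contDiffAt_const.add (contDiffAt_id.smul contDiffAt_const)
      · exact contDiffAt_const.add (contDiffAt_id.smul contDiffAt_const)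
    have h6 := hcont.tendsto.mono_left (nhdsWithin_le_nhds (s := {0}ᶜ))
    rw [zero_smul, zero_smul, add_zero, add_zero] at h6
    exact tendsto_nhds_unique (tendsto_const_nhds.congr' (hev.mono fun _ h => h.symm)) h6
  refine ⟨hα, A, fun ζ x hx => ?_, fun ζ => ?_⟩
  · rw [← hAf]; congr 1
    refine Subtype.ext ?_
    rw [hx, hι, map_zero, LinearMap.zero_apply]
  · rw [← hA1]
    refine M.norm_eq_of_norm_conj A (fun ζ => ?_) ζ
    have e1 : M.J ζ (M.J M.one v) = M.J ζ v := by rw [M.J_one]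
    -- The norms in these two instances give |Aζ||Aζ̄| = |ζ|²|A1|² after cancellation of |B1| ≠ 0.
    have k1 := key ζ M.one ζ e1
    have e2 : M.J (M.conj ζ) (M.J ζ v) = M.J (‖ζ‖ ^ 2 • M.one) v := by
      rw [M.J_conj_J, map_smul, LinearMap.smul_apply, M.J_one]
    have k2 := key (M.conj ζ) ζ _ e2
    have n1 := congrArg norm k1
    have n2 := congrArg norm k2
    rw [map_smul, norm_smul, norm_pow, norm_norm, M.norm_J, M.norm_J, M.norm_inv] at n2
    rw [M.norm_J, M.norm_J, M.norm_inv] at n1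
    rw [n1] at n2
    have hb : ‖B M.one‖ ≠ 0 := norm_ne_zero_iff.2 fun h => M.one_ne_zero (hB0 _ h)
    have ha : ‖α‖ ≠ 0 := norm_ne_zero_iff.2 hα
    rw [hA1]
    field_simp at n2
    linarith

/-! ### Tangent spaces and conformality -/

variable {M} in
lemma Rep.tangent_mono {h : M.CPW → M.CPW} {φ ψ : WSpace C V → M.CPW} {x y : WSpace C V}
    {F : WSpace C V → WSpace C V} (hF : M.Rep h φ ψ x y F) {L L' : Set M.CPW}
    (hL : ∀ p ∈ L, h p ∈ L') {X : WSpace C V} (hX : X ∈ M.tangent φ L x) :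
    fderiv ℝ F x X ∈ M.tangent ψ L' y := by
  obtain ⟨γ, h0, h1, h2, h3⟩ := hX
  obtain ⟨hy, hs, he⟩ := hF
  refine ⟨F ∘ γ, ?_, ?_, ?_, ?_⟩
  · rw [Function.comp_apply, h0, hy]
  · exact ContDiffAt.comp (0 : ℝ) (by rw [h0]; exact hs) h1
  · have hd : HasFDerivAt F (fderiv ℝ F x) (γ 0) := by
      rw [h0]; exact (hs.differentiableAt (by simp)).hasFDerivAt
    rw [← h2]
    exact (hd.comp_hasDerivAt (0 : ℝ) (h1.differentiableAt (by simp)).hasDerivAt).deriv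
  · have hc : Filter.Tendsto γ (𝓝 0) (𝓝 x) := by
      rw [← h0]; exact h1.continuousAt.tendsto
    filter_upwards [h3, hc.eventually he] with t h4 h5
    rw [Function.comp_apply, ← h5]
    exact hL _ h4

variable {M} in
/-- Isometries map tangent spaces onto tangent spaces. -/
lemma Rep.image_tangent {u : M.CPW ≃ M.CPW} {φ ψ : WSpace C V → M.CPW} {x y : WSpace C V}
    {F : WSpace C V → WSpace C V} (hF : M.Rep u φ ψ x y F)
    (hinj : Function.Injective (fderiv ℝ F x)) (L : Set M.CPW) :
    fderiv ℝ F x '' M.tangent φ L x = M.tangent ψ (u '' L) y := by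
  obtain ⟨G, hG, hGF⟩ := hF.symm hinj
  ext Y
  constructor
  · rintro ⟨X, hX, rfl⟩
    exact hF.tangent_mono (L' := u '' L) (fun p hp => ⟨p, hp, rfl⟩) hX
  · intro hY
    refine ⟨_, hG.tangent_mono ?_ hY, hGF Y⟩
    rintro _ ⟨q, hq, rfl⟩
    rwa [Equiv.symm_apply_apply]

/-- The projective line `C ⊕ 0` with its point at infinity. -/
def axis : Set M.CPW := M.projLine 0 (pr M.one 0)

variable {M} in
lemma fin_mem_axis {w : WSpace C V} : CPW.fin w ∈ M.axis ↔ w.snd = 0 := by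
  rw [axis, fin_mem_projLine (M.pr_one_ne 0), sub_zero, mem_line_one, map_zero]

lemma tangent_axis : M.tangent .fin M.axis 0 = {X | X.snd = 0} := by
  ext X
  constructor
  · rintro ⟨γ, h0, h1, h2, h3⟩
    have hd := hasDerivAt_wsnd (h1.differentiableAt (by simp)).hasDerivAt
    rw [h2] at hd
    have he : (fun s => (γ s).snd) =ᶠ[𝓝 0] fun _ => (0 : V) := by
      filter_upwards [h3] with t ht
      exact fin_mem_axis.1 ht
    exact (hd.congr_of_eventuallyEq he.symm).unique (hasDerivAt_const (0 : ℝ) (0 : V))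
  · intro hX
    have hX : X.snd = 0 := hX
    refine ⟨fun t => t • X, zero_smul ℝ X, contDiffAt_id.smul contDiffAt_const, ?_, ?_⟩
    · have : HasDerivAt (fun t : ℝ => t • X) X 0 := by
        simpa using (hasDerivAt_id (0 : ℝ)).smul_const X
      exact this.deriv
    · refine Filter.Eventually.of_forall fun t => ?_
      rw [fin_mem_axis, WithLp.smul_snd, hX, smul_zero]

/-- The isometries act transitively on the incident pairs of points and lines. -/
lemma exists_gen_axis [Nontrivial V] {L : Set M.CPW} (hL : M.IsStd L) {p : M.CPW} (hp : p ∈ L) :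
    ∃ u, M.Gen u ∧ u p = .fin 0 ∧ u '' L = M.axis := by
  obtain ⟨r, hr, h0⟩ := M.exists_gen_zero p
  have h1 := hL.gen hr
  have h2 : CPW.fin 0 ∈ r '' L := ⟨p, hp, h0⟩
  rcases h1 with ⟨w₀, w, hw, h1⟩ | ⟨x, y, hx, hy, h1⟩
  · obtain ⟨T, hT, a, ha, h⟩ := M.exists_isSpread_fst hw
    refine ⟨r.trans (ext hT), hr.trans (.ext hT), ?_, ?_⟩
    · rw [Homeomorph.trans_apply, h0, ext_fin, map_zero]
    · rw [h1, fin_mem_projLine hw] at h2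
      have h3 : ext hT '' (r '' L) = M.axis := by
        rw [h1, projLine_congr hw hw rfl h2, M.image_ext_projLine hT _ hw, map_zero, h, axis]
        have ha' : pr a (0 : V) ≠ 0 := fun h => ha (pr_eq_zero.1 h).1
        refine projLine_congr ha' (M.pr_one_ne 0) ?_ ?_
        · rw [M.line_of_ne ha, map_zero]
        · rw [sub_zero]; exact Submodule.zero_mem _
      rwa [← Set.image_comp] at h3
  · rw [h1] at h2
    obtain ⟨z, _, hz, h⟩ := h2
    exact absurd h.symm (infPt_ne_fin hz)

variable {M} in
lemma Rep.continuousAt {h : M.CPW → M.CPW} {x y : WSpace C V} {F : WSpace C V → WSpace C V}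
    (hF : M.Rep h .fin .fin x y F) : ContinuousAt h (.fin x) := by
  obtain ⟨hy, hs, he⟩ := hF
  rw [ContinuousAt, ← M.isOpenEmbedding_fin.map_nhds_eq, Filter.tendsto_map'_iff,
    he.self_of_nhds]
  have h1 : Filter.Tendsto (fun a => (CPW.fin (F a) : M.CPW)) (𝓝 x) (𝓝 (.fin (F x))) :=
    M.tendsto_fin.2 hs.continuousAt
  exact h1.congr' (he.mono fun a ha => ha.symm)

/-- Near the origin, a collineation that fixes the origin is conformal on the axis. -/
lemma exists_conformal [Nontrivial V] (G : M.CPW ≃ₜ M.CPW)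
    (hG : ∀ L, M.IsStd L → M.IsStd (G '' L)) (h0 : G (.fin 0) = .fin 0) :
    ∃ H : WSpace C V → WSpace C V, H 0 = 0 ∧ ContDiffAt ℝ ∞ H 0 ∧
      (∀ᶠ ζ : C in 𝓝 0, G (.fin (pr ζ 0)) = .fin (H (pr ζ 0))) ∧
      ∃ c : ℝ, 0 < c ∧ ∀ ζ : C, ‖fderiv ℝ H 0 (pr ζ 0)‖ = c * ‖ζ‖ := by
  obtain ⟨v, hv⟩ := exists_ne (0 : V)
  have hN : M.IsStd (G '' M.infLine (pr M.one 0) (pr 0 v)) := by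
    refine hG _ (Or.inr ⟨_, _, M.pr_one_ne 0, ?_, rfl⟩)
    rw [mem_line_one, map_zero]; exact hv
  -- The image line misses the origin because G is injective and already takes the finite point 0 to
  -- 0.
  obtain ⟨K, hK, hKinf, F, hF, hFn⟩ := hN.exists_move (by
    rintro ⟨_, ⟨z, _, hz, rfl⟩, h⟩
    rw [← h0] at h
    exact infPt_ne_fin hz (G.injective h))
  have hK0 : K (.fin 0) = .fin 0 := by
    have := hF.2.2.self_of_nhds
    rwa [hF.1] at this
  obtain ⟨f₀, hf₀, hf₀l⟩ := M.exists_linear_of_isStd hv (G.toEquiv.trans K)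
    (fun L hL => by
      have := hK _ (hG L hL)
      rwa [← Set.image_comp] at this)
    ((congrArg K h0).trans hK0)
    (ContinuousAt.comp (g := K) (f := G) (by rw [h0]; exact hF.continuousAt)
      G.continuous.continuousAt)
    (fun p hp => hKinf (G p) ⟨p, hp, rfl⟩)
  set e : M.plane v := ⟨pr M.one 0, Submodule.mem_sup_left (M.self_mem_line _)⟩ with he
  have hfe : f₀ e ≠ 0 := by
    intro h
    have h1 := (hf₀l 0 e).2 (by rw [h, map_zero]; exact Submodule.zero_mem _)
    rw [Submodule.coe_zero, line_zero, Submodule.mem_bot] at h1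
    exact M.pr_one_ne 0 h1
  obtain ⟨T, hT, α, hα, hTα⟩ := M.exists_isSpread_fst hfe
  obtain ⟨hα', A, hA, hAn⟩ := M.similarity_of_linear hv
    (T.toContinuousLinearEquiv.toContinuousLinearMap ∘L f₀)
    (fun x y => (hf₀l x y).trans (hT (f₀ x) (f₀ y)).symm) (α := α) hTα
  have hinj : Function.Injective (fderiv ℝ F 0) := by
    rw [injective_iff_map_eq_zero]
    intro X hX
    rw [← norm_eq_zero, ← hFn, hX, norm_zero]
  obtain ⟨F', hF', hFF'⟩ := hF.symm hinj
  -- B is the linear expression of K∘G on the axis, extended to W by ignoring the V-component. Then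
  -- G is the local inverse of K after B near 0 on the axis.
  set B : WSpace C V →L[ℝ] WSpace C V := LinearMap.toContinuousLinearMap
    (T.symm.toLinearEquiv.toLinearMap ∘ₗ (WithLp.linearEquiv 2 ℝ (C × V)).symm.toLinearMap ∘ₗ
      LinearMap.inl ℝ C V ∘ₗ A ∘ₗ WithLp.fstₗ 2 ℝ C V) with hB
  have hBp : ∀ ζ, B (pr ζ 0) = T.symm (pr (A ζ) 0) := fun ζ => rfl
  have hmem : ∀ ζ : C, pr ζ 0 ∈ M.plane v := fun ζ => M.mem_infLine_aux.2 ⟨0, by simp⟩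
  have hKG : ∀ ζ, K (G (.fin (pr ζ 0))) = .fin (B (pr ζ 0)) := by
    intro ζ
    have h1 := hf₀ ⟨pr ζ 0, hmem ζ⟩
    have h2 := hA ζ ⟨pr ζ 0, hmem ζ⟩ rfl
    have h3 : T (f₀ ⟨pr ζ 0, hmem ζ⟩) = pr (A ζ) 0 := h2
    rw [hBp, ← h3, T.symm_apply_apply]
    exact h1
  refine ⟨F' ∘ B, ?_, ?_, ?_, ‖α‖, norm_pos_iff.2 hα, fun ζ => ?_⟩
  · rw [Function.comp_apply, map_zero, hF'.1]
  · exact ContDiffAt.comp 0 (by rw [map_zero]; exact hF'.2.1) B.contDiff.contDiffAt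
  · have hc : Filter.Tendsto (fun ζ : C => B (pr ζ 0)) (𝓝 0) (𝓝 0) := by
      have : Continuous fun ζ : C => B (pr ζ 0) :=
        B.continuous.comp ((WithLp.prod_continuous_toLp 2 C V).comp
          (continuous_id.prodMk continuous_const))
      have h1 := this.tendsto 0
      have h2 : B (pr 0 0) = 0 := map_zero B
      rwa [h2] at h1
    filter_upwards [hc.eventually hF'.2.2] with ζ hζ
    rw [Function.comp_apply, ← hζ, ← hKG, Equiv.symm_apply_apply]
  · have hd : fderiv ℝ (F' ∘ B) 0 (pr ζ 0) = fderiv ℝ F' 0 (B (pr ζ 0)) := by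
      have h1 : HasFDerivAt F' (fderiv ℝ F' 0) (B 0) := by
        rw [map_zero]; exact (hF'.2.1.differentiableAt (by simp)).hasFDerivAt
      rw [(h1.comp 0 B.hasFDerivAt).fderiv]; rfl
    rw [hd, ← hFn, hFF', hBp, LinearIsometryEquiv.norm_map, ← hAn]
    have h1 : ‖pr (A ζ) (0 : V)‖ ^ 2 = ‖A ζ‖ ^ 2 := by
      rw [norm_pr_sq, norm_zero]; ring
    exact (sq_eq_sq₀ (norm_nonneg _) (norm_nonneg _)).1 h1

variable {M} in
-- Isometries move p and its image to the origin, and L and g(L) to the axis. There the tangent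
-- space is C ⊕ 0 with the Euclidean metric, so `exists_conformal` suffices.
lemma IsCollineation.isConformalOn [Nontrivial V] {g : M.CPW ≃ₜ M.CPW} (hg : M.IsCollineation g)
    {L : Set M.CPW} (hL : M.IsProjLine L) : M.IsConformalOn g L := by
  have hgS : ∀ N, M.IsStd N → M.IsStd (g '' N) := fun N hN =>
    (M.isProjLine_iff _).1 (hg _ ((M.isProjLine_iff N).2 hN))
  have hLS := (M.isProjLine_iff L).1 hL
  intro φ hφ ψ hψ x y hx hxy
  obtain ⟨u, hu, hu0, huL⟩ := M.exists_gen_axis hLS hx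
  obtain ⟨r, hr, hr0, hrL⟩ := M.exists_gen_axis (hgS L hLS) ⟨φ x, hx, hxy⟩
  have hfin : (CPW.fin : WSpace C V → M.CPW) ∈ M.atlas := Or.inl (Or.inl rfl)
  have hr0' : r.symm (.fin 0) = ψ y := by rw [← hr0, r.symm_apply_apply]
  have hu0' : u.symm (.fin 0) = φ x := by rw [← hu0, u.symm_apply_apply]
  obtain ⟨U, hU, hUm⟩ := (M.isIsom_iff u).1 hu.isIsom φ hφ _ hfin x 0 hu0
  obtain ⟨R, hR, hRm⟩ := (M.isIsom_iff r.symm).1 hr.symm.isIsom _ hfin ψ hψ 0 y hr0'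
  have huL' : u.symm '' M.axis = L := by
    rw [← huL, ← Set.image_comp]; simp
  have hrL' : r.symm '' M.axis = g '' L := by
    rw [← hrL, ← Set.image_comp]; simp
  obtain ⟨H, hH0, hHs, hHG, c, hc, hHn⟩ := M.exists_conformal (u.symm.trans (g.trans r))
    (fun N hN => by
      have := (hgS _ (hN.gen hu.symm)).gen hr
      rwa [← Set.image_comp, ← Set.image_comp] at this)
    (by rw [Homeomorph.trans_apply, Homeomorph.trans_apply, hu0', hxy, hr0])
  set G := u.symm.trans (g.trans r) with hGdef
  have hGu : ∀ p, r.symm (G (u p)) = g p := by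
    intro p
    simp [hGdef]
  have hGaxis : ∀ p ∈ M.axis, G p ∈ M.axis := by
    intro p hp
    rw [← hrL]
    refine ⟨g (u.symm p), ⟨_, ?_, rfl⟩, rfl⟩
    rw [← huL']; exact ⟨p, hp, rfl⟩
  have htan : fderiv ℝ U x '' M.tangent φ L x = {X | X.snd = 0} := by
    rw [← M.tangent_axis, ← huL]
    exact Rep.image_tangent (u := u.toEquiv) hU (M.injective_of_metric hUm) L
  have htan' : fderiv ℝ R 0 '' {X | X.snd = 0} = M.tangent ψ (g '' L) y := by
    rw [← M.tangent_axis, ← hrL']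
    exact Rep.image_tangent (u := r.symm.toEquiv) hR (M.injective_of_metric hRm) M.axis
  have hHrep : ∀ᶠ w in 𝓝[{w : WSpace C V | w.snd = 0}] 0, G (.fin w) = .fin (H w) := by
    have h1 : Filter.Tendsto (fun w : WSpace C V => w.fst)
        (𝓝[{w : WSpace C V | w.snd = 0}] 0) (𝓝 0) :=
      (contDiff_wfst.continuous.tendsto (0 : WSpace C V)).mono_left nhdsWithin_le_nhds
    filter_upwards [h1.eventually hHG, self_mem_nhdsWithin] with w hw hw'
    have hw' : w.snd = 0 := hw'
    have e : w = pr w.fst 0 := by rw [← hw']; rfl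
    rw [e]; exact hw
  have hdH : ∀ X : WSpace C V, X.snd = 0 → ‖fderiv ℝ H 0 X‖ = c * ‖X‖ := by
    intro X hX
    have e : X = pr X.fst 0 := by rw [← hX]; rfl
    have h1 : ‖X‖ ^ 2 = ‖X.fst‖ ^ 2 := by rw [wnorm_sq, hX, norm_zero]; ring
    rw [(sq_eq_sq₀ (norm_nonneg _) (norm_nonneg _)).1 h1, ← hHn, ← e]
  -- H is an arbitrary extension of G off the axis; that its differential preserves C ⊕ 0 follows
  -- because G maps the axis into itself.
  have hdH' : ∀ X : WSpace C V, X.snd = 0 → (fderiv ℝ H 0 X).snd = 0 := by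
    intro X hX
    have hX' : X ∈ M.tangent .fin M.axis 0 := by rw [tangent_axis]; exact hX
    have h1 : fderiv ℝ H 0 X ∈ M.tangent .fin M.axis 0 := by
      have hγ : HasDerivAt (fun t : ℝ => t • X) X 0 := by
        simpa using (hasDerivAt_id (0 : ℝ)).smul_const X
      have hγs : ContDiffAt ℝ ∞ (fun t : ℝ => t • X) 0 := contDiffAt_id.smul contDiffAt_const
      refine ⟨fun t => H (t • X), by simp [hH0], ?_, ?_, ?_⟩
      · exact ContDiffAt.comp (0 : ℝ) (by rw [zero_smul]; exact hHs) hγs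
      · have hd : HasFDerivAt H (fderiv ℝ H 0) ((0 : ℝ) • X) := by
          rw [zero_smul]; exact (hHs.differentiableAt (by simp)).hasFDerivAt
        exact (hd.comp_hasDerivAt (0 : ℝ) hγ).deriv
      · have hs : ∀ t : ℝ, (t • X).snd = 0 := fun t => by rw [WithLp.smul_snd, hX, smul_zero]
        have h2 : Filter.Tendsto (fun t : ℝ => t • X) (𝓝 0)
            (𝓝[{w : WSpace C V | w.snd = 0}] 0) := by
          refine tendsto_nhdsWithin_iff.2 ⟨?_, Filter.Eventually.of_forall hs⟩
          have := hγ.continuousAt.tendsto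
          rwa [zero_smul] at this
        filter_upwards [h2.eventually hHrep] with t ht
        rw [← ht]
        exact hGaxis _ (fin_mem_axis.2 (hs t))
    rw [tangent_axis] at h1
    exact h1
  -- The differential scales norms by c > 0 on C ⊕ 0, so it is injective there, and surjective by
  -- dimension.
  have himH : fderiv ℝ H 0 '' {X | X.snd = 0} = {X | X.snd = 0} := by
    let D : C →ₗ[ℝ] C := WithLp.fstₗ 2 ℝ C V ∘ₗ (fderiv ℝ H 0).toLinearMap ∘ₗ
      (WithLp.linearEquiv 2 ℝ (C × V)).symm.toLinearMap ∘ₗ LinearMap.inl ℝ C V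
    have hD : ∀ ζ, fderiv ℝ H 0 (pr ζ 0) = pr (D ζ) 0 := fun ζ =>
      wext rfl (hdH' (pr ζ 0) rfl)
    have hDi : Function.Injective D := by
      rw [injective_iff_map_eq_zero]
      intro ζ hζ
      have h1 := hHn ζ
      rw [hD, hζ] at h1
      have h2 : ‖pr (0 : C) (0 : V)‖ = 0 := norm_zero
      rw [h2] at h1
      have := mul_eq_zero.1 h1.symm
      exact norm_eq_zero.1 (this.resolve_left hc.ne')
    have hDs := (LinearMap.injective_iff_surjective (f := D)).1 hDi
    ext Y
    constructor
    · rintro ⟨X, hX, rfl⟩; exact hdH' X hX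
    · intro hY
      have hY : Y.snd = 0 := hY
      obtain ⟨ζ, hζ⟩ := hDs Y.fst
      refine ⟨pr ζ 0, rfl, ?_⟩
      rw [hD, hζ, ← hY]; rfl
  have hFd : ∀ X, fderiv ℝ (R ∘ H ∘ U) x X = fderiv ℝ R 0 (fderiv ℝ H 0 (fderiv ℝ U x X)) := by
    intro X
    have h1 := (hU.2.1.differentiableAt (by simp)).hasFDerivAt
    have h2 : HasFDerivAt H (fderiv ℝ H 0) (U x) := by
      rw [hU.1]; exact (hHs.differentiableAt (by simp)).hasFDerivAt
    have h3 : HasFDerivAt R (fderiv ℝ R 0) ((H ∘ U) x) := by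
      rw [Function.comp_apply, hU.1, hH0]; exact (hR.2.1.differentiableAt (by simp)).hasFDerivAt
    rw [(h3.comp x (h2.comp x h1)).fderiv]; rfl
  refine ⟨R ∘ H ∘ U, ?_, ?_, ?_, ?_, c, hc, ?_⟩
  · simp only [Function.comp_apply, hU.1, hH0, hR.1]
  · have h2 : ContDiffAt ℝ ∞ (H ∘ U) x :=
      ContDiffAt.comp x (by rw [hU.1]; exact hHs) hU.2.1
    exact ContDiffAt.comp x (by rw [Function.comp_apply, hU.1, hH0]; exact hR.2.1) h2
  · have hUt : Filter.Tendsto U (𝓝 x) (𝓝 0) := by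
      have := hU.2.1.continuousAt.tendsto
      rwa [hU.1] at this
    have hmem : ∀ᶠ x' in 𝓝[φ ⁻¹' L] x, U x' ∈ {w : WSpace C V | w.snd = 0} := by
      filter_upwards [nhdsWithin_le_nhds hU.2.2, self_mem_nhdsWithin] with x' h1 h2
      have h3 : u (φ x') ∈ M.axis := by rw [← huL]; exact ⟨_, h2, rfl⟩
      rw [h1] at h3
      exact fin_mem_axis.1 h3
    have hUt' : Filter.Tendsto U (𝓝[φ ⁻¹' L] x) (𝓝[{w : WSpace C V | w.snd = 0}] 0) :=
      tendsto_nhdsWithin_iff.2 ⟨hUt.mono_left nhdsWithin_le_nhds, hmem⟩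
    have hHt : Filter.Tendsto H (𝓝 0) (𝓝 0) := by
      have := hHs.continuousAt.tendsto
      rwa [hH0] at this
    filter_upwards [nhdsWithin_le_nhds hU.2.2, hUt'.eventually hHrep,
      nhdsWithin_le_nhds ((hHt.comp hUt).eventually hR.2.2)] with x' h1 h2 h3
    rw [← hGu, h1, h2]
    exact h3
  · have e : fderiv ℝ (R ∘ H ∘ U) x '' M.tangent φ L x
        = fderiv ℝ R 0 '' (fderiv ℝ H 0 '' (fderiv ℝ U x '' M.tangent φ L x)) := by
      rw [← Set.image_comp, ← Set.image_comp]
      exact Set.image_congr fun X _ => hFd X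
    rw [e, htan, himH, htan']
  · intro X hX Y hY
    have hX' : (fderiv ℝ U x X).snd = 0 := by
      have : fderiv ℝ U x X ∈ {X : WSpace C V | X.snd = 0} := htan ▸ ⟨X, hX, rfl⟩
      exact this
    have hY' : (fderiv ℝ U x Y).snd = 0 := by
      have : fderiv ℝ U x Y ∈ {X : WSpace C V | X.snd = 0} := htan ▸ ⟨Y, hY, rfl⟩
      exact this
    rw [hFd, hFd, M.metric_of_self hRm, ← M.metric_of_self hUm X Y, metric_zero, metric_zero]
    set a := fderiv ℝ U x X
    set b := fderiv ℝ U x Y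
    -- Scaling of norms by c is polarized to scaling of inner products by c².
    have hab : (a + b).snd = 0 := by rw [WithLp.add_snd, hX', hY', add_zero]
    have n1 := hdH _ hX'
    have n2 := hdH _ hY'
    have n3 := hdH _ hab
    rw [map_add] at n3
    have n4 := norm_add_sq_real (fderiv ℝ H 0 a) (fderiv ℝ H 0 b)
    have n5 := norm_add_sq_real a b
    rw [n1, n2, n3, mul_pow, n5] at n4
    linarith

end J2CModule

end

theorem theorem10p4 {C V : Type*} [NormedAddCommGroup C] [InnerProductSpace ℝ C]
    [FiniteDimensional ℝ C] [NormedAddCommGroup V] [InnerProductSpace ℝ V]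
    [FiniteDimensional ℝ V] [Nontrivial V] (M : J2CModule C V)
    (g : M.CPW ≃ₜ M.CPW) (hg : M.IsCollineation g) (L : Set M.CPW) (hL : M.IsProjLine L) :
    M.IsConformalOn g L :=
  hg.isConformalOn hL
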